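/- **Setting.** Let $d\ge 1$, let $\Omega\subset\mathbb R^d$ be open and bounded with smooth boundary and outer unit normal $\nu$, let $T>0$ and $N\in\mathbb N$. Let $x_0\in\mathbb R^d$, put $r(x)=|x-x_0|$, and assume $r(x)>1$ for all $x\in\overline\Omega$ and $b>\max_{\overline\Omega} r$. Let $(\Psi_n)_{n\ge1}$ be an orthonormal basis of $L^2(0,T)$ consisting of absolutely continuous functions on $[0,T]$ (for instance $C^1$ functions). Let $c\in C^1(\mathbb R^d)$ with $c\ge c_0>0$ and $q\in C^1(\mathbb R)$, and let $f_m,g_m\in L^2(\partial\Omega)$, $1\le m\le N$. Set $$s_{mn}=\int_0^T\Psi_n'(t)\Psi_m(t)\,dt,\qquad q_m(s_1,\dots,s_N)=\int_0^T q\Big(\sum_{n=1}^N s_n\Psi_n(t)\Big)\Psi_m(t)\,dt ,$$ $$H=\{(u_m)\in H^2(\Omega)^N:\ u_m=f_m,\ \partial_\nu u_m=g_m\ \text{on }\partial\Omega,\ 1\le m\le N\}.$$ Assume that the problem: find $(u_m)_{m=1}^N\in H$ with $$c(x)\sum_{n=1}^N s_{mn}u_n(x)=\Delta u_m(x)+q_m(u_1(x),\dots,u_N(x))\quad\text{for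 a.e. }x\in\Omega,\ 1\le m\le N,$$ has a unique solution $(u_m^*)_{m=1}^N$. Put $u^*(x,t)=\sum_{n=1}^N u_n^*(x)\Psi_n(t)$ and $p^*(x)=u^*(x,0)$, and let $M>\|u^*\|_{L^\infty(\Omega\times[0,T])}$. Let $P(s)=\max\{-M\sqrt T,\min\{M\sqrt T,s\}\}$. Let $Q$ be an upper bound of $|q|$ and $|q'|$ on the set of values of $\sum_n s_n\Psi_n(t)$ with $t\in[0,T]$ and $|s_n|\le M\sqrt T$. For $\beta,\lambda>0$ let $u^{(0)}=(u^{(0)}_m)$ be a minimizer over $H$ of $$J^{(0)}(u)=\sum_{m=1}^N\int_\Omega e^{2\lambda b^{-\beta}r^\beta(x)}\Big|\Delta u_m-c\sum_{n=1}^N s_{mn}u_n\Big|^2dx,$$ and, for $k\ge1$, let $u^{(k)}$ be a minimizer over $H$ of $$J^{(k)}(u)=\sum_{m=1}^N\int_\Omega e^{2\lambda b^{-\beta}r^\beta(x)}\Big|\Delta u_m-c\sum_{n=1}^N s_{mn}u_n+q_m\big(P(u_1^{(k-1)}),\dots,P(u_N^{(k-1)})\big)\Big|^2dx .$$ Put $p^{(k)}(x)=\sum_{n=1}^N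 u_n^{(k)}(x)\Psi_n(0)$. **Theorem.** There is $\beta_0>0$, depending only on $\Omega,d,T,N,x_0,b$, such that for every $\beta\ge\beta_0$ there are * a constant $C>0$ depending only on $\Omega,T,d,N,x_0,b,\beta$, on $M$ and on $Q$, and * a number $\lambda_0>0$ depending only on $\Omega,T,d,N,x_0,b,\beta$, on the basis $(\Psi_n)$ and on an upper bound of $c$ on $\Omega$, such that for every $\lambda\ge\lambda_0$ a sequence $(u^{(k)})_{k\ge0}$ of successive minimizers as above exists, and every such sequence satisfies $$\sum_{m=1}^N\big\|e^{\lambda b^{-\beta}r^\beta}(u_m^{(k)}-u_m^*)\big\|_{L^2(\Omega)}^2\le\Big[\frac{C}{\lambda^3}\Big]^{k-1}\sum_{m=1}^N\big\|e^{\lambda b^{-\beta}r^\beta}(u_m^{(1)}-u_m^*)\big\|_{L^2(\Omega)}^2,\qquad k=1,2,\dots$$ In particular, if moreover $C/\lambda^3<1$, then $u^{(k)}$ converges to $u^*$ exponentially in $L^2(\Omega)^N$, namely there is $K$ with $\sum_m\|u_m^{(k)}-u_m^*\|^2_{L^2(\Omega)}\le K\,[C/\lambda^3]^{k-1}$ for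 all $k\ge1$, and $p^{(k)}\to p^*$ in $L^2(\Omega)$ as $k\to\infty$. -/

import Mathlib

open MeasureTheory Set Filter Topology
open scoped ENNReal ContDiff

noncomputable section

namespace LateralCauchy

/-- The Euclidean space `ℝ^d`. -/
abbrev Sp (d : ℕ) : Type := EuclideanSpace ℝ (Fin d)

/-- The coordinate vector `e_i` of `ℝ^d`. -/
def coordVec {d : ℕ} (i : Fin d) : Sp d := EuclideanSpace.single i 1

/-! ### The boundary of a domain -/

/-- `ρ` is a smooth defining function of `Ω` near `x`: its gradient at `x` does not vanish and,
near `x`, the set `Ω` is the set where `ρ` is negative. -/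
structure IsDefiningFunctionAt {d : ℕ} (Ω : Set (Sp d)) (x : Sp d) (ρ : Sp d → ℝ) : Prop where
  smooth : ContDiff ℝ ∞ ρ
  gradient_ne_zero : gradient ρ x ≠ 0
  mem_iff : ∀ᶠ y in 𝓝 x, (y ∈ Ω ↔ ρ y < 0)

/-- The boundary of `Ω` is smooth (and `Ω` lies locally on one side of it). -/
def HasSmoothBoundary {d : ℕ} (Ω : Set (Sp d)) : Prop :=
  ∀ x ∈ frontier Ω, ∃ ρ, IsDefiningFunctionAt Ω x ρ

open Classical in
/-- The outer unit normal `ν(x) = ∇ρ(x) / |∇ρ(x)|`, where `ρ` is any smooth defining function of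
`Ω` near the boundary point `x` (the value does not depend on `ρ`). -/
def outerNormal {d : ℕ} (Ω : Set (Sp d)) (x : Sp d) : Sp d :=
  if h : ∃ ρ, IsDefiningFunctionAt Ω x ρ then
    ‖gradient h.choose x‖⁻¹ • gradient h.choose x
  else 0

/-- The surface measure on `∂Ω`: the `(d-1)`-dimensional Hausdorff measure, normalized so that it
agrees with the Lebesgue measure on flat pieces. -/
def surfaceMeasure {d : ℕ} (Ω : Set (Sp d)) : Measure (Sp d) :=
  (Measure.euclideanHausdorffMeasure (d - 1)).restrict (frontier Ω)

/-! ### Weak derivatives and the spaces `H¹(Ω)`, `H²(Ω)` -/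

/-- `w` is the weak partial derivative `∂_i u` on `Ω`. -/
def IsWeakDeriv {d : ℕ} (Ω : Set (Sp d)) (i : Fin d) (u w : Sp d → ℝ) : Prop :=
  ∀ φ : Sp d → ℝ, ContDiff ℝ ∞ φ → HasCompactSupport φ → tsupport φ ⊆ Ω →
    ∫ x in Ω, u x * fderiv ℝ φ x (coordVec i) = -∫ x in Ω, w x * φ x

/-- `u` has a weak partial derivative `∂_i u` in `L²(Ω)`. -/
def HasL2Deriv {d : ℕ} (Ω : Set (Sp d)) (i : Fin d) (u : Sp d → ℝ) : Prop :=
  ∃ w : Sp d → ℝ, MemLp w 2 (volume.restrict Ω) ∧ IsWeakDeriv Ω i u w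

open Classical in
/-- The weak partial derivative `∂_i u ∈ L²(Ω)` (unique up to null sets when it exists). -/
def weakDeriv {d : ℕ} (Ω : Set (Sp d)) (i : Fin d) (u : Sp d → ℝ) : Sp d → ℝ :=
  if h : HasL2Deriv Ω i u then h.choose else 0

/-- `u ∈ H¹(Ω)`. -/
def MemH1 {d : ℕ} (Ω : Set (Sp d)) (u : Sp d → ℝ) : Prop :=
  MemLp u 2 (volume.restrict Ω) ∧ ∀ i, HasL2Deriv Ω i u

/-- `u ∈ H²(Ω)`. -/
def MemH2 {d : ℕ} (Ω : Set (Sp d)) (u : Sp d → ℝ) : Prop :=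
  MemH1 Ω u ∧ ∀ i, MemH1 Ω (weakDeriv Ω i u)

/-- The Laplacian `Δu = ∑ ∂_i ∂_i u` of `u ∈ H²(Ω)`. -/
def lap {d : ℕ} (Ω : Set (Sp d)) (u : Sp d → ℝ) (x : Sp d) : ℝ :=
  ∑ i, weakDeriv Ω i (weakDeriv Ω i u) x

/-! ### Boundary values -/

/-- `u|_{∂Ω} = f` in the sense of traces, for `u ∈ H¹(Ω)` and `f ∈ L²(∂Ω)`: the trace is the
function for which the Gauss-Green formula
`∫_Ω (u div X + ∇u · X) = ∫_{∂Ω} f X · ν` holds for all smooth vector fields `X`. -/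
def HasTrace {d : ℕ} (Ω : Set (Sp d)) (u f : Sp d → ℝ) : Prop :=
  ∀ X : Sp d → Sp d, ContDiff ℝ ∞ X → HasCompactSupport X →
    ∫ x in Ω, (u x * ∑ i, (fderiv ℝ X x (coordVec i)) i + ∑ i, weakDeriv Ω i u x * X x i)
      = ∫ x, f x * inner ℝ (X x) (outerNormal Ω x) ∂(surfaceMeasure Ω)

/-- `∂_ν u|_{∂Ω} = g`, for `u ∈ H²(Ω)` and `g ∈ L²(∂Ω)`: the normal derivative is the function for
which Green's formula `∫_Ω (Δu φ + ∇u · ∇φ) = ∫_{∂Ω} g φ` holds for all smooth `φ`. -/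
def HasNormalDeriv {d : ℕ} (Ω : Set (Sp d)) (u g : Sp d → ℝ) : Prop :=
  ∀ φ : Sp d → ℝ, ContDiff ℝ ∞ φ → HasCompactSupport φ →
    ∫ x in Ω, (lap Ω u x * φ x + ∑ i, weakDeriv Ω i u x * fderiv ℝ φ x (coordVec i))
      = ∫ x, g x * φ x ∂(surfaceMeasure Ω)

/-- The admissible set `H` of all `(u_m) ∈ H²(Ω)^N` with `u_m = f_m` and `∂_ν u_m = g_m` on
`∂Ω`. -/
def admissible {d N : ℕ} (Ω : Set (Sp d)) (f g : Fin N → Sp d → ℝ) : Set (Fin N → Sp d → ℝ) :=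
  {u | ∀ m, MemH2 Ω (u m) ∧ HasTrace Ω (u m) (f m) ∧ HasNormalDeriv Ω (u m) (g m)}

/-! ### The time basis and the system for the Fourier coefficients -/

/-- `(Ψ_n)` is an orthonormal basis of `L²(0,T)` consisting of absolutely continuous functions on
`[0,T]` (so that the derivatives `Ψ_n'` and the values `Ψ_n(0)` make sense). The index starts
at `0`. -/
structure IsTimeBasis (T : ℝ) (Ψ : ℕ → ℝ → ℝ) : Prop where
  absCont : ∀ n, AbsolutelyContinuousOnInterval (Ψ n) 0 T
  basis : ∃ B : HilbertBasis ℕ ℝ (Lp ℝ 2 (volume.restrict (Ioo 0 T))),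
    ∀ n, B n =ᵐ[volume.restrict (Ioo 0 T)] Ψ n

/-- The numbers `s_{mn} = ∫_0^T Ψ_n'(t) Ψ_m(t) dt`. -/
def sCoef (T : ℝ) (Ψ : ℕ → ℝ → ℝ) (m n : ℕ) : ℝ :=
  ∫ t in (0 : ℝ)..T, deriv (Ψ n) t * Ψ m t

/-- `q_m(s_1, …, s_N) = ∫_0^T q(∑ s_n Ψ_n(t)) Ψ_m(t) dt`. -/
def qCoef {N : ℕ} (T : ℝ) (Ψ : ℕ → ℝ → ℝ) (q : ℝ → ℝ) (m : Fin N) (s : Fin N → ℝ) : ℝ :=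
  ∫ t in (0 : ℝ)..T, q (∑ n : Fin N, s n * Ψ n t) * Ψ m t

/-- The function `∑ u_n(x) Ψ_n(t)` with the Fourier coefficients `u_n`. -/
def expand {d N : ℕ} (Ψ : ℕ → ℝ → ℝ) (u : Fin N → Sp d → ℝ) (x : Sp d) (t : ℝ) : ℝ :=
  ∑ n : Fin N, u n x * Ψ n t

/-- The linear part `Δu_m - c ∑ s_{mn} u_n` of the `m`-th equation. -/
def linPart {d N : ℕ} (Ω : Set (Sp d)) (T : ℝ) (Ψ : ℕ → ℝ → ℝ) (c : Sp d → ℝ)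
    (u : Fin N → Sp d → ℝ) (m : Fin N) (x : Sp d) : ℝ :=
  lap Ω (u m) x - c x * ∑ n : Fin N, sCoef T Ψ m n * u n x

/-- `(u_m)` solves the system `c ∑ s_{mn} u_n = Δu_m + q_m(u_1, …, u_N)` in `Ω` with the Cauchy
data `u_m = f_m`, `∂_ν u_m = g_m` on `∂Ω`. -/
def IsSolution {d N : ℕ} (Ω : Set (Sp d)) (T : ℝ) (Ψ : ℕ → ℝ → ℝ) (c : Sp d → ℝ) (q : ℝ → ℝ)
    (f g : Fin N → Sp d → ℝ) (u : Fin N → Sp d → ℝ) : Prop :=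
  u ∈ admissible Ω f g ∧
    ∀ m : Fin N, ∀ᵐ x ∂(volume.restrict Ω),
      c x * ∑ n : Fin N, sCoef T Ψ m n * u n x
        = lap Ω (u m) x + qCoef T Ψ q m (fun n => u n x)

/-- `|q| ≤ Q` and `|q'| ≤ Q` on the interval of all values that `∑ s_n Ψ_n(t)` takes for
`t ∈ [0,T]` and `|s_n| ≤ M √T`. -/
def C1BoundedBy (N : ℕ) (T : ℝ) (Ψ : ℕ → ℝ → ℝ) (q : ℝ → ℝ) (M Q : ℝ) : Prop :=
  ∀ t ∈ Icc 0 T, ∀ s : Fin N → ℝ, (∀ n, |s n| ≤ M * Real.sqrt T) →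
    |q (∑ n, s n * Ψ n t)| ≤ Q ∧ |deriv q (∑ n, s n * Ψ n t)| ≤ Q

/-! ### The iteration -/

/-- The cut-off function `P`, with values in `[-M √T, M √T]`. -/
def cutoff (M T s : ℝ) : ℝ :=
  max (-(M * Real.sqrt T)) (min (M * Real.sqrt T) s)

/-- The exponential `e^{λ b^{-β} r^β(x)}` with `r(x) = |x - x₀|`. -/
def carlemanExp {d : ℕ} (x₀ : Sp d) (b β lam : ℝ) (x : Sp d) : ℝ :=
  Real.exp (lam * b ^ (-β) * dist x x₀ ^ β)

/-- The functional
`∑_m ∫_Ω e^{2 λ b^{-β} r^β} |Δu_m - c ∑_n s_{mn} u_n + F_m|² dx`. -/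
def costJ {d N : ℕ} (Ω : Set (Sp d)) (T : ℝ) (Ψ : ℕ → ℝ → ℝ) (c : Sp d → ℝ) (x₀ : Sp d)
    (b β lam : ℝ) (F u : Fin N → Sp d → ℝ) : ℝ :=
  ∑ m : Fin N, ∫ x in Ω, carlemanExp x₀ b β lam x ^ 2 * |linPart Ω T Ψ c u m x + F m x| ^ 2

/-- `u^{(0)}, u^{(1)}, …` is a sequence of successive minimizers: `u^{(0)}` minimizes on `H` the
functional `J^{(0)}` (no nonlinear term), and `u^{(k+1)}` minimizes on `H` the functional
`J^{(k+1)}`, whose nonlinear term is `q_m(P(u_1^{(k)}), …, P(u_N^{(k)}))`. -/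
structure IsMinimizingIteration {d N : ℕ} (Ω : Set (Sp d)) (T : ℝ) (Ψ : ℕ → ℝ → ℝ)
    (c : Sp d → ℝ) (q : ℝ → ℝ) (M : ℝ) (x₀ : Sp d) (b β lam : ℝ) (f g : Fin N → Sp d → ℝ)
    (u : ℕ → Fin N → Sp d → ℝ) : Prop where
  mem : ∀ k, u k ∈ admissible Ω f g
  isMin_zero : IsMinOn (costJ Ω T Ψ c x₀ b β lam (fun _ _ => 0)) (admissible Ω f g) (u 0)
  isMin_succ : ∀ k, IsMinOn
    (costJ Ω T Ψ c x₀ b β lam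
      (fun m x => qCoef T Ψ q m (fun n => cutoff M T (u k n x))))
    (admissible Ω f g) (u (k + 1))

/-- The squared weighted error `∑_m ‖e^{λ b^{-β} r^β} (u_m - v_m)‖²_{L²(Ω)}`. -/
def weightedError {d N : ℕ} (Ω : Set (Sp d)) (x₀ : Sp d) (b β lam : ℝ)
    (u v : Fin N → Sp d → ℝ) : ℝ :=
  ∑ m : Fin N, ∫ x in Ω, (carlemanExp x₀ b β lam x * (u m x - v m x)) ^ 2

end LateralCauchy

end

open MeasureTheory Set Filter Topology
open scoped ENNReal ContDiff

noncomputable section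

namespace LateralCauchy

/-! The contraction rate comes from a Carleman estimate. With `w = e^{λ b^{-β} r^β}` and `v ∈ H²(Ω)`
having zero Cauchy data, `κ λ³ ∫ w² v² ≤ ∫ w² |Δv|²` for all large `λ`, where `κ` does not depend on
`λ` (`carleman_of_isExtLaplacian`). For large `λ` the zeroth-order coupling `c ∑ s_{mn} v_n` is
absorbed (`system_stability`).

The solution `u*` is a competitor for every `J^{(k+1)}`. Since the cut-off does not change `u*`, its
cost there is only the weighted norm of `q_m(P u^{(k)}) - q_m(P u*)`. By Bessel, the mean value
theorem and Parseval this is at most `Q²` times the weighted error of `u^{(k)}`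
(`qCoef_cutoff_lipschitz`). Applying stability to `u^{(k+1)} - u*` gives `κ λ³ E_{k+1} ≤ 16 Q² E_k`
(`weightedError_step`). Only the comparison of costs is used, no Euler-Lagrange equation.

For test functions, conjugation by `e^{λφ}` splits the Laplacian into a symmetric part `A` and a
skew part `B`. From `(A + B)² ≥ 4AB` and integration by parts, convexity of `φ` makes the gradient
terms nonnegative, and the Hessian of `φ` in the direction `∇φ` produces `λ³`
(`carleman_of_convex`). The weight is a convex increasing function of `r²`. To reach `H²(Ω)`, note
that the extension by zero of a function with zero Cauchy data has its Laplacian in `L²(ℝ^d)`: its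
mollifications are test functions, and Fatou's lemma removes the mollification.

Minimizers exist because the admissible set is `u*` plus a closed space of jets on which the
weighted linear operator is bounded below; its range is then complete, and the minimizer is an
orthogonal projection (`exists_norm_add_le_of_bounded_below`). -/

/-! ### Partial derivatives of smooth functions -/

/-- The partial derivative `∂_i f`. -/
def pd {d : ℕ} (i : Fin d) (f : Sp d → ℝ) (x : Sp d) : ℝ := fderiv ℝ f x (coordVec i)

section pd

variable {d : ℕ} {i j : Fin d} {f g : Sp d → ℝ}

@[fun_prop]
theorem contDiff_pd (hf : ContDiff ℝ ∞ f) : ContDiff ℝ ∞ (fun x => pd i f x) :=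
  (hf.fderiv_right (m := ∞) (by simp)).clm_apply contDiff_const

theorem contDiff_pd' (hf : ContDiff ℝ ∞ f) : ContDiff ℝ ∞ (pd i f) := contDiff_pd hf

theorem differentiable_of_contDiff (hf : ContDiff ℝ ∞ f) : Differentiable ℝ f :=
  hf.differentiable (by simp)

theorem pd_add (hf : ContDiff ℝ ∞ f) (hg : ContDiff ℝ ∞ g) (x : Sp d) :
    pd i (fun x => f x + g x) x = pd i f x + pd i g x := by
  unfold pd
  rw [fderiv_fun_add (differentiable_of_contDiff hf x) (differentiable_of_contDiff hg x)]
  rfl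

theorem pd_sub (hf : ContDiff ℝ ∞ f) (hg : ContDiff ℝ ∞ g) (x : Sp d) :
    pd i (fun x => f x - g x) x = pd i f x - pd i g x := by
  unfold pd
  rw [fderiv_fun_sub (differentiable_of_contDiff hf x) (differentiable_of_contDiff hg x)]
  rfl

theorem pd_mul (hf : ContDiff ℝ ∞ f) (hg : ContDiff ℝ ∞ g) (x : Sp d) :
    pd i (fun x => f x * g x) x = pd i f x * g x + f x * pd i g x := by
  unfold pd
  rw [fderiv_fun_mul (differentiable_of_contDiff hf x) (differentiable_of_contDiff hg x)]
  simp
  ring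

theorem pd_const (a : ℝ) (x : Sp d) : pd i (fun _ => a) x = 0 := by
  simp [pd]

theorem pd_comp {h : ℝ → ℝ} (hh : ContDiff ℝ ∞ h) (hf : ContDiff ℝ ∞ f) (x : Sp d) :
    pd i (fun x => h (f x)) x = deriv h (f x) * pd i f x := by
  unfold pd
  have h1 := (hh.differentiable (by simp) (f x)).hasDerivAt.comp_hasFDerivAt x
    (differentiable_of_contDiff hf x).hasFDerivAt
  have h2 : fderiv ℝ (fun x => h (f x)) x = deriv h (f x) • fderiv ℝ f x := h1.fderiv
  rw [h2]
  simp

theorem pd_comm (hf : ContDiff ℝ ∞ f) (x : Sp d) : pd i (pd j f) x = pd j (pd i f) x := by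
  have hs : IsSymmSndFDerivAt ℝ f x :=
    (hf.contDiffAt).isSymmSndFDerivAt (by
      rw [minSmoothness_of_isRCLikeNormedField]
      exact WithTop.coe_le_coe.2 le_top)
  have h1 : ∀ k l : Fin d, pd k (pd l f) x = fderiv ℝ (fderiv ℝ f) x (coordVec k) (coordVec l) := by
    intro k l
    unfold pd
    have hd : DifferentiableAt ℝ (fderiv ℝ f) x :=
      ((hf.fderiv_right (m := ∞) (by simp)).differentiable (by simp)) x
    rw [fderiv_clm_apply hd (differentiableAt_const _)]
    simp
  rw [h1, h1, hs.eq]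

theorem tsupport_pd_subset : tsupport (pd i f) ⊆ tsupport f := tsupport_fderiv_apply_subset ℝ _

theorem _root_.HasCompactSupport.pd (hf : HasCompactSupport f) : HasCompactSupport (pd i f) :=
  hf.fderiv_apply ℝ _

theorem pd_eq_zero_of_notMem_tsupport {x : Sp d} (hx : x ∉ tsupport f) : pd i f x = 0 :=
  image_eq_zero_of_notMem_tsupport (fun h => hx (tsupport_pd_subset h))

theorem pd_pd_eq_zero_of_notMem_tsupport {x : Sp d} (hx : x ∉ tsupport f) :
    pd i (pd j f) x = 0 :=
  pd_eq_zero_of_notMem_tsupport (fun h => hx (tsupport_pd_subset h))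

theorem integral_pd_eq_zero (hf : ContDiff ℝ ∞ f) (hc : HasCompactSupport f) :
    ∫ x, pd i f x = 0 := by
  have h1 : Integrable f := hf.continuous.integrable_of_hasCompactSupport hc
  have h2 : Integrable (LateralCauchy.pd i f) :=
    (contDiff_pd' hf).continuous.integrable_of_hasCompactSupport hc.pd
  -- Integration by parts against the constant function 1.
  have := integral_mul_fderiv_eq_neg_fderiv_mul_of_integrable (μ := (volume : Measure (Sp d)))
    (f := fun _ => (1 : ℝ)) (g := f) (v := coordVec i) (by simp)
    (by simpa [LateralCauchy.pd] using! h2) (by simpa using h1) (by fun_prop)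
    (fun x _ => differentiable_of_contDiff hf x)
  simpa [LateralCauchy.pd] using! this

end pd

/-! ### The Carleman estimate for test functions -/

section carleman

variable {d : ℕ} {φ z v : Sp d → ℝ}

/-- Conjugation turns the weighted estimate for `v` into an unweighted one for `z = e^{λφ} v`. It is
done one coordinate at a time so that the symmetric and skew parts split coordinatewise. -/
theorem conj_pd_pd (hφ : ContDiff ℝ ∞ φ) (hv : ContDiff ℝ ∞ v) (lam : ℝ) (i : Fin d) (x : Sp d)
    (hz : z = fun x => Real.exp (lam * φ x) * v x) :
    Real.exp (lam * φ x) * pd i (pd i v) x = pd i (pd i z) x - 2 * lam * pd i φ x * pd i z x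
      + (lam ^ 2 * pd i φ x ^ 2 - lam * pd i (pd i φ) x) * z x := by
  have he : ContDiff ℝ ∞ (fun x => Real.exp (lam * φ x)) := by fun_prop
  have h0 : ∀ x, pd i (fun x => Real.exp (lam * φ x)) x
      = Real.exp (lam * φ x) * (lam * pd i φ x) := by
    intro x
    rw [pd_comp Real.contDiff_exp (by fun_prop), Real.deriv_exp, pd_mul (by fun_prop) hφ, pd_const]
    ring
  have h1 : pd i z = fun x => Real.exp (lam * φ x) * (pd i v x + lam * pd i φ x * v x) := by
    funext x
    rw [hz, pd_mul he hv, h0]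
    ring
  have h2 : pd i (pd i z) x = Real.exp (lam * φ x) * (pd i (pd i v) x + 2 * lam * pd i φ x * pd i v x
      + lam * pd i (pd i φ) x * v x + lam ^ 2 * pd i φ x ^ 2 * v x) := by
    rw [h1]
    simp (disch := fun_prop) only [pd_mul, pd_add, pd_const, h0]
    ring
  rw [h2, h1, hz]
  ring

/-- This is the commutator computation behind the Carleman estimate, for one pair `(i, j)`: the
symmetric `i`-term times the skew `j`-term is a quadratic form in `∇z` and `z` plus exact
derivatives. Without sums it is a ring identity modulo the symmetry of second derivatives. -/
theorem pair_identity (hφ : ContDiff ℝ ∞ φ) (hz : ContDiff ℝ ∞ z) (lam : ℝ) (i j : Fin d)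
    (x : Sp d) :
    (pd i (pd i z) x + lam ^ 2 * pd i φ x ^ 2 * z x)
        * (-2 * lam * pd j φ x * pd j z x - lam * pd j (pd j φ) x * z x)
      = 2 * lam * pd i (pd j φ) x * pd i z x * pd j z x
        + 2 * lam ^ 3 * pd i φ x * pd j φ x * pd i (pd j φ) x * z x ^ 2
        - lam / 2 * pd i (pd i (pd j (pd j φ))) x * z x ^ 2
        + (pd i (fun x => -2 * lam * (pd j φ x * pd j z x * pd i z x)
            - lam * (pd j (pd j φ) x * (z x * pd i z x))
            + lam / 2 * (pd i (pd j (pd j φ)) x * (z x * z x))) x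
        + pd j (fun x => lam * (pd j φ x * (pd i z x * pd i z x))
            - lam ^ 3 * (pd i φ x * pd i φ x * pd j φ x * (z x * z x))) x) := by
  simp (disch := fun_prop) only [pd_mul, pd_add, pd_sub, pd_const]
  rw [pd_comm (i := j) (j := i) hz, pd_comm (i := j) (j := i) hφ]
  ring

theorem integrable_of_zero_off_tsupport {F : Sp d → ℝ} (hF : Continuous F)
    (hzc : HasCompactSupport z) (h0 : ∀ x, x ∉ tsupport z → F x = 0) : Integrable F :=
  hF.integrable_of_hasCompactSupport (HasCompactSupport.intro hzc h0)

theorem pair_integral (hφ : ContDiff ℝ ∞ φ) (hz : ContDiff ℝ ∞ z) (hzc : HasCompactSupport z)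
    (lam : ℝ) (i j : Fin d) :
    ∫ x, (pd i (pd i z) x + lam ^ 2 * pd i φ x ^ 2 * z x)
        * (-2 * lam * pd j φ x * pd j z x - lam * pd j (pd j φ) x * z x)
      = ∫ x, (2 * lam * pd i (pd j φ) x * pd i z x * pd j z x
        + 2 * lam ^ 3 * pd i φ x * pd j φ x * pd i (pd j φ) x * z x ^ 2
        - lam / 2 * pd i (pd i (pd j (pd j φ))) x * z x ^ 2) := by
  simp_rw [pair_identity hφ hz lam i j]
  have h0 : ∀ x, x ∉ tsupport z → z x = 0 := fun x hx => image_eq_zero_of_notMem_tsupport hx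
  have h1 : ∀ k x, x ∉ tsupport z → pd k z x = 0 := fun k x hx => pd_eq_zero_of_notMem_tsupport hx
  have key : ∀ (k : Fin d) (F : Sp d → ℝ), ContDiff ℝ ∞ F → (∀ x, x ∉ tsupport z → F x = 0) →
      Integrable (pd k F) ∧ ∫ x, pd k F x = 0 := fun k F hF hF0 =>
    ⟨(contDiff_pd' hF).continuous.integrable_of_hasCompactSupport
      (HasCompactSupport.intro hzc hF0).pd, integral_pd_eq_zero hF (HasCompactSupport.intro hzc hF0)⟩
  have k1 := key i (fun x => -2 * lam * (pd j φ x * pd j z x * pd i z x)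
            - lam * (pd j (pd j φ) x * (z x * pd i z x))
            + lam / 2 * (pd i (pd j (pd j φ)) x * (z x * z x))) (by fun_prop)
            (fun x hx => by simp [h0 x hx, h1 _ x hx])
  have k2 := key j (fun x => lam * (pd j φ x * (pd i z x * pd i z x))
            - lam ^ 3 * (pd i φ x * pd i φ x * pd j φ x * (z x * z x))) (by fun_prop)
            (fun x hx => by simp [h0 x hx, h1 _ x hx])
  have hR : Integrable (fun x => 2 * lam * pd i (pd j φ) x * pd i z x * pd j z x
        + 2 * lam ^ 3 * pd i φ x * pd j φ x * pd i (pd j φ) x * z x ^ 2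
        - lam / 2 * pd i (pd i (pd j (pd j φ))) x * z x ^ 2) := by
    refine integrable_of_zero_off_tsupport (z := z) ?_ hzc (fun x hx => by simp [h0 x hx, h1 _ x hx])
    exact ContDiff.continuous (𝕜 := ℝ) (n := ∞) (by fun_prop)
  refine (integral_add hR (k1.1.add k2.1)).trans ?_
  rw [integral_add' k1.1 k2.1, k1.2, k2.2]
  simp

/-- The Carleman estimate with a general convex weight. -/
theorem carleman_of_convex (hφ : ContDiff ℝ ∞ φ) {U : Set (Sp d)} {κ₁ κ₂ : ℝ}
    (hconv : ∀ x ∈ U, ∀ ξ : Fin d → ℝ, 0 ≤ ∑ i, ∑ j, pd i (pd j φ) x * ξ i * ξ j)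
    (hpos : ∀ x ∈ U, κ₁ ≤ ∑ i, ∑ j, pd i φ x * pd j φ x * pd i (pd j φ) x)
    (hbi : ∀ x ∈ U, ∑ i, ∑ j, pd i (pd i (pd j (pd j φ))) x ≤ κ₂)
    {lam : ℝ} (hlam : 0 ≤ lam) (hv : ContDiff ℝ ∞ v) (hvc : HasCompactSupport v)
    (hvU : tsupport v ⊆ U) :
    (8 * lam ^ 3 * κ₁ - 2 * lam * κ₂) * ∫ x, (Real.exp (lam * φ x) * v x) ^ 2
      ≤ ∫ x, (Real.exp (lam * φ x) * ∑ i, pd i (pd i v) x) ^ 2 := by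
  set z : Sp d → ℝ := fun x => Real.exp (lam * φ x) * v x with hzdef
  have hz : ContDiff ℝ ∞ z := by fun_prop
  have hzv : tsupport z ⊆ tsupport v := tsupport_mul_subset_right
  have hzc : HasCompactSupport z := hvc.mul_left
  have h0 : ∀ x, x ∉ tsupport v → z x = 0 :=
    fun x hx => image_eq_zero_of_notMem_tsupport (fun h => hx (hzv h))
  have h1 : ∀ k x, x ∉ tsupport v → pd k z x = 0 :=
    fun k x hx => pd_eq_zero_of_notMem_tsupport (fun h => hx (hzv h))
  have h2 : ∀ k l x, x ∉ tsupport v → pd k (pd l z) x = 0 :=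
    fun k l x hx => pd_pd_eq_zero_of_notMem_tsupport (fun h => hx (hzv h))
  have h3 : ∀ k l x, x ∉ tsupport v → pd k (pd l v) x = 0 :=
    fun k l x hx => pd_pd_eq_zero_of_notMem_tsupport hx
  -- The sum of the `A i` is the symmetric part of the conjugated Laplacian, the sum of the `B j`
  -- its skew part.
  let A : Fin d → Sp d → ℝ := fun i x => pd i (pd i z) x + lam ^ 2 * pd i φ x ^ 2 * z x
  let B : Fin d → Sp d → ℝ := fun j x => -2 * lam * pd j φ x * pd j z x - lam * pd j (pd j φ) x * z x
  let R : Fin d → Fin d → Sp d → ℝ := fun i j x => 2 * lam * pd i (pd j φ) x * pd i z x * pd j z x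
        + 2 * lam ^ 3 * pd i φ x * pd j φ x * pd i (pd j φ) x * z x ^ 2
        - lam / 2 * pd i (pd i (pd j (pd j φ))) x * z x ^ 2
  have hAB : ∀ x, Real.exp (lam * φ x) * ∑ i, pd i (pd i v) x = ∑ i, A i x + ∑ j, B j x := by
    intro x
    rw [Finset.mul_sum, ← Finset.sum_add_distrib]
    refine Finset.sum_congr rfl fun i _ => ?_
    rw [conj_pd_pd hφ hv lam i x hzdef]
    simp only [A, B]
    ring
  have hABi : ∀ i j, Integrable (fun x => A i x * B j x) := fun i j =>
    integrable_of_zero_off_tsupport (z := v)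
      (ContDiff.continuous (𝕜 := ℝ) (n := ∞) (by simp only [A, B]; fun_prop)) hvc
      (fun x hx => by simp [A, B, h0 x hx, h1 _ x hx])
  have hRi : ∀ i j, Integrable (R i j) := fun i j =>
    integrable_of_zero_off_tsupport (z := v)
      (ContDiff.continuous (𝕜 := ℝ) (n := ∞) (by simp only [R]; fun_prop)) hvc
      (fun x hx => by simp [R, h0 x hx, h1 _ x hx])
  have hz2 : Integrable (fun x => z x ^ 2) :=
    integrable_of_zero_off_tsupport (z := v) (by fun_prop) hvc (fun x hx => by simp [h0 x hx])
  have hL : Integrable (fun x => (Real.exp (lam * φ x) * ∑ i, pd i (pd i v) x) ^ 2) :=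
    integrable_of_zero_off_tsupport (z := v)
      (ContDiff.continuous (𝕜 := ℝ) (n := ∞) (by fun_prop)) hvc
      (fun x hx => by simp [h3 _ _ x hx])
  calc (8 * lam ^ 3 * κ₁ - 2 * lam * κ₂) * ∫ x, z x ^ 2
      = ∫ x, (8 * lam ^ 3 * κ₁ - 2 * lam * κ₂) * z x ^ 2 := (integral_const_mul _ _).symm
    _ ≤ ∫ x, 4 * ∑ i, ∑ j, R i j x := by
        refine integral_mono (hz2.const_mul _) (Integrable.const_mul (integrable_finsetSum _
          fun i _ => integrable_finsetSum _ fun j _ => hRi i j) _) fun x => ?_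
        by_cases hx : x ∈ tsupport v
        · have c1 := hconv x (hvU hx) (fun i => pd i z x)
          have c2 := hpos x (hvU hx)
          have c3 := hbi x (hvU hx)
          have e : ∑ i, ∑ j, R i j x = 2 * lam * ∑ i, ∑ j, pd i (pd j φ) x * pd i z x * pd j z x
              + 2 * lam ^ 3 * z x ^ 2 * ∑ i, ∑ j, pd i φ x * pd j φ x * pd i (pd j φ) x
              - lam / 2 * z x ^ 2 * ∑ i, ∑ j, pd i (pd i (pd j (pd j φ))) x := by
            simp only [Finset.mul_sum, ← Finset.sum_add_distrib, ← Finset.sum_sub_distrib]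
            refine Finset.sum_congr rfl fun i _ => Finset.sum_congr rfl fun j _ => ?_
            simp only [R]
            ring
          -- `d1` discards the gradient term by convexity, `d2` keeps the main `λ³` term, `d3`
          -- controls the `Δ²φ` term, which is only of order `λ`.
          have d1 := mul_nonneg (mul_nonneg zero_le_two hlam) c1
          have d2 := mul_le_mul_of_nonneg_left c2
            (by positivity : 0 ≤ 2 * lam ^ 3 * z x ^ 2)
          have d3 := mul_le_mul_of_nonneg_left c3 (by positivity : 0 ≤ lam / 2 * z x ^ 2)
          simp only [e]
          linarith
        · simp [R, h0 x hx, h1 _ x hx]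
    _ = ∫ x, 4 * ∑ i, ∑ j, A i x * B j x := by
        rw [integral_const_mul, integral_const_mul]
        congr 1
        rw [integral_finsetSum _ fun i _ => integrable_finsetSum _ fun j _ => hRi i j,
          integral_finsetSum _ fun i _ => integrable_finsetSum _ fun j _ => hABi i j]
        refine Finset.sum_congr rfl fun i _ => ?_
        rw [integral_finsetSum _ fun j _ => hRi i j, integral_finsetSum _ fun j _ => hABi i j]
        exact Finset.sum_congr rfl fun j _ => (pair_integral hφ hz hzc lam i j).symm
    _ ≤ ∫ x, (Real.exp (lam * φ x) * ∑ i, pd i (pd i v) x) ^ 2 := by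
        refine integral_mono (Integrable.const_mul (integrable_finsetSum _
          fun i _ => integrable_finsetSum _ fun j _ => hABi i j) _) hL fun x => ?_
        simp only [hAB, ← Finset.sum_mul_sum]
        -- `4ab ≤ (a + b)²`; this is the source of the factor 4 above.
        nlinarith [sq_nonneg (∑ i, A i x - ∑ j, B j x)]

/-- `∫ (∂_i ∂_j w)² ≤ ∫ (Δ w)²` for test functions. -/
theorem integral_pd_pd_sq_le (hz : ContDiff ℝ ∞ z) (hzc : HasCompactSupport z) (i j : Fin d) :
    ∫ x, pd i (pd j z) x ^ 2 ≤ ∫ x, (∑ k, pd k (pd k z) x) ^ 2 := by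
  have h0 : ∀ x, x ∉ tsupport z → z x = 0 := fun x hx => image_eq_zero_of_notMem_tsupport hx
  have h1 : ∀ k x, x ∉ tsupport z → pd k z x = 0 := fun k x hx => pd_eq_zero_of_notMem_tsupport hx
  have h2 : ∀ k l x, x ∉ tsupport z → pd k (pd l z) x = 0 :=
    fun k l x hx => pd_pd_eq_zero_of_notMem_tsupport hx
  have hi : ∀ k l, Integrable (fun x => pd k (pd l z) x ^ 2) := fun k l =>
    integrable_of_zero_off_tsupport (z := z)
      (ContDiff.continuous (𝕜 := ℝ) (n := ∞) (by fun_prop)) hzc (fun x hx => by simp [h2 _ _ x hx])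
  have hi' : ∀ k l, Integrable (fun x => pd k (pd k z) x * pd l (pd l z) x) := fun k l =>
    integrable_of_zero_off_tsupport (z := z)
      (ContDiff.continuous (𝕜 := ℝ) (n := ∞) (by fun_prop)) hzc (fun x hx => by simp [h2 _ _ x hx])
  -- Two integrations by parts move `∂_k` and `∂_l` across, so `∫ (Δz)²` is the sum of all `∫ (∂_k
  -- ∂_l z)²`.
  have key : ∀ k l, ∫ x, pd k (pd k z) x * pd l (pd l z) x = ∫ x, pd k (pd l z) x ^ 2 := by
    intro k l
    have e : ∀ x, pd k (pd k z) x * pd l (pd l z) x = pd k (pd l z) x ^ 2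
        + (pd k (fun x => pd k z x * pd l (pd l z) x) x
          - pd l (fun x => pd k z x * pd k (pd l z) x) x) := by
      intro x
      simp (disch := fun_prop) only [pd_mul]
      have e1 : pd k (pd l (pd l z)) x = pd l (pd k (pd l z)) x := pd_comm (contDiff_pd' hz) x
      rw [e1, pd_comm (i := l) (j := k) hz]
      ring
    have c1 : HasCompactSupport (fun x => pd k z x * pd l (pd l z) x) :=
      HasCompactSupport.intro hzc (fun x hx => by simp [h1 _ x hx])
    have c2 : HasCompactSupport (fun x => pd k z x * pd k (pd l z) x) :=
      HasCompactSupport.intro hzc (fun x hx => by simp [h1 _ x hx])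
    have s1 : ContDiff ℝ ∞ (fun x => pd k z x * pd l (pd l z) x) := by fun_prop
    have s2 : ContDiff ℝ ∞ (fun x => pd k z x * pd k (pd l z) x) := by fun_prop
    have i1 := (contDiff_pd' (i := k) s1).continuous.integrable_of_hasCompactSupport c1.pd
      (μ := volume)
    have i2 := (contDiff_pd' (i := l) s2).continuous.integrable_of_hasCompactSupport c2.pd
      (μ := volume)
    simp_rw [e]
    refine (integral_add (hi k l) (i1.sub i2)).trans ?_
    rw [integral_sub' i1 i2, integral_pd_eq_zero s1 c1,
      integral_pd_eq_zero s2 c2]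
    simp
  simp_rw [sq (∑ k, pd k (pd k z) _), Finset.sum_mul_sum]
  rw [integral_finsetSum _ fun k _ => integrable_finsetSum _ fun l _ => hi' k l]
  have : ∀ k, ∫ x, ∑ l, pd k (pd k z) x * pd l (pd l z) x = ∑ l, ∫ x, pd k (pd l z) x ^ 2 := by
    intro k
    rw [integral_finsetSum _ fun l _ => hi' k l]
    exact Finset.sum_congr rfl fun l _ => key k l
  simp_rw [this]
  have hnn : ∀ k l, 0 ≤ ∫ x, pd k (pd l z) x ^ 2 := fun k l =>
    integral_nonneg fun x => sq_nonneg _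
  exact (Finset.single_le_sum (f := fun l => ∫ x, pd i (pd l z) x ^ 2)
    (fun l _ => hnn i l) (Finset.mem_univ j)).trans
    (Finset.single_le_sum (f := fun k => ∑ l, ∫ x, pd k (pd l z) x ^ 2)
    (fun k _ => Finset.sum_nonneg fun l _ => hnn k l) (Finset.mem_univ i))

/-- `∫ (∂_i w)² ≤ ∫ w² + ∫ (Δ w)²` for test functions. -/
theorem integral_pd_sq_le (hz : ContDiff ℝ ∞ z) (hzc : HasCompactSupport z) (i : Fin d) :
    ∫ x, pd i z x ^ 2 ≤ (∫ x, z x ^ 2) + ∫ x, (∑ k, pd k (pd k z) x) ^ 2 := by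
  have h0 : ∀ x, x ∉ tsupport z → z x = 0 := fun x hx => image_eq_zero_of_notMem_tsupport hx
  have h1 : ∀ k x, x ∉ tsupport z → pd k z x = 0 := fun k x hx => pd_eq_zero_of_notMem_tsupport hx
  have h2 : ∀ k l x, x ∉ tsupport z → pd k (pd l z) x = 0 :=
    fun k l x hx => pd_pd_eq_zero_of_notMem_tsupport hx
  have hi : Integrable (fun x => pd i z x ^ 2) :=
    integrable_of_zero_off_tsupport (z := z)
      (ContDiff.continuous (𝕜 := ℝ) (n := ∞) (by fun_prop)) hzc (fun x hx => by simp [h1 _ x hx])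
  have hz2 : Integrable (fun x => z x ^ 2) :=
    integrable_of_zero_off_tsupport (z := z) (by fun_prop) hzc (fun x hx => by simp [h0 x hx])
  have hL : Integrable (fun x => pd i (pd i z) x ^ 2) :=
    integrable_of_zero_off_tsupport (z := z)
      (ContDiff.continuous (𝕜 := ℝ) (n := ∞) (by fun_prop)) hzc (fun x hx => by simp [h2 _ _ x hx])
  have c1 : HasCompactSupport (fun x => z x * pd i z x) :=
    HasCompactSupport.intro hzc (fun x hx => by simp [h0 x hx])
  have s1 : ContDiff ℝ ∞ (fun x => z x * pd i z x) := by fun_prop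
  have i1 := (contDiff_pd' (i := i) s1).continuous.integrable_of_hasCompactSupport c1.pd
    (μ := volume)
  calc ∫ x, pd i z x ^ 2
      ≤ ∫ x, (pd i (fun x => z x * pd i z x) x + (z x ^ 2 + pd i (pd i z) x ^ 2)) := by
        refine integral_mono hi (i1.add (hz2.add hL)) fun x => ?_
        simp (disch := fun_prop) only [pd_mul]
        -- `(∂_i z)² = ∂_i (z ∂_i z) - z ∂_i² z`, and the last product is bounded by the two
        -- squares.
        nlinarith [sq_nonneg (z x + pd i (pd i z) x), sq_nonneg (z x), sq_nonneg (pd i (pd i z) x)]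
    _ = (∫ x, z x ^ 2) + ∫ x, pd i (pd i z) x ^ 2 := by
        refine (integral_add i1 (hz2.add hL)).trans ?_
        rw [integral_pd_eq_zero s1 c1, zero_add]
        exact integral_add hz2 hL
    _ ≤ _ := by
        exact add_le_add_right (integral_pd_pd_sq_le hz hzc i i) _

end carleman

/-! ### The radial convex weight -/

section radial

/-- A smooth positive function which is the identity on `[1, ∞)`. -/
def posId (t : ℝ) : ℝ := t * Real.smoothTransition t + (1 - Real.smoothTransition t)

theorem posId_of_one_le {t : ℝ} (ht : 1 ≤ t) : posId t = t := by
  simp [posId, Real.smoothTransition.one_of_one_le ht]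

theorem contDiff_posId : ContDiff ℝ ∞ posId := by
  have : ContDiff ℝ ∞ Real.smoothTransition := Real.smoothTransition.contDiff
  unfold posId
  fun_prop

theorem posId_pos (t : ℝ) : 0 < posId t := by
  unfold posId
  rcases le_or_gt t 0 with h | h
  · simp [Real.smoothTransition.zero_of_nonpos h]
  · have h1 := Real.smoothTransition.pos_of_pos h
    have h2 := Real.smoothTransition.le_one t
    have := mul_pos h h1
    linarith

/-- A smooth function on `ℝ` which is `κ t ^ γ` on `[1, ∞)`. -/
def smoothRpow (κ γ t : ℝ) : ℝ := κ * posId t ^ γ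

theorem contDiff_smoothRpow (κ γ : ℝ) : ContDiff ℝ ∞ (smoothRpow κ γ) :=
  contDiff_const.mul (contDiff_posId.rpow_const_of_ne fun t => (posId_pos t).ne')

theorem smoothRpow_of_one_le (κ γ : ℝ) {t : ℝ} (ht : 1 ≤ t) : smoothRpow κ γ t = κ * t ^ γ := by
  rw [smoothRpow, posId_of_one_le ht]

theorem deriv_smoothRpow (κ γ : ℝ) {t : ℝ} (ht : 1 < t) :
    deriv (smoothRpow κ γ) t = κ * (γ * t ^ (γ - 1)) := by
  have h : smoothRpow κ γ =ᶠ[𝓝 t] fun t => κ * t ^ γ := by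
    filter_upwards [lt_mem_nhds ht] with s hs using smoothRpow_of_one_le κ γ hs.le
  rw [h.deriv_eq]
  exact ((Real.hasDerivAt_rpow_const (Or.inl (by linarith))).const_mul κ).deriv

theorem deriv_deriv_smoothRpow (κ γ : ℝ) {t : ℝ} (ht : 1 < t) :
    deriv (deriv (smoothRpow κ γ)) t = κ * (γ * ((γ - 1) * t ^ (γ - 1 - 1))) := by
  have h : deriv (smoothRpow κ γ) =ᶠ[𝓝 t] fun t => κ * (γ * t ^ (γ - 1)) := by
    filter_upwards [lt_mem_nhds ht] with s hs using deriv_smoothRpow κ γ hs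
  rw [h.deriv_eq]
  exact (((Real.hasDerivAt_rpow_const (Or.inl (by linarith))).const_mul γ).const_mul κ).deriv

variable {d : ℕ}

theorem pd_coord (i j : Fin d) (x₀ x : Sp d) :
    pd i (fun x => x j - x₀ j) x = if i = j then 1 else 0 := by
  have h : HasFDerivAt (fun x : Sp d => x j - x₀ j) (EuclideanSpace.proj j : Sp d →L[ℝ] ℝ) x :=
    ((EuclideanSpace.proj j : Sp d →L[ℝ] ℝ).hasFDerivAt).sub_const _
  rw [pd, h.fderiv]
  simp [coordVec, eq_comm]

@[fun_prop]
theorem contDiff_coord (j : Fin d) : ContDiff ℝ ∞ (fun x : Sp d => x j) :=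
  (EuclideanSpace.proj j : Sp d →L[ℝ] ℝ).contDiff

theorem dist_sq_eq (x₀ x : Sp d) :
    dist x x₀ ^ 2 = ∑ k, (x k - x₀ k) * (x k - x₀ k) := by
  rw [EuclideanSpace.dist_eq, Real.sq_sqrt (Finset.sum_nonneg fun _ _ => sq_nonneg _)]
  exact Finset.sum_congr rfl fun k _ => by rw [Real.dist_eq, sq_abs, sq]

theorem contDiff_dist_sq (x₀ : Sp d) : ContDiff ℝ ∞ (fun x : Sp d => dist x x₀ ^ 2) := by
  simp_rw [dist_sq_eq]
  fun_prop

theorem pd_dist_sq (i : Fin d) (x₀ x : Sp d) :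
    pd i (fun x => dist x x₀ ^ 2) x = 2 * (x i - x₀ i) := by
  unfold pd
  have h : HasFDerivAt (fun x : Sp d => dist x x₀ ^ 2)
      (∑ k, ((x k - x₀ k) • (EuclideanSpace.proj k : Sp d →L[ℝ] ℝ)
        + (x k - x₀ k) • (EuclideanSpace.proj k : Sp d →L[ℝ] ℝ))) x := by
    simp_rw [dist_sq_eq]
    refine HasFDerivAt.fun_sum fun k _ => ?_
    have h : HasFDerivAt (fun x : Sp d => x k - x₀ k) (EuclideanSpace.proj k : Sp d →L[ℝ] ℝ) x :=
      ((EuclideanSpace.proj k : Sp d →L[ℝ] ℝ).hasFDerivAt).sub_const _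
    exact h.mul h
  rw [h.fderiv]
  simp [coordVec, Finset.sum_add_distrib]
  ring

/-- The smooth weight which is `κ |x - x₀| ^ (2 γ)` where `|x - x₀| ≥ 1`. -/
def radialWeight (κ γ : ℝ) (x₀ x : Sp d) : ℝ := smoothRpow κ γ (dist x x₀ ^ 2)

theorem contDiff_radialWeight (κ γ : ℝ) (x₀ : Sp d) : ContDiff ℝ ∞ (radialWeight κ γ x₀) :=
  (contDiff_smoothRpow κ γ).comp (contDiff_dist_sq x₀)

theorem pd_radialWeight (κ γ : ℝ) (x₀ : Sp d) (i : Fin d) :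
    pd i (radialWeight κ γ x₀)
      = fun x => deriv (smoothRpow κ γ) (dist x x₀ ^ 2) * (2 * (x i - x₀ i)) := by
  funext x
  unfold radialWeight
  rw [pd_comp (contDiff_smoothRpow κ γ) (contDiff_dist_sq x₀), pd_dist_sq]

theorem pd_pd_radialWeight (κ γ : ℝ) (x₀ x : Sp d) (i j : Fin d) :
    pd i (pd j (radialWeight κ γ x₀)) x
      = deriv (deriv (smoothRpow κ γ)) (dist x x₀ ^ 2) * (2 * (x i - x₀ i)) * (2 * (x j - x₀ j))
        + deriv (smoothRpow κ γ) (dist x x₀ ^ 2) * (2 * if i = j then 1 else 0) := by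
  have h1 : ContDiff ℝ ∞ (deriv (smoothRpow κ γ)) :=
    (contDiff_infty_iff_deriv.1 (contDiff_smoothRpow κ γ)).2
  have h2 := contDiff_dist_sq x₀
  have h3 : ContDiff ℝ ∞ (fun x => deriv (smoothRpow κ γ) (dist x x₀ ^ 2)) := h1.comp h2
  rw [pd_radialWeight, pd_mul h3 (by fun_prop), pd_comp h1 h2, pd_dist_sq, pd_mul (by fun_prop) (by fun_prop),
    pd_const, pd_coord]
  ring

/-- For `φ = h(r²)` both terms are nonnegative when `h', h'' ≥ 0`, which gives convexity; the second
alone bounds the Hessian below. -/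
theorem radialWeight_hessian (κ γ : ℝ) (x₀ x : Sp d) (ξ : Fin d → ℝ) :
    ∑ i, ∑ j, pd i (pd j (radialWeight κ γ x₀)) x * ξ i * ξ j
      = 4 * deriv (deriv (smoothRpow κ γ)) (dist x x₀ ^ 2) * (∑ i, (x i - x₀ i) * ξ i) ^ 2
        + 2 * deriv (smoothRpow κ γ) (dist x x₀ ^ 2) * ∑ i, ξ i ^ 2 := by
  simp_rw [pd_pd_radialWeight, add_mul, Finset.sum_add_distrib]
  congr 1
  · rw [sq (∑ i, _), Finset.sum_mul_sum, Finset.mul_sum]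
    refine Finset.sum_congr rfl fun i _ => ?_
    rw [Finset.mul_sum]
    exact Finset.sum_congr rfl fun j _ => by ring
  · rw [Finset.mul_sum]
    refine Finset.sum_congr rfl fun i _ => ?_
    rw [Finset.sum_eq_single i (fun j _ hj => by simp [hj.symm]) (by simp)]
    simp
    ring

/-- The Carleman estimate with the weight `e^{λ b^{-β} r^β}` for test functions. -/
theorem carleman_test {β b : ℝ} (hβ : 2 ≤ β) (hb : 0 < b) (x₀ : Sp d) :
    ∃ κ lam₁ : ℝ, 0 < κ ∧ 0 < lam₁ ∧ ∀ lam, lam₁ ≤ lam → ∀ v : Sp d → ℝ,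
      ContDiff ℝ ∞ v → HasCompactSupport v → tsupport v ⊆ {x | 1 < dist x x₀ ∧ dist x x₀ < b} →
      κ * lam ^ 3 * ∫ x, (carlemanExp x₀ b β lam x * v x) ^ 2
        ≤ ∫ x, (carlemanExp x₀ b β lam x * ∑ i, pd i (pd i v) x) ^ 2 := by
  -- `r^β = (r²)^γ`, and `r²` is a polynomial. The condition `β ≥ 2` means `γ ≥ 1`, so `h(t) = κ₀
  -- t^γ` is convex on `t > 1` with `h' ≥ κ₀ γ`.
  set γ := β / 2 with hγdef
  have hγ : 1 ≤ γ := by rw [hγdef]; linarith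
  set κ₀ := b ^ (-β) with hκ₀
  have hκ₀pos : 0 < κ₀ := Real.rpow_pos_of_pos hb _
  set φ : Sp d → ℝ := radialWeight κ₀ γ x₀ with hφdef
  have hφ : ContDiff ℝ ∞ φ := contDiff_radialWeight _ _ _
  set U : Set (Sp d) := {x | 1 < dist x x₀ ∧ dist x x₀ < b} with hU
  have hU1 : ∀ x ∈ U, 1 < dist x x₀ ^ 2 := fun x hx => one_lt_pow₀ hx.1 (by simp)
  have hH1 : ∀ x ∈ U, κ₀ * γ ≤ deriv (smoothRpow κ₀ γ) (dist x x₀ ^ 2) := by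
    intro x hx
    rw [deriv_smoothRpow κ₀ γ (hU1 x hx), ← mul_assoc]
    exact le_mul_of_one_le_right (by positivity) (Real.one_le_rpow (hU1 x hx).le (by linarith))
  have hH2 : ∀ x ∈ U, 0 ≤ deriv (deriv (smoothRpow κ₀ γ)) (dist x x₀ ^ 2) := by
    intro x hx
    rw [deriv_deriv_smoothRpow κ₀ γ (hU1 x hx)]
    have : 0 ≤ γ - 1 := by linarith
    positivity
  have hκγ : 0 < κ₀ * γ := by positivity
  -- A bound for `Δ²φ`, by compactness of a ball containing `U`.
  obtain ⟨κ₂, hκ₂⟩ : ∃ κ₂ : ℝ, ∀ x ∈ Metric.closedBall x₀ b,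
      ‖∑ i, ∑ j, pd i (pd i (pd j (pd j φ))) x‖ ≤ κ₂ :=
    (isCompact_closedBall x₀ b).exists_bound_of_continuousOn
      (ContDiff.continuous (𝕜 := ℝ) (n := ∞) (by fun_prop)).continuousOn
  have hweight : ∀ (lam : ℝ) (x : Sp d), x ∈ U →
      Real.exp (lam * φ x) = carlemanExp x₀ b β lam x := by
    intro lam x hx
    rw [hφdef, carlemanExp, radialWeight, smoothRpow_of_one_le _ _ (hU1 x hx).le, ← mul_assoc,
      ← Real.rpow_natCast, ← Real.rpow_mul dist_nonneg]
    congr 4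
    rw [hγdef]
    push_cast
    ring
  have hκ₂' : 0 ≤ max κ₂ 0 := le_max_right _ _
  -- The general estimate gives `64 λ³ (κ₀γ)³ - 2λκ₂`; the choice of `lam₁` makes `λκ₂ ≤ λ³ (κ₀γ)³`,
  -- so much more than `8 λ³ (κ₀γ)³` is left.
  refine ⟨8 * (κ₀ * γ) ^ 3, 1 + max κ₂ 0 / (κ₀ * γ) ^ 3, by positivity, by positivity,
    fun lam hlam v hv hvc hvU => ?_⟩
  have hlam1 : 1 ≤ lam := by
    have : 0 ≤ max κ₂ 0 / (κ₀ * γ) ^ 3 := by positivity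
    linarith
  have key := carleman_of_convex (κ₁ := 8 * (κ₀ * γ) ^ 3) (κ₂ := max κ₂ 0) hφ (U := U)
    (fun x hx ξ => by
      rw [radialWeight_hessian]
      have := hH2 x hx
      have := hκγ.trans_le (hH1 x hx)
      positivity)
    -- Take `ξ = ∇φ` in the Hessian formula. Since `|∇φ|² = 4 h'² r²`, the second term is `8 h'³ r²
    -- ≥ 8 (κ₀γ)³`, using `r > 1`.
    (fun x hx => by
      have e : ∑ i, ∑ j, pd i φ x * pd j φ x * pd i (pd j φ) x
          = ∑ i, ∑ j, pd i (pd j φ) x * pd i φ x * pd j φ x :=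
        Finset.sum_congr rfl fun i _ => Finset.sum_congr rfl fun j _ => by ring
      have e2 : ∑ i, pd i φ x ^ 2
          = 4 * deriv (smoothRpow κ₀ γ) (dist x x₀ ^ 2) ^ 2 * dist x x₀ ^ 2 := by
        rw [dist_sq_eq x₀ x, Finset.mul_sum, ← dist_sq_eq]
        refine Finset.sum_congr rfl fun i _ => ?_
        rw [hφdef, pd_radialWeight]
        ring
      rw [e, radialWeight_hessian κ₀ γ x₀ x (fun i => pd i φ x), e2]
      have a1 := hH2 x hx
      have a2 := hH1 x hx
      have a3 := (hU1 x hx).le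
      have a4 : (κ₀ * γ) ^ 3 ≤ deriv (smoothRpow κ₀ γ) (dist x x₀ ^ 2) ^ 3 := by gcongr
      have a5 : 0 ≤ deriv (smoothRpow κ₀ γ) (dist x x₀ ^ 2) := hκγ.le.trans a2
      calc 8 * (κ₀ * γ) ^ 3 ≤ 8 * deriv (smoothRpow κ₀ γ) (dist x x₀ ^ 2) ^ 3 * 1 := by linarith
        _ ≤ 8 * deriv (smoothRpow κ₀ γ) (dist x x₀ ^ 2) ^ 3 * dist x x₀ ^ 2 := by gcongr
        _ ≤ 8 * deriv (smoothRpow κ₀ γ) (dist x x₀ ^ 2) ^ 3 * dist x x₀ ^ 2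
            + 4 * deriv (deriv (smoothRpow κ₀ γ)) (dist x x₀ ^ 2)
              * (∑ i, (x i - x₀ i) * pd i φ x) ^ 2 := le_add_of_nonneg_right (by positivity)
        _ = _ := by ring)
    (fun x hx => (le_abs_self _).trans ((hκ₂ x (Metric.mem_closedBall.2 hx.2.le)).trans
      (le_max_left _ _)))
    (by linarith : 0 ≤ lam) hv hvc hvU
  have hl : 8 * (κ₀ * γ) ^ 3 * lam ^ 3
      ≤ 8 * lam ^ 3 * (8 * (κ₀ * γ) ^ 3) - 2 * lam * max κ₂ 0 := by
    have h1 : max κ₂ 0 ≤ lam * (κ₀ * γ) ^ 3 := by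
      rw [← div_le_iff₀ (by positivity)]
      linarith
    have h2 : lam * max κ₂ 0 ≤ lam ^ 3 * (κ₀ * γ) ^ 3 := by
      calc lam * max κ₂ 0 ≤ lam * (lam * (κ₀ * γ) ^ 3) := by gcongr
        _ = lam ^ 2 * (κ₀ * γ) ^ 3 := by ring
        _ ≤ lam ^ 3 * (κ₀ * γ) ^ 3 := by gcongr; simp
    have h3 : 0 ≤ lam ^ 3 * (κ₀ * γ) ^ 3 := by positivity
    linarith
  have e1 : ∀ x, (carlemanExp x₀ b β lam x * v x) ^ 2 = (Real.exp (lam * φ x) * v x) ^ 2 := by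
    intro x
    by_cases hx : x ∈ tsupport v
    · rw [hweight lam x (hvU hx)]
    · simp [image_eq_zero_of_notMem_tsupport hx]
  have e2 : ∀ x, (carlemanExp x₀ b β lam x * ∑ i, pd i (pd i v) x) ^ 2
      = (Real.exp (lam * φ x) * ∑ i, pd i (pd i v) x) ^ 2 := by
    intro x
    by_cases hx : x ∈ tsupport v
    · rw [hweight lam x (hvU hx)]
    · simp [pd_pd_eq_zero_of_notMem_tsupport hx]
  simp_rw [e1, e2]
  exact (mul_le_mul_of_nonneg_right hl (integral_nonneg fun x => sq_nonneg _)).trans key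

end radial

/-! ### Mollification -/

section mollification

variable {d : ℕ} {Ω : Set (Sp d)} {ρ u v f g W : Sp d → ℝ}

/-- The convolution with `ρ` of the extension of `v` by zero outside `Ω`. -/
def moll (Ω : Set (Sp d)) (ρ v : Sp d → ℝ) (x : Sp d) : ℝ := ∫ y in Ω, ρ (x - y) * v y

open scoped Convolution in
theorem moll_eq_convolution (hΩ : MeasurableSet Ω) :
    moll Ω ρ v = (ρ ⋆[ContinuousLinearMap.lsmul ℝ ℝ, volume] (Ω.indicator v)) := by
  funext x
  rw [convolution_lsmul_swap, moll, ← integral_indicator hΩ]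
  congr 1
  funext y
  by_cases hy : y ∈ Ω <;> simp [hy]

theorem contDiff_moll (hΩ : MeasurableSet Ω) (hρ : ContDiff ℝ ∞ ρ) (hρc : HasCompactSupport ρ)
    (hv : IntegrableOn v Ω) : ContDiff ℝ ∞ (moll Ω ρ v) := by
  rw [moll_eq_convolution hΩ]
  exact hρc.contDiff_convolution_left _ hρ (hv.integrable_indicator hΩ).locallyIntegrable

theorem pd_moll (hΩ : MeasurableSet Ω) (hρ : ContDiff ℝ ∞ ρ) (hρc : HasCompactSupport ρ)
    (hv : IntegrableOn v Ω) (i : Fin d) : pd i (moll Ω ρ v) = moll Ω (pd i ρ) v := by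
  funext x
  have hl := (hv.integrable_indicator hΩ).locallyIntegrable
  have h := hρc.hasFDerivAt_convolution_left (ContinuousLinearMap.lsmul ℝ ℝ) (hρ.of_le (by simp))
    hl x (μ := volume)
  rw [moll_eq_convolution hΩ, moll_eq_convolution hΩ, pd, h.fderiv]
  have hex : ConvolutionExistsAt (fderiv ℝ ρ) (Ω.indicator v) x
      ((ContinuousLinearMap.lsmul ℝ ℝ).precompL (Sp d)) volume :=
    (hρc.fderiv ℝ).convolutionExists_left _ (hρ.continuous_fderiv (by simp)) hl x
  rw [convolution_def, ContinuousLinearMap.integral_apply hex]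
  rfl

theorem moll_eq_zero {ε : ℝ} (hρ : ∀ x, ε ≤ ‖x‖ → ρ x = 0) {x : Sp d}
    (hx : x ∉ Metric.thickening ε Ω) : moll Ω ρ v x = 0 := by
  rw [moll]
  refine setIntegral_eq_zero_of_forall_eq_zero fun y hy => ?_
  rw [hρ (x - y), zero_mul]
  by_contra! h
  exact hx (Metric.mem_thickening_iff.2 ⟨y, hy, by rwa [dist_eq_norm]⟩)

theorem tsupport_moll_subset {ε : ℝ} (hρ : ∀ x, ε ≤ ‖x‖ → ρ x = 0) :
    tsupport (moll Ω ρ v) ⊆ Metric.cthickening ε Ω := by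
  refine closure_minimal (fun x hx => ?_) Metric.isClosed_cthickening
  by_contra h
  exact hx (moll_eq_zero hρ (fun h' => h (Metric.thickening_subset_cthickening _ _ h')))

theorem hasCompactSupport_moll {ε : ℝ} (hρ : ∀ x, ε ≤ ‖x‖ → ρ x = 0)
    (hΩb : Bornology.IsBounded Ω) : HasCompactSupport (moll Ω ρ v) :=
  IsCompact.of_isClosed_subset (Metric.isCompact_of_isClosed_isBounded
    Metric.isClosed_cthickening hΩb.cthickening) (isClosed_tsupport _)
    (tsupport_moll_subset hρ)

theorem pd_comp_sub_left (hρ : ContDiff ℝ ∞ ρ) (i : Fin d) (x y : Sp d) :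
    pd i (fun y => ρ (x - y)) y = -pd i ρ (x - y) := by
  unfold pd
  have h := (differentiable_of_contDiff hρ (x - y)).hasFDerivAt.comp y
    ((hasFDerivAt_id y).const_sub x)
  have h' : fderiv ℝ (fun y => ρ (x - y)) y = _ := h.fderiv
  rw [h']
  simp

theorem contDiff_comp_sub_left (hρ : ContDiff ℝ ∞ ρ) (x : Sp d) :
    ContDiff ℝ ∞ (fun y => ρ (x - y)) := by fun_prop

theorem hasCompactSupport_comp_sub_left (hρc : HasCompactSupport ρ) (x : Sp d) :
    HasCompactSupport (fun y => ρ (x - y)) :=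
  hρc.comp_homeomorph (Homeomorph.subLeft x)

/-- Away from the boundary, mollification commutes with weak derivatives. -/
theorem moll_pd_of_isWeakDeriv {ε : ℝ} (hρ : ContDiff ℝ ∞ ρ) (hρε : ∀ x, ε ≤ ‖x‖ → ρ x = 0)
    {x : Sp d} (hx : Metric.closedBall x ε ⊆ Ω) {i : Fin d} (hw : IsWeakDeriv Ω i v g) :
    moll Ω (pd i ρ) v x = moll Ω ρ g x := by
  have hsupp : tsupport (fun y => ρ (x - y)) ⊆ Metric.closedBall x ε := by
    refine closure_minimal (fun y hy => ?_) Metric.isClosed_closedBall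
    by_contra h
    refine hy (hρε _ ?_)
    rw [Metric.mem_closedBall, not_le, dist_comm, dist_eq_norm] at h
    exact h.le
  have hc : HasCompactSupport (fun y => ρ (x - y)) :=
    IsCompact.of_isClosed_subset (isCompact_closedBall x ε) (isClosed_tsupport _) hsupp
  have h := hw _ (contDiff_comp_sub_left hρ x) hc (hsupp.trans hx)
  have e : ∀ y, fderiv ℝ (fun y => ρ (x - y)) y (coordVec i) = -pd i ρ (x - y) :=
    fun y => pd_comp_sub_left hρ i x y
  simp_rw [e, mul_neg, integral_neg, neg_inj] at h
  rw [moll, moll]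
  simp_rw [mul_comm _ (v _), mul_comm _ (g _)]
  exact h

/-- `Δv = f` on the whole space for the extensions by zero. -/
def IsExtLaplacian (Ω : Set (Sp d)) (v f : Sp d → ℝ) : Prop :=
  ∀ φ : Sp d → ℝ, ContDiff ℝ ∞ φ → HasCompactSupport φ →
    ∫ x in Ω, v x * ∑ i, pd i (pd i φ) x = ∫ x in Ω, f x * φ x

/-- Test the equation on the whole space with `y ↦ ρ(x - y)`. No distance from `x` to the boundary
is needed, because `IsExtLaplacian` admits test functions that do not vanish near `∂Ω`. -/
theorem laplacian_moll (hΩ : MeasurableSet Ω) (hρ : ContDiff ℝ ∞ ρ) (hρc : HasCompactSupport ρ)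
    (hv : IntegrableOn v Ω) (h : IsExtLaplacian Ω v f) (x : Sp d) :
    ∑ i, pd i (pd i (moll Ω ρ v)) x = moll Ω ρ f x := by
  have e : ∀ i, pd i (pd i (moll Ω ρ v)) = moll Ω (pd i (pd i ρ)) v := fun i => by
    rw [pd_moll hΩ hρ hρc hv, pd_moll hΩ (contDiff_pd' hρ) hρc.pd hv]
  have h1 := h _ (contDiff_comp_sub_left hρ x) (hasCompactSupport_comp_sub_left hρc x)
  have e1 : ∀ i y, pd i (pd i (fun y => ρ (x - y))) y = pd i (pd i ρ) (x - y) := by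
    intro i y
    have : pd i (fun y => ρ (x - y)) = fun y => (0 : ℝ) - pd i ρ (x - y) := by
      funext y
      rw [pd_comp_sub_left hρ]; simp
    rw [this, pd_sub contDiff_const (contDiff_comp_sub_left (contDiff_pd' hρ) x), pd_const,
      pd_comp_sub_left (contDiff_pd' hρ)]
    simp
  simp_rw [e1] at h1
  simp_rw [e]
  unfold moll
  rw [← integral_finsetSum]
  · simp_rw [← Finset.sum_mul, mul_comm _ (v _), mul_comm _ (f _)]
    exact h1
  · intro i _
    refine Integrable.bdd_mul (c := (hρc.pd (i := i).pd (i := i)).exists_bound_of_continuous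
      (contDiff_pd' (contDiff_pd' hρ)).continuous |>.choose) hv ?_ ?_
    · exact (ContDiff.continuous (𝕜 := ℝ) (n := ∞)
        (contDiff_comp_sub_left (contDiff_pd' (contDiff_pd' hρ)) x)).aestronglyMeasurable
    · exact ae_of_all _ fun y => (hρc.pd (i := i).pd (i := i)).exists_bound_of_continuous
        (contDiff_pd' (contDiff_pd' hρ)).continuous |>.choose_spec _

/-- Jensen's inequality for a mollification. -/
theorem moll_sq_le (hρ : Continuous ρ) (hρc : HasCompactSupport ρ) (hρ0 : ∀ x, 0 ≤ ρ x)
    (hρ1 : ∫ x, ρ x = 1) (hΩb : Bornology.IsBounded Ω) (hv : MemLp v 2 (volume.restrict Ω))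
    (x : Sp d) : moll Ω ρ v x ^ 2 ≤ ∫ y in Ω, ρ (x - y) * v y ^ 2 := by
  have hfin : IsFiniteMeasure (volume.restrict Ω) := ⟨by
    rw [Measure.restrict_apply_univ]; exact hΩb.measure_lt_top⟩
  obtain ⟨K, hK⟩ := hρc.exists_bound_of_continuous hρ
  have hρx : Continuous (fun y => ρ (x - y)) := by fun_prop
  have i1 : IntegrableOn (fun y => ρ (x - y) * v y) Ω :=
    Integrable.bdd_mul (c := K) (hv.integrable (by norm_num)) hρx.aestronglyMeasurable
      (ae_of_all _ fun y => hK _)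
  have i2 : IntegrableOn (fun y => ρ (x - y) * v y ^ 2) Ω :=
    Integrable.bdd_mul (c := K) hv.integrable_sq hρx.aestronglyMeasurable
      (ae_of_all _ fun y => hK _)
  have hρi : Integrable (fun y => ρ (x - y)) :=
    (hρ.integrable_of_hasCompactSupport hρc).comp_sub_left x
  have i3 : IntegrableOn (fun y => ρ (x - y)) Ω := hρi.integrableOn
  have h3 : ∫ y in Ω, ρ (x - y) ≤ 1 := by
    calc ∫ y in Ω, ρ (x - y) ≤ ∫ y, ρ (x - y) :=
          setIntegral_le_integral hρi (ae_of_all _ fun y => hρ0 _)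
      _ = 1 := by rw [integral_sub_left_eq_self ρ volume x, hρ1]
  -- Expand the nonnegative integral `∫ ρ(x - y) (v(y) - m)²`. The kernel may have mass less than 1
  -- on `Ω`, but mass at most 1 suffices for `m² ≤ ∫ ρ v²`.
  set m := moll Ω ρ v x with hm
  have h4 : 0 ≤ ∫ y in Ω, ρ (x - y) * (v y - m) ^ 2 :=
    integral_nonneg fun y => mul_nonneg (hρ0 _) (sq_nonneg _)
  have h5 : ∫ y in Ω, ρ (x - y) * (v y - m) ^ 2
      = (∫ y in Ω, ρ (x - y) * v y ^ 2) - 2 * m * m + m ^ 2 * ∫ y in Ω, ρ (x - y) := by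
    have e : ∀ y, ρ (x - y) * (v y - m) ^ 2
        = ρ (x - y) * v y ^ 2 - 2 * m * (ρ (x - y) * v y) + m ^ 2 * ρ (x - y) := fun y => by ring
    simp_rw [e]
    refine (integral_add (i2.sub (i1.const_mul _)) (i3.const_mul _)).trans ?_
    rw [integral_sub' i2 (i1.const_mul _), integral_const_mul, integral_const_mul]
    rfl
  nlinarith [sq_nonneg m]

/-- The weighted `L²` bound for mollifications. -/
theorem integral_moll_sq_le (hρ : ContDiff ℝ ∞ ρ) (hρc : HasCompactSupport ρ) (hρ0 : ∀ x, 0 ≤ ρ x)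
    (hρ1 : ∫ x, ρ x = 1) {ε : ℝ} (hρε : ∀ x, ε ≤ ‖x‖ → ρ x = 0) (hΩ : MeasurableSet Ω)
    (hΩb : Bornology.IsBounded Ω) (hv : MemLp v 2 (volume.restrict Ω))
    (hW : Continuous W) (hW0 : ∀ x, 0 ≤ W x)
    (hWε : ∀ x, ∀ y ∈ Ω, dist x y < ε → W x ≤ 2 * W y) :
    ∫ x, W x * moll Ω ρ v x ^ 2 ≤ 2 * ∫ x in Ω, W x * v x ^ 2 := by
  have hfin : IsFiniteMeasure (volume.restrict Ω) := ⟨by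
    rw [Measure.restrict_apply_univ]; exact hΩb.measure_lt_top⟩
  obtain ⟨K, hK⟩ := hρc.exists_bound_of_continuous hρ.continuous
  have hvi : IntegrableOn v Ω := hv.integrable (by norm_num)
  have hWv : IntegrableOn (fun x => W x * v x ^ 2) Ω := by
    obtain ⟨K', hK'⟩ := (Metric.isCompact_of_isClosed_isBounded isClosed_closure
      hΩb.closure).exists_bound_of_continuousOn hW.continuousOn
    exact Integrable.bdd_mul (c := K') hv.integrable_sq hW.aestronglyMeasurable
      (ae_restrict_of_forall_mem hΩ fun y hy => hK' y (subset_closure hy))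
  have hρi : Integrable ρ := hρ.continuous.integrable_of_hasCompactSupport hρc
  have hmeas : AEMeasurable (Function.uncurry fun x y : Sp d =>
      ENNReal.ofReal (2 * (W y * v y ^ 2)) * ENNReal.ofReal (ρ (x - y)))
      (volume.prod (volume.restrict Ω)) := by
    refine AEMeasurable.mul (f := fun p : Sp d × Sp d => ENNReal.ofReal (2 * (W p.2 * v p.2 ^ 2)))
      (g := fun p : Sp d × Sp d => ENNReal.ofReal (ρ (p.1 - p.2))) ?_ ?_
    · exact ((hWv.aestronglyMeasurable.aemeasurable.const_mul 2).ennreal_ofReal).comp_snd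
    · refine Measurable.aemeasurable (Measurable.ennreal_ofReal ?_)
      exact (hρ.continuous.comp (continuous_fst.sub continuous_snd)).measurable
  -- Jensen's inequality followed by Tonelli, in `ℝ≥0∞` so that no integrability on the product has
  -- to be shown.
  have key : ∫⁻ x, ENNReal.ofReal (W x * moll Ω ρ v x ^ 2)
      ≤ ENNReal.ofReal (2 * ∫ x in Ω, W x * v x ^ 2) := by
    calc ∫⁻ x, ENNReal.ofReal (W x * moll Ω ρ v x ^ 2)
        ≤ ∫⁻ x, ∫⁻ y in Ω, ENNReal.ofReal (2 * (W y * v y ^ 2)) * ENNReal.ofReal (ρ (x - y)) := by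
          refine lintegral_mono fun x => ?_
          have i2 : IntegrableOn (fun y => ρ (x - y) * v y ^ 2) Ω :=
            Integrable.bdd_mul (c := K) hv.integrable_sq
              (by fun_prop : Continuous (fun y => ρ (x - y))).aestronglyMeasurable
              (ae_of_all _ fun y => hK _)
          calc ENNReal.ofReal (W x * moll Ω ρ v x ^ 2)
              ≤ ENNReal.ofReal (∫ y in Ω, W x * (ρ (x - y) * v y ^ 2)) := by
                rw [integral_const_mul]
                exact ENNReal.ofReal_le_ofReal (mul_le_mul_of_nonneg_left
                  (moll_sq_le hρ.continuous hρc hρ0 hρ1 hΩb hv x) (hW0 x))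
            _ = ∫⁻ y in Ω, ENNReal.ofReal (W x * (ρ (x - y) * v y ^ 2)) :=
                ofReal_integral_eq_lintegral_ofReal (i2.const_mul _) (ae_of_all _ fun y =>
                  mul_nonneg (hW0 x) (mul_nonneg (hρ0 _) (sq_nonneg _)))
            _ ≤ _ := by
                refine setLIntegral_mono' hΩ fun y hy => ?_
                rw [← ENNReal.ofReal_mul (mul_nonneg zero_le_two
                  (mul_nonneg (hW0 y) (sq_nonneg _)))]
                refine ENNReal.ofReal_le_ofReal ?_
                -- Where the kernel does not vanish, the weight at `x` is exchanged for twice the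
                -- weight at `y`.
                by_cases h : dist x y < ε
                · have := mul_le_mul_of_nonneg_right (hWε x y hy h)
                    (mul_nonneg (hρ0 (x - y)) (sq_nonneg (v y)))
                  linarith
                · rw [hρε (x - y) (by rw [← dist_eq_norm]; exact not_lt.1 h)]
                  simp
      _ = ∫⁻ y in Ω, ∫⁻ x, ENNReal.ofReal (2 * (W y * v y ^ 2)) * ENNReal.ofReal (ρ (x - y)) :=
          lintegral_lintegral_swap hmeas
      _ = ∫⁻ y in Ω, ENNReal.ofReal (2 * (W y * v y ^ 2)) := by
          refine lintegral_congr fun y => ?_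
          rw [lintegral_const_mul _ (Measurable.ennreal_ofReal
            (by fun_prop : Continuous (fun x => ρ (x - y))).measurable),
            lintegral_sub_right_eq_self (fun x => ENNReal.ofReal (ρ x)) y,
            ← ofReal_integral_eq_lintegral_ofReal hρi (ae_of_all _ hρ0), hρ1]
          simp
      _ = ENNReal.ofReal (2 * ∫ x in Ω, W x * v x ^ 2) := by
          rw [← integral_const_mul]
          exact (ofReal_integral_eq_lintegral_ofReal (hWv.const_mul 2) (ae_of_all _ fun y =>
            mul_nonneg zero_le_two (mul_nonneg (hW0 y) (sq_nonneg _)))).symm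
  rw [integral_eq_lintegral_of_nonneg_ae (ae_of_all _ fun x => mul_nonneg (hW0 x) (sq_nonneg _))
    (hW.mul ((contDiff_moll hΩ hρ hρc hvi).continuous.pow 2)).aestronglyMeasurable]
  refine ENNReal.toReal_le_of_le_ofReal ?_ key
  exact mul_nonneg zero_le_two (integral_nonneg fun x => mul_nonneg (hW0 x) (sq_nonneg _))

/-- Fatou's lemma: bounds on mollifications pass to their almost everywhere limit, so `L²`
convergence of mollifications is never needed. -/
theorem integral_sq_le_of_ae_tendsto {α : Type*} [MeasurableSpace α] {μ : Measure α}
    {F : ℕ → α → ℝ} {G : α → ℝ} {K : ℝ} (hF : ∀ n, Integrable (fun x => F n x ^ 2) μ)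
    (hG : AEStronglyMeasurable G μ)
    (hlim : ∀ᵐ x ∂μ, Tendsto (fun n => F n x) atTop (𝓝 (G x)))
    (hK : ∀ᶠ n in atTop, ∫ x, F n x ^ 2 ∂μ ≤ K) : ∫ x, G x ^ 2 ∂μ ≤ K := by
  have hK0 : 0 ≤ K := by
    obtain ⟨n, hn⟩ := hK.exists
    exact (integral_nonneg fun x => sq_nonneg _).trans hn
  rw [integral_eq_lintegral_of_nonneg_ae (ae_of_all _ fun x => sq_nonneg _) (hG.pow 2)]
  refine ENNReal.toReal_le_of_le_ofReal hK0 ?_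
  calc ∫⁻ x, ENNReal.ofReal (G x ^ 2) ∂μ
      = ∫⁻ x, liminf (fun n => ENNReal.ofReal (F n x ^ 2)) atTop ∂μ := by
        refine lintegral_congr_ae ?_
        filter_upwards [hlim] with x hx
        exact ((ENNReal.tendsto_ofReal (hx.pow 2)).liminf_eq).symm
    _ ≤ liminf (fun n => ∫⁻ x, ENNReal.ofReal (F n x ^ 2) ∂μ) atTop :=
        lintegral_liminf_le' fun n => (hF n).aestronglyMeasurable.aemeasurable.ennreal_ofReal
    _ ≤ ENNReal.ofReal K := by
        refine liminf_le_of_frequently_le' (Eventually.frequently ?_)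
        filter_upwards [hK] with n hn
        rw [← ofReal_integral_eq_lintegral_ofReal (hF n) (ae_of_all _ fun x => sq_nonneg _)]
        exact ENNReal.ofReal_le_ofReal hn

/-- A sequence of smooth bump functions with shrinking supports. -/
def bumpSeq (d n : ℕ) : ContDiffBump (0 : Sp d) where
  rIn := 1 / (n + 1) / 2
  rOut := 1 / (n + 1)
  rIn_pos := by positivity
  rIn_lt_rOut := half_lt_self (by positivity)

/-- A sequence of mollifiers, the `n`-th being supported in the ball of radius `1 / (n + 1)`. -/
def mollifier (d n : ℕ) : Sp d → ℝ := (bumpSeq d n).normed volume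

theorem contDiff_mollifier (n : ℕ) : ContDiff ℝ ∞ (mollifier d n) := (bumpSeq d n).contDiff_normed

theorem hasCompactSupport_mollifier (n : ℕ) : HasCompactSupport (mollifier d n) :=
  (bumpSeq d n).hasCompactSupport_normed

theorem mollifier_nonneg (n : ℕ) (x : Sp d) : 0 ≤ mollifier d n x := (bumpSeq d n).nonneg_normed x

theorem integral_mollifier (n : ℕ) : ∫ x, mollifier d n x = 1 := (bumpSeq d n).integral_normed

theorem mollifier_eq_zero (n : ℕ) (x : Sp d) (hx : (1 : ℝ) / (n + 1) ≤ ‖x‖) :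
    mollifier d n x = 0 := by
  have h := (bumpSeq d n).support_normed_eq (μ := volume)
  by_contra hne
  have : x ∈ Function.support (mollifier d n) := hne
  rw [mollifier, h, mem_ball_zero_iff] at this
  exact absurd hx (not_le.2 this)

/-- The derivative vanishes on the open set `‖x‖ > ε` and, by continuity, on the sphere too. Thus
`pd i ρ` can serve as a kernel with the same radius when a second derivative is moved. -/
theorem pd_eq_zero_of_norm_ge {ε : ℝ} (hε : 0 < ε) (hρ : ContDiff ℝ ∞ ρ)
    (h : ∀ x, ε ≤ ‖x‖ → ρ x = 0) (i : Fin d) (x : Sp d) (hx : ε ≤ ‖x‖) : pd i ρ x = 0 := by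
  have hcl : x ∈ closure {y : Sp d | ε < ‖y‖} := by
    have hx0 : 0 < ‖x‖ := hε.trans_le hx
    refine mem_closure_of_tendsto (f := fun n : ℕ => (1 + 1 / ((n : ℝ) + 1)) • x)
      (b := atTop) ?_ (Eventually.of_forall fun n => ?_)
    · have := (tendsto_one_div_add_atTop_nhds_zero_nat (𝕜 := ℝ)).const_add 1
      simpa using this.smul_const x
    · have h1 : (0 : ℝ) < 1 / ((n : ℝ) + 1) := by positivity
      rw [mem_ofPred_eq, norm_smul, Real.norm_of_nonneg (by positivity)]
      nlinarith
  have hz : ∀ y ∈ {y : Sp d | ε < ‖y‖}, pd i ρ y = 0 := by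
    intro y hy
    have : ρ =ᶠ[𝓝 y] fun _ => (0 : ℝ) := by
      filter_upwards [(isOpen_lt continuous_const continuous_norm).mem_nhds hy] with z hz
        using h z (le_of_lt hz)
    rw [pd, this.fderiv_eq]
    simp
  exact (isClosed_singleton.preimage (contDiff_pd' hρ).continuous).closure_subset_iff.2 hz hcl

theorem ae_tendsto_moll (hΩ : MeasurableSet Ω) (hv : IntegrableOn v Ω) :
    ∀ᵐ x ∂(volume.restrict Ω), Tendsto (fun n => moll Ω (mollifier d n) v x) atTop (𝓝 (v x)) := by
  -- `K = 2` because the inner radius of each bump is half the outer one.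
  have h := ContDiffBump.ae_convolution_tendsto_right_of_locallyIntegrable (μ := volume)
    (φ := bumpSeq d) (l := atTop) (K := 2) tendsto_one_div_add_atTop_nhds_zero_nat
    (Eventually.of_forall fun n => by simp only [bumpSeq]; linarith)
    (hv.integrable_indicator hΩ).locallyIntegrable
  filter_upwards [ae_restrict_of_ae h, ae_restrict_mem hΩ] with x hx hxΩ
  rw [indicator_of_mem hxΩ] at hx
  simp_rw [moll_eq_convolution hΩ]
  exact hx

theorem eventually_closedBall_subset (hΩ : IsOpen Ω) {x : Sp d} (hx : x ∈ Ω) :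
    ∀ᶠ n : ℕ in atTop, Metric.closedBall x (1 / (n + 1)) ⊆ Ω := by
  obtain ⟨ε, hε, h⟩ := Metric.nhds_basis_closedBall.mem_iff.1 (hΩ.mem_nhds hx)
  filter_upwards [tendsto_one_div_add_atTop_nhds_zero_nat.eventually_le_const hε] with n hn
  exact (Metric.closedBall_subset_closedBall hn).trans h

/-! ### Estimates for functions with zero Cauchy data -/

/-- The bound is uniform in `n`; the factor 2 is the slack of `integral_moll_sq_le` applied with `W
= 1`. -/
theorem laplacian_mollifier_bound (hΩ : MeasurableSet Ω) (hΩb : Bornology.IsBounded Ω)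
    (hv : MemLp v 2 (volume.restrict Ω)) (hf : MemLp f 2 (volume.restrict Ω))
    (h : IsExtLaplacian Ω v f) (n : ℕ) :
    ∫ x, (∑ k, pd k (pd k (moll Ω (mollifier d n) v)) x) ^ 2 ≤ 2 * ∫ x in Ω, f x ^ 2 := by
  have hfin : IsFiniteMeasure (volume.restrict Ω) := ⟨by
    rw [Measure.restrict_apply_univ]; exact hΩb.measure_lt_top⟩
  simp_rw [laplacian_moll hΩ (contDiff_mollifier n) (hasCompactSupport_mollifier n)
    (hv.integrable (by norm_num)) h]
  simpa using integral_moll_sq_le (contDiff_mollifier n) (hasCompactSupport_mollifier n)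
    (mollifier_nonneg n) (integral_mollifier n) (mollifier_eq_zero n) hΩ hΩb hf
    (continuous_const (y := (1 : ℝ))) (fun _ => zero_le_one) (fun _ _ _ _ => by norm_num)

theorem integrable_sq_of_test {z : Sp d → ℝ} (hz : Continuous z) (hzc : HasCompactSupport z) :
    Integrable (fun x => z x ^ 2) :=
  (hz.pow 2).integrable_of_hasCompactSupport
    (HasCompactSupport.intro hzc fun x hx => by simp [image_eq_zero_of_notMem_tsupport hx])

/-- `∫_Ω |∂_i v|² ≤ 2 ∫_Ω v² + 2 ∫_Ω |Δv|²` for zero Cauchy data. -/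
theorem integral_weakDeriv_sq_le (hΩ : IsOpen Ω) (hΩb : Bornology.IsBounded Ω)
    (hv : MemLp v 2 (volume.restrict Ω)) (hf : MemLp f 2 (volume.restrict Ω))
    (h : IsExtLaplacian Ω v f) (hg : MemLp g 2 (volume.restrict Ω)) {i : Fin d}
    (hvg : IsWeakDeriv Ω i v g) :
    ∫ x in Ω, g x ^ 2 ≤ 2 * (∫ x in Ω, v x ^ 2) + 2 * ∫ x in Ω, f x ^ 2 := by
  have hfin : IsFiniteMeasure (volume.restrict Ω) := ⟨by
    rw [Measure.restrict_apply_univ]; exact hΩb.measure_lt_top⟩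
  have hm := hΩ.measurableSet
  have hvi : IntegrableOn v Ω := hv.integrable (by norm_num)
  have hs : ∀ n, ContDiff ℝ ∞ (moll Ω (mollifier d n) v) := fun n =>
    contDiff_moll hm (contDiff_mollifier n) (hasCompactSupport_mollifier n) hvi
  have hc : ∀ n, HasCompactSupport (moll Ω (mollifier d n) v) := fun n =>
    hasCompactSupport_moll (mollifier_eq_zero n) hΩb
  have hi : ∀ n, Integrable (fun x => pd i (moll Ω (mollifier d n) v) x ^ 2) := fun n =>
    integrable_sq_of_test (contDiff_pd' (hs n)).continuous (hc n).pd
  refine integral_sq_le_of_ae_tendsto (F := fun n => pd i (moll Ω (mollifier d n) v))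
    (fun n => (hi n).integrableOn) hg.aestronglyMeasurable ?_ (Eventually.of_forall fun n => ?_)
  · filter_upwards [ae_tendsto_moll hm (hg.integrable (by norm_num)), ae_restrict_mem hm]
      with x hx hxΩ
    refine hx.congr' ?_
    -- At a fixed interior point, mollification commutes with the weak derivative once the kernel
    -- fits inside `Ω`.
    filter_upwards [eventually_closedBall_subset hΩ hxΩ] with n hn
    rw [pd_moll hm (contDiff_mollifier n) (hasCompactSupport_mollifier n) hvi,
      moll_pd_of_isWeakDeriv (contDiff_mollifier n) (mollifier_eq_zero n) hn hvg]
  · refine (setIntegral_le_integral (hi n) (ae_of_all _ fun x => sq_nonneg _)).trans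
      ((integral_pd_sq_le (hs n) (hc n) i).trans (add_le_add ?_
        (laplacian_mollifier_bound hm hΩb hv hf h n)))
    simpa using integral_moll_sq_le (contDiff_mollifier n) (hasCompactSupport_mollifier n)
      (mollifier_nonneg n) (integral_mollifier n) (mollifier_eq_zero n) hm hΩb hv
      (continuous_const (y := (1 : ℝ))) (fun _ => zero_le_one) (fun _ _ _ _ => by norm_num)

/-- `∫_Ω |∂_j ∂_i v|² ≤ 2 ∫_Ω |Δv|²` for zero Cauchy data. -/
theorem integral_weakDeriv_weakDeriv_sq_le (hΩ : IsOpen Ω) (hΩb : Bornology.IsBounded Ω)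
    (hv : MemLp v 2 (volume.restrict Ω)) (hf : MemLp f 2 (volume.restrict Ω))
    (h : IsExtLaplacian Ω v f) (hu : MemLp u 2 (volume.restrict Ω)) {i j : Fin d}
    (hvg : IsWeakDeriv Ω i v g) (hgu : IsWeakDeriv Ω j g u) :
    ∫ x in Ω, u x ^ 2 ≤ 2 * ∫ x in Ω, f x ^ 2 := by
  have hfin : IsFiniteMeasure (volume.restrict Ω) := ⟨by
    rw [Measure.restrict_apply_univ]; exact hΩb.measure_lt_top⟩
  have hm := hΩ.measurableSet
  have hvi : IntegrableOn v Ω := hv.integrable (by norm_num)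
  have hs : ∀ n, ContDiff ℝ ∞ (moll Ω (mollifier d n) v) := fun n =>
    contDiff_moll hm (contDiff_mollifier n) (hasCompactSupport_mollifier n) hvi
  have hc : ∀ n, HasCompactSupport (moll Ω (mollifier d n) v) := fun n =>
    hasCompactSupport_moll (mollifier_eq_zero n) hΩb
  have hi : ∀ n, Integrable (fun x => pd i (pd j (moll Ω (mollifier d n) v)) x ^ 2) := fun n =>
    integrable_sq_of_test (contDiff_pd' (contDiff_pd' (hs n))).continuous (hc n).pd.pd
  refine integral_sq_le_of_ae_tendsto (F := fun n => pd i (pd j (moll Ω (mollifier d n) v)))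
    (fun n => (hi n).integrableOn) hu.aestronglyMeasurable ?_ (Eventually.of_forall fun n => ?_)
  · filter_upwards [ae_tendsto_moll hm (hu.integrable (by norm_num)), ae_restrict_mem hm]
      with x hx hxΩ
    refine hx.congr' ?_
    filter_upwards [eventually_closedBall_subset hΩ hxΩ] with n hn
    have hρ := contDiff_mollifier (d := d) n
    have hρc := hasCompactSupport_mollifier (d := d) n
    have hz : ∀ x : Sp d, (1 : ℝ) / (n + 1) ≤ ‖x‖ → pd j (mollifier d n) x = 0 :=
      pd_eq_zero_of_norm_ge (by positivity) hρ (mollifier_eq_zero n) j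
    rw [pd_moll hm hρ hρc hvi, pd_moll hm (contDiff_pd' hρ) hρc.pd hvi,
      moll_pd_of_isWeakDeriv (contDiff_pd' hρ) hz hn hvg,
      moll_pd_of_isWeakDeriv hρ (mollifier_eq_zero n) hn hgu]
  · exact (setIntegral_le_integral (hi n) (ae_of_all _ fun x => sq_nonneg _)).trans
      ((integral_pd_pd_sq_le (hs n) (hc n) i j).trans (laplacian_mollifier_bound hm hΩb hv hf h n))

theorem continuous_carlemanExp {β : ℝ} (hβ : 0 ≤ β) (x₀ : Sp d) (b lam : ℝ) :
    Continuous (carlemanExp x₀ b β lam) := by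
  unfold carlemanExp
  have : Continuous (fun x : Sp d => dist x x₀ ^ β) :=
    (continuous_id.dist continuous_const).rpow_const fun _ => Or.inr hβ
  fun_prop

/-- `log W` is uniformly continuous near the compact closure of `Ω`, so at small distances it
changes by less than `log 2`. The point `x` may lie outside `Ω`, as mollifications spill over the
boundary. -/
theorem eventually_le_two_mul (hΩb : Bornology.IsBounded Ω) (hW : Continuous W)
    (hW0 : ∀ x, 0 < W x) :
    ∀ᶠ n : ℕ in atTop, ∀ x, ∀ y ∈ Ω, dist x y < 1 / (n + 1) → W x ≤ 2 * W y := by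
  have hK : IsCompact (closure Ω) :=
    Metric.isCompact_of_isClosed_isBounded isClosed_closure hΩb.closure
  have hlog : Continuous (fun x => Real.log (W x)) := hW.log fun x => (hW0 x).ne'
  have hu := hK.uniformContinuousAt_of_continuousAt _ (fun x _ => hlog.continuousAt)
    (Metric.dist_mem_uniformity (Real.log_pos one_lt_two))
  obtain ⟨ε, hε, h⟩ := Metric.mem_uniformity_dist.1 hu
  filter_upwards [tendsto_one_div_add_atTop_nhds_zero_nat.eventually_le_const hε] with n hn x y hy hxy
  have h1 : dist (Real.log (W y)) (Real.log (W x)) < Real.log 2 :=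
    h (a := y) (b := x) (by rw [dist_comm]; exact hxy.trans_le hn) (subset_closure hy)
  rw [dist_comm, Real.dist_eq] at h1
  have h2 : Real.log (W x) ≤ Real.log (2 * W y) := by
    rw [Real.log_mul two_ne_zero (hW0 y).ne']
    linarith [le_abs_self (Real.log (W x) - Real.log (W y))]
  exact (Real.log_le_log_iff (hW0 x) (mul_pos two_pos (hW0 y))).1 h2

/-- The Carleman estimate for functions with zero Cauchy data. -/
theorem carleman_of_isExtLaplacian {β b : ℝ} (hβ : 2 ≤ β) (hΩ : IsOpen Ω)
    (hΩb : Bornology.IsBounded Ω) (x₀ : Sp d) (hx₀ : ∀ x ∈ closure Ω, 1 < dist x x₀)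
    (hb : ∀ x ∈ closure Ω, dist x x₀ < b) :
    ∃ κ lam₁ : ℝ, 0 < κ ∧ 0 < lam₁ ∧ ∀ lam, lam₁ ≤ lam → ∀ v f : Sp d → ℝ,
      MemLp v 2 (volume.restrict Ω) → MemLp f 2 (volume.restrict Ω) → IsExtLaplacian Ω v f →
      κ * lam ^ 3 * ∫ x in Ω, (carlemanExp x₀ b β lam x * v x) ^ 2
        ≤ ∫ x in Ω, (carlemanExp x₀ b β lam x * f x) ^ 2 := by
  have hfin : IsFiniteMeasure (volume.restrict Ω) := ⟨by
    rw [Measure.restrict_apply_univ]; exact hΩb.measure_lt_top⟩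
  rcases Ω.eq_empty_or_nonempty with rfl | ⟨y, hy⟩
  · exact ⟨1, 1, one_pos, one_pos, by simp⟩
  have hb0 : 0 < b := by
    have h1 := hx₀ y (subset_closure hy)
    have h2 := hb y (subset_closure hy)
    linarith
  obtain ⟨κ, lam₁, hκ, hlam₁, key⟩ := carleman_test (d := d) hβ hb0 x₀
  -- Half of the constant for test functions is lost to the factor 2 in mollifying the weighted
  -- right-hand side. The threshold on `n` may depend on `λ`, but `κ` does not.
  refine ⟨κ / 2, lam₁, by positivity, hlam₁, fun lam hlam v f hv hf h => ?_⟩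
  have hlam0 : 0 < lam := hlam₁.trans_le hlam
  have hm := hΩ.measurableSet
  have hvi : IntegrableOn v Ω := hv.integrable (by norm_num)
  set w := carlemanExp x₀ b β lam with hw
  have hwc : Continuous w := continuous_carlemanExp (by linarith) _ _ _
  have hs : ∀ n, ContDiff ℝ ∞ (moll Ω (mollifier d n) v) := fun n =>
    contDiff_moll hm (contDiff_mollifier n) (hasCompactSupport_mollifier n) hvi
  have hc : ∀ n, HasCompactSupport (moll Ω (mollifier d n) v) := fun n =>
    hasCompactSupport_moll (mollifier_eq_zero n) hΩb
  have hi : ∀ n, Integrable (fun x => (w x * moll Ω (mollifier d n) v x) ^ 2) := fun n =>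
    integrable_sq_of_test (hwc.mul (hs n).continuous) (hc n).mul_left
  have hopen : IsOpen {x : Sp d | 1 < dist x x₀ ∧ dist x x₀ < b} :=
    (isOpen_lt continuous_const (continuous_id.dist continuous_const)).and
      (isOpen_lt (continuous_id.dist continuous_const) continuous_const)
  -- The closure of `Ω` is compact inside the open annulus `1 < r < b`, so a thickening, hence the
  -- support of fine mollifications, stays inside.
  obtain ⟨δ, hδ, hδU⟩ := (Metric.isCompact_of_isClosed_isBounded isClosed_closure
    hΩb.closure).exists_cthickening_subset_open hopen (fun x hx => ⟨hx₀ x hx, hb x hx⟩)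
  rw [Metric.cthickening_closure] at hδU
  have main : ∫ x in Ω, (w x * v x) ^ 2 ≤ (κ * lam ^ 3)⁻¹ * (2 * ∫ x in Ω, w x ^ 2 * f x ^ 2) := by
    refine integral_sq_le_of_ae_tendsto (F := fun n x => w x * moll Ω (mollifier d n) v x)
      (fun n => (hi n).integrableOn)
      (hwc.aestronglyMeasurable.mul hv.aestronglyMeasurable) ?_ ?_
    · filter_upwards [ae_tendsto_moll hm hvi] with x hx
      exact hx.const_mul _
    · filter_upwards [eventually_le_two_mul hΩb (hwc.pow 2) (fun x => pow_pos (Real.exp_pos _) 2),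
        tendsto_one_div_add_atTop_nhds_zero_nat.eventually_le_const hδ] with n hn hnδ
      refine (setIntegral_le_integral (hi n) (ae_of_all _ fun x => sq_nonneg _)).trans ?_
      rw [le_inv_mul_iff₀ (by positivity)]
      have h1 := key lam hlam _ (hs n) (hc n) ((tsupport_moll_subset (mollifier_eq_zero n)).trans
        ((Metric.cthickening_mono hnδ Ω).trans hδU))
      simp_rw [laplacian_moll hm (contDiff_mollifier n) (hasCompactSupport_mollifier n) hvi h] at h1
      refine h1.trans ?_
      simp_rw [mul_pow]
      exact integral_moll_sq_le (contDiff_mollifier n) (hasCompactSupport_mollifier n)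
        (mollifier_nonneg n) (integral_mollifier n) (mollifier_eq_zero n) hm hΩb hf
        (hwc.pow 2) (fun x => sq_nonneg _) hn
  rw [le_inv_mul_iff₀ (by positivity)] at main
  simp_rw [mul_pow] at main ⊢
  linarith

end mollification

/-! ### Weak derivatives -/

section weak

variable {d : ℕ} {Ω : Set (Sp d)} {u v w w' g f : Sp d → ℝ} {i : Fin d}

theorem memLp_of_test {τ : Sp d → ℝ} (hτ : Continuous τ) (hc : HasCompactSupport τ) :
    MemLp τ 2 (volume.restrict Ω) :=
  (hτ.memLp_of_hasCompactSupport hc).restrict Ω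

theorem memLp_test_pd {φ : Sp d → ℝ} (hφ : ContDiff ℝ ∞ φ) (hc : HasCompactSupport φ) (i : Fin d) :
    MemLp (fun x => fderiv ℝ φ x (coordVec i)) 2 (volume.restrict Ω) :=
  memLp_of_test (contDiff_pd hφ).continuous (hc.pd (i := i))

theorem integrable_mul_of_memLp {α : Type*} [MeasurableSpace α] {μ : Measure α} {u τ : α → ℝ}
    (hu : MemLp u 2 μ) (hτ : MemLp τ 2 μ) : Integrable (fun x => u x * τ x) μ :=
  hu.integrable_mul hτ

theorem HasL2Deriv.memLp (h : HasL2Deriv Ω i u) : MemLp (weakDeriv Ω i u) 2 (volume.restrict Ω) := by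
  rw [weakDeriv, dif_pos h]
  exact h.choose_spec.1

theorem HasL2Deriv.isWeakDeriv (h : HasL2Deriv Ω i u) : IsWeakDeriv Ω i u (weakDeriv Ω i u) := by
  rw [weakDeriv, dif_pos h]
  exact h.choose_spec.2

theorem IsWeakDeriv.congr (h : IsWeakDeriv Ω i u w) (hu : u =ᵐ[volume.restrict Ω] v)
    (hw : w =ᵐ[volume.restrict Ω] w') : IsWeakDeriv Ω i v w' := by
  intro φ hφ hc hs
  have h1 : ∫ x in Ω, v x * fderiv ℝ φ x (coordVec i) = ∫ x in Ω, u x * fderiv ℝ φ x (coordVec i) :=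
    integral_congr_ae (by filter_upwards [hu] with x hx; rw [hx])
  have h2 : ∫ x in Ω, w' x * φ x = ∫ x in Ω, w x * φ x :=
    integral_congr_ae (by filter_upwards [hw] with x hx; rw [hx])
  rw [h1, h2]
  exact h φ hφ hc hs

theorem IsWeakDeriv.add (h : IsWeakDeriv Ω i u w) (h' : IsWeakDeriv Ω i v w')
    (hu : MemLp u 2 (volume.restrict Ω)) (hv : MemLp v 2 (volume.restrict Ω))
    (hw : MemLp w 2 (volume.restrict Ω)) (hw' : MemLp w' 2 (volume.restrict Ω)) :
    IsWeakDeriv Ω i (fun x => u x + v x) (fun x => w x + w' x) := by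
  intro φ hφ hc hs
  have t1 := memLp_of_test (Ω := Ω) hφ.continuous hc
  have t2 := memLp_test_pd (Ω := Ω) hφ hc i
  simp_rw [add_mul]
  rw [integral_add (integrable_mul_of_memLp hu t2) (integrable_mul_of_memLp hv t2),
    integral_add (integrable_mul_of_memLp hw t1) (integrable_mul_of_memLp hw' t1), h φ hφ hc hs, h' φ hφ hc hs]
  ring

theorem IsWeakDeriv.neg (h : IsWeakDeriv Ω i u w) :
    IsWeakDeriv Ω i (fun x => -u x) (fun x => -w x) := by
  intro φ hφ hc hs
  simp_rw [neg_mul, integral_neg]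
  rw [h φ hφ hc hs]

/-- The fundamental lemma of the calculus of variations, applied to `w - w'`. -/
theorem IsWeakDeriv.ae_unique (hΩ : IsOpen Ω) (h : IsWeakDeriv Ω i u w) (h' : IsWeakDeriv Ω i u w')
    (hw : MemLp w 2 (volume.restrict Ω)) (hw' : MemLp w' 2 (volume.restrict Ω)) :
    w =ᵐ[volume.restrict Ω] w' := by
  have hm := hΩ.measurableSet
  have hloc : LocallyIntegrableOn (fun x => w x - w' x) Ω := by
    intro x hx
    obtain ⟨K, hK, hKx, hKΩ⟩ := exists_compact_subset hΩ hx
    have hfin : IsFiniteMeasure (volume.restrict K) := ⟨by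
      rw [Measure.restrict_apply_univ]; exact hK.measure_lt_top⟩
    exact ⟨K, mem_nhdsWithin_of_mem_nhds (mem_interior_iff_mem_nhds.1 hKx),
      (((hw.sub hw').mono_measure (Measure.restrict_mono hKΩ le_rfl)).integrable (by norm_num))⟩
  have key := hΩ.ae_eq_zero_of_integral_contDiff_smul_eq_zero hloc (fun φ hφ hc hs => by
    have t1 := memLp_of_test (Ω := Ω) hφ.continuous hc
    have e1 : ∫ x, φ x • (w x - w' x) = ∫ x in Ω, (w x * φ x - w' x * φ x) := by
      rw [← integral_indicator hm]
      congr 1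
      funext x
      by_cases hx : x ∈ Ω
      · rw [indicator_of_mem hx, smul_eq_mul]; ring
      · rw [indicator_of_notMem hx, image_eq_zero_of_notMem_tsupport (fun h => hx (hs h)), zero_smul]
    rw [e1, integral_sub (integrable_mul_of_memLp hw t1) (integrable_mul_of_memLp hw' t1)]
    linarith [h φ hφ hc hs, h' φ hφ hc hs])
  filter_upwards [ae_restrict_of_ae key, ae_restrict_mem hm] with x hx hxΩ
  exact sub_eq_zero.1 (hx hxΩ)

/-- `weakDeriv` picks an arbitrary representative, so its algebraic rules hold only almost
everywhere; they are all obtained from this identification. -/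
theorem IsWeakDeriv.weakDeriv_ae_eq (hΩ : IsOpen Ω) (h : IsWeakDeriv Ω i u w)
    (hw : MemLp w 2 (volume.restrict Ω)) : weakDeriv Ω i u =ᵐ[volume.restrict Ω] w :=
  have h' : HasL2Deriv Ω i u := ⟨w, hw, h⟩
  h'.isWeakDeriv.ae_unique hΩ h h'.memLp hw

/-- `g` and `G` are the first and second weak derivatives of `v ∈ H²(Ω)`. -/
structure IsJet (Ω : Set (Sp d)) (v : Sp d → ℝ) (g : Fin d → Sp d → ℝ)
    (G : Fin d → Fin d → Sp d → ℝ) : Prop where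
  memLp : MemLp v 2 (volume.restrict Ω)
  memLp_fst : ∀ i, MemLp (g i) 2 (volume.restrict Ω)
  memLp_snd : ∀ i j, MemLp (G i j) 2 (volume.restrict Ω)
  weak_fst : ∀ i, IsWeakDeriv Ω i v (g i)
  weak_snd : ∀ i j, IsWeakDeriv Ω j (g i) (G i j)

theorem MemH2.isJet (h : MemH2 Ω u) : IsJet Ω u (fun i => weakDeriv Ω i u)
    (fun i j => weakDeriv Ω j (weakDeriv Ω i u)) where
  memLp := h.1.1
  memLp_fst i := (h.1.2 i).memLp
  memLp_snd i j := ((h.2 i).2 j).memLp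
  weak_fst i := (h.1.2 i).isWeakDeriv
  weak_snd i j := ((h.2 i).2 j).isWeakDeriv

section jet

variable {g g' : Fin d → Sp d → ℝ} {G G' : Fin d → Fin d → Sp d → ℝ}

theorem IsJet.weakDeriv_ae_eq (hΩ : IsOpen Ω) (h : IsJet Ω v g G) (i : Fin d) :
    weakDeriv Ω i v =ᵐ[volume.restrict Ω] g i :=
  (h.weak_fst i).weakDeriv_ae_eq hΩ (h.memLp_fst i)

theorem IsJet.isWeakDeriv_weakDeriv (hΩ : IsOpen Ω) (h : IsJet Ω v g G) (i j : Fin d) :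
    IsWeakDeriv Ω j (weakDeriv Ω i v) (G i j) :=
  (h.weak_snd i j).congr (h.weakDeriv_ae_eq hΩ i).symm (ae_eq_refl _)

theorem IsJet.memH2 (hΩ : IsOpen Ω) (h : IsJet Ω v g G) : MemH2 Ω v :=
  ⟨⟨h.memLp, fun i => ⟨g i, h.memLp_fst i, h.weak_fst i⟩⟩, fun i =>
    ⟨(memLp_congr_ae (h.weakDeriv_ae_eq hΩ i)).2 (h.memLp_fst i), fun j =>
      ⟨G i j, h.memLp_snd i j, h.isWeakDeriv_weakDeriv hΩ i j⟩⟩⟩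

theorem IsJet.lap_ae_eq (hΩ : IsOpen Ω) (h : IsJet Ω v g G) :
    lap Ω v =ᵐ[volume.restrict Ω] fun x => ∑ i, G i i x := by
  have : ∀ i, weakDeriv Ω i (weakDeriv Ω i v) =ᵐ[volume.restrict Ω] G i i := fun i =>
    (h.isWeakDeriv_weakDeriv hΩ i i).weakDeriv_ae_eq hΩ (h.memLp_snd i i)
  filter_upwards [eventually_all.2 this] with x hx
  exact Finset.sum_congr rfl fun i _ => hx i

theorem IsJet.add (h : IsJet Ω u g G) (h' : IsJet Ω v g' G') :
    IsJet Ω (fun x => u x + v x) (fun i x => g i x + g' i x) (fun i j x => G i j x + G' i j x) where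
  memLp := h.memLp.add h'.memLp
  memLp_fst i := (h.memLp_fst i).add (h'.memLp_fst i)
  memLp_snd i j := (h.memLp_snd i j).add (h'.memLp_snd i j)
  weak_fst i := (h.weak_fst i).add (h'.weak_fst i) h.memLp h'.memLp (h.memLp_fst i) (h'.memLp_fst i)
  weak_snd i j := (h.weak_snd i j).add (h'.weak_snd i j) (h.memLp_fst i) (h'.memLp_fst i)
    (h.memLp_snd i j) (h'.memLp_snd i j)

theorem IsJet.neg (h : IsJet Ω u g G) :
    IsJet Ω (fun x => -u x) (fun i x => -g i x) (fun i j x => -G i j x) where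
  memLp := h.memLp.neg
  memLp_fst i := (h.memLp_fst i).neg
  memLp_snd i j := (h.memLp_snd i j).neg
  weak_fst i := (h.weak_fst i).neg
  weak_snd i j := (h.weak_snd i j).neg

theorem IsJet.congr (h : IsJet Ω u g G) (hu : u =ᵐ[volume.restrict Ω] v)
    (hg : ∀ i, g i =ᵐ[volume.restrict Ω] g' i)
    (hG : ∀ i j, G i j =ᵐ[volume.restrict Ω] G' i j) : IsJet Ω v g' G' where
  memLp := (memLp_congr_ae hu).1 h.memLp
  memLp_fst i := (memLp_congr_ae (hg i)).1 (h.memLp_fst i)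
  memLp_snd i j := (memLp_congr_ae (hG i j)).1 (h.memLp_snd i j)
  weak_fst i := (h.weak_fst i).congr hu (hg i)
  weak_snd i j := (h.weak_snd i j).congr (hg i) (hG i j)

/-! ### Cauchy data through Green's formulas -/

/-- The left side of the Gauss-Green formula for the trace. -/
def traceForm (Ω : Set (Sp d)) (v : Sp d → ℝ) (g : Fin d → Sp d → ℝ) (X : Sp d → Sp d) : ℝ :=
  ∫ x in Ω, (v x * ∑ i, (fderiv ℝ X x (coordVec i)) i + ∑ i, g i x * X x i)

/-- The left side of Green's formula for the normal derivative. -/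
def normalForm (Ω : Set (Sp d)) (f : Sp d → ℝ) (g : Fin d → Sp d → ℝ) (φ : Sp d → ℝ) : ℝ :=
  ∫ x in Ω, (f x * φ x + ∑ i, g i x * fderiv ℝ φ x (coordVec i))

theorem memLp_div {X : Sp d → Sp d} (hX : ContDiff ℝ ∞ X) (hc : HasCompactSupport X) :
    MemLp (fun x => ∑ i, (fderiv ℝ X x (coordVec i)) i) 2 (volume.restrict Ω) := by
  refine memLp_finsetSum _ fun i _ => memLp_of_test ?_ ?_
  · exact (contDiff_coord i).continuous.comp
      ((hX.continuous_fderiv (by simp)).clm_apply continuous_const)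
  · exact (hc.fderiv_apply ℝ (coordVec i)).comp_left (g := fun y : Sp d => y i) rfl

theorem memLp_component {X : Sp d → Sp d} (hX : ContDiff ℝ ∞ X) (hc : HasCompactSupport X)
    (i : Fin d) : MemLp (fun x => X x i) 2 (volume.restrict Ω) :=
  memLp_of_test ((contDiff_coord i).continuous.comp hX.continuous)
    (hc.comp_left (g := fun y : Sp d => y i) rfl)

theorem traceForm_eq (hv : MemLp v 2 (volume.restrict Ω))
    (hg : ∀ i, MemLp (g i) 2 (volume.restrict Ω)) {X : Sp d → Sp d} (hX : ContDiff ℝ ∞ X)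
    (hc : HasCompactSupport X) :
    traceForm Ω v g X = (∫ x in Ω, v x * ∑ i, (fderiv ℝ X x (coordVec i)) i)
      + ∑ i, ∫ x in Ω, g i x * X x i := by
  have h := fun i => integrable_mul_of_memLp (hg i) (memLp_component hX hc i)
  rw [traceForm, integral_add (integrable_mul_of_memLp hv (memLp_div hX hc))
    (integrable_finsetSum _ fun i _ => h i), integral_finsetSum _ fun i _ => h i]

theorem normalForm_eq (hf : MemLp f 2 (volume.restrict Ω))
    (hg : ∀ i, MemLp (g i) 2 (volume.restrict Ω)) {φ : Sp d → ℝ} (hφ : ContDiff ℝ ∞ φ)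
    (hc : HasCompactSupport φ) :
    normalForm Ω f g φ = (∫ x in Ω, f x * φ x)
      + ∑ i, ∫ x in Ω, g i x * fderiv ℝ φ x (coordVec i) := by
  have h := fun i => integrable_mul_of_memLp (hg i) (memLp_test_pd hφ hc i)
  rw [normalForm, integral_add (integrable_mul_of_memLp hf (memLp_of_test hφ.continuous hc))
    (integrable_finsetSum _ fun i _ => h i), integral_finsetSum _ fun i _ => h i]

theorem integral_mul_add {u v τ : Sp d → ℝ} (hu : MemLp u 2 (volume.restrict Ω))
    (hv : MemLp v 2 (volume.restrict Ω)) (hτ : MemLp τ 2 (volume.restrict Ω)) :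
    ∫ x in Ω, (u x + v x) * τ x = (∫ x in Ω, u x * τ x) + ∫ x in Ω, v x * τ x := by
  simp_rw [add_mul]
  exact integral_add (integrable_mul_of_memLp hu hτ) (integrable_mul_of_memLp hv hτ)

theorem traceForm_add (hu : MemLp u 2 (volume.restrict Ω)) (hv : MemLp v 2 (volume.restrict Ω))
    (hg : ∀ i, MemLp (g i) 2 (volume.restrict Ω)) (hg' : ∀ i, MemLp (g' i) 2 (volume.restrict Ω))
    {X : Sp d → Sp d} (hX : ContDiff ℝ ∞ X) (hc : HasCompactSupport X) :
    traceForm Ω (fun x => u x + v x) (fun i x => g i x + g' i x) X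
      = traceForm Ω u g X + traceForm Ω v g' X := by
  rw [traceForm_eq hu hg hX hc, traceForm_eq hv hg' hX hc,
    traceForm_eq (v := fun x => u x + v x) (g := fun i x => g i x + g' i x) (hu.add hv)
      (fun i => (hg i).add (hg' i)) hX hc]
  simp_rw [integral_mul_add hu hv (memLp_div hX hc),
    fun i => integral_mul_add (hg i) (hg' i) (memLp_component hX hc i), Finset.sum_add_distrib]
  ring

theorem normalForm_add {f' : Sp d → ℝ} (hf : MemLp f 2 (volume.restrict Ω))
    (hf' : MemLp f' 2 (volume.restrict Ω))
    (hg : ∀ i, MemLp (g i) 2 (volume.restrict Ω)) (hg' : ∀ i, MemLp (g' i) 2 (volume.restrict Ω))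
    {φ : Sp d → ℝ} (hφ : ContDiff ℝ ∞ φ) (hc : HasCompactSupport φ) :
    normalForm Ω (fun x => f x + f' x) (fun i x => g i x + g' i x) φ
      = normalForm Ω f g φ + normalForm Ω f' g' φ := by
  rw [normalForm_eq hf hg hφ hc, normalForm_eq hf' hg' hφ hc,
    normalForm_eq (f := fun x => f x + f' x) (g := fun i x => g i x + g' i x) (hf.add hf')
      (fun i => (hg i).add (hg' i)) hφ hc]
  simp_rw [integral_mul_add hf hf' (memLp_of_test hφ.continuous hc),
    fun i => integral_mul_add (hg i) (hg' i) (memLp_test_pd hφ hc i), Finset.sum_add_distrib]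
  ring

theorem traceForm_neg (X : Sp d → Sp d) :
    traceForm Ω (fun x => -v x) (fun i x => -g i x) X = -traceForm Ω v g X := by
  simp only [traceForm, ← integral_neg, neg_add, neg_mul, Finset.sum_neg_distrib]

theorem normalForm_neg (φ : Sp d → ℝ) :
    normalForm Ω (fun x => -f x) (fun i x => -g i x) φ = -normalForm Ω f g φ := by
  simp only [normalForm, ← integral_neg, neg_add, neg_mul, Finset.sum_neg_distrib]

theorem traceForm_congr (hv : u =ᵐ[volume.restrict Ω] v)
    (hg : ∀ i, g i =ᵐ[volume.restrict Ω] g' i) (X : Sp d → Sp d) :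
    traceForm Ω u g X = traceForm Ω v g' X := by
  refine integral_congr_ae ?_
  filter_upwards [hv, eventually_all.2 hg] with x h1 h2
  simp only [h1, h2]

theorem normalForm_congr {f' : Sp d → ℝ} (hf : f =ᵐ[volume.restrict Ω] f')
    (hg : ∀ i, g i =ᵐ[volume.restrict Ω] g' i) (φ : Sp d → ℝ) :
    normalForm Ω f g φ = normalForm Ω f' g' φ := by
  refine integral_congr_ae ?_
  filter_upwards [hf, eventually_all.2 hg] with x h1 h2
  simp only [h1, h2]

/-- `(v, g, G)` is the jet of a function of `H²(Ω)` with zero Cauchy data. -/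
structure IsZeroJet (Ω : Set (Sp d)) (v : Sp d → ℝ) (g : Fin d → Sp d → ℝ)
    (G : Fin d → Fin d → Sp d → ℝ) : Prop extends IsJet Ω v g G where
  trace : ∀ X : Sp d → Sp d, ContDiff ℝ ∞ X → HasCompactSupport X → traceForm Ω v g X = 0
  normal : ∀ φ : Sp d → ℝ, ContDiff ℝ ∞ φ → HasCompactSupport φ →
    normalForm Ω (fun x => ∑ i, G i i x) g φ = 0

theorem IsJet.memLp_lap (h : IsJet Ω v g G) :
    MemLp (fun x => ∑ i, G i i x) 2 (volume.restrict Ω) :=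
  memLp_finsetSum _ fun i _ => h.memLp_snd i i

/-- The trace condition with `X = ∇φ` reads `∫ (v Δφ + ∇v · ∇φ) = 0`, the normal condition reads `∫
(Δv φ + ∇v · ∇φ) = 0`; subtract. This is how zero Cauchy data enter the Carleman estimate. -/
theorem IsZeroJet.isExtLaplacian (h : IsZeroJet Ω v g G) :
    IsExtLaplacian Ω v (fun x => ∑ i, G i i x) := by
  intro φ hφ hc
  set X : Sp d → Sp d := fun x => WithLp.toLp 2 (fun i => pd i φ x) with hXdef
  have hX : ContDiff ℝ ∞ X := contDiff_euclidean.2 fun i => contDiff_pd' hφ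
  have hXc : HasCompactSupport X := HasCompactSupport.intro hc fun x hx => by
    ext i
    exact pd_eq_zero_of_notMem_tsupport hx
  have e : ∀ x i, (fderiv ℝ X x (coordVec i)) i = pd i (pd i φ) x := by
    intro x i
    have h1 := ((EuclideanSpace.proj i : Sp d →L[ℝ] ℝ).hasFDerivAt).comp x
      (hX.differentiable (by simp) x).hasFDerivAt
    have h2 : fderiv ℝ (pd i φ) x = _ := h1.fderiv
    rw [pd, h2]
    rfl
  have h1 := h.trace X hX hXc
  have h2 := h.normal φ hφ hc
  rw [traceForm_eq h.memLp h.memLp_fst hX hXc] at h1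
  rw [normalForm_eq h.memLp_lap h.memLp_fst hφ hc] at h2
  simp_rw [e] at h1
  have e2 : ∀ i, ∫ x in Ω, g i x * X x i = ∫ x in Ω, g i x * fderiv ℝ φ x (coordVec i) :=
    fun i => rfl
  simp_rw [e2] at h1
  linarith

/-- The difference of two functions with the same Cauchy data has zero Cauchy data. -/
theorem isZeroJet_sub {a b : Sp d → ℝ} (hu : MemH2 Ω u) (hua : HasTrace Ω u a)
    (hub : HasNormalDeriv Ω u b) (hv : MemH2 Ω v) (hva : HasTrace Ω v a)
    (hvb : HasNormalDeriv Ω v b) :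
    IsZeroJet Ω (fun x => u x + -v x) (fun i x => weakDeriv Ω i u x + -weakDeriv Ω i v x)
      (fun i j x => weakDeriv Ω j (weakDeriv Ω i u) x + -weakDeriv Ω j (weakDeriv Ω i v) x) where
  toIsJet := hu.isJet.add hv.isJet.neg
  trace X hX hc := by
    have h1 : traceForm Ω u _ X = _ := hua X hX hc
    have h2 : traceForm Ω v _ X = _ := hva X hX hc
    rw [traceForm_add hu.isJet.memLp hv.isJet.neg.memLp hu.isJet.memLp_fst
      hv.isJet.neg.memLp_fst hX hc, traceForm_neg, h1, h2]
    ring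
  normal φ hφ hc := by
    have h1 : normalForm Ω (lap Ω u) (fun i => weakDeriv Ω i u) φ = _ := hub φ hφ hc
    have h2 : normalForm Ω (lap Ω v) (fun i => weakDeriv Ω i v) φ = _ := hvb φ hφ hc
    simp_rw [Finset.sum_add_distrib, Finset.sum_neg_distrib]
    have h3 := normalForm_add (f := lap Ω u) (f' := fun x => -lap Ω v x)
      hu.isJet.memLp_lap hv.isJet.memLp_lap.neg hu.isJet.memLp_fst
      hv.isJet.neg.memLp_fst hφ hc
    rw [normalForm_neg, h1, h2, add_neg_cancel] at h3
    exact h3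

/-- Adding a function with zero Cauchy data does not change the Cauchy data. -/
theorem IsZeroJet.add_cauchyData (hΩ : IsOpen Ω) {a b : Sp d → ℝ} (hu : MemH2 Ω u)
    (hua : HasTrace Ω u a) (hub : HasNormalDeriv Ω u b) (h : IsZeroJet Ω v g G) :
    MemH2 Ω (fun x => u x + v x) ∧ HasTrace Ω (fun x => u x + v x) a ∧
      HasNormalDeriv Ω (fun x => u x + v x) b ∧
      lap Ω (fun x => u x + v x) =ᵐ[volume.restrict Ω] fun x => lap Ω u x + ∑ i, G i i x := by
  have hj := hu.isJet.add h.toIsJet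
  have hl : lap Ω (fun x => u x + v x) =ᵐ[volume.restrict Ω] fun x => lap Ω u x + ∑ i, G i i x := by
    filter_upwards [hj.lap_ae_eq hΩ] with x hx
    rw [hx, Finset.sum_add_distrib]
    rfl
  refine ⟨hj.memH2 hΩ, fun X hX hc => ?_, fun φ hφ hc => ?_, hl⟩
  · have h1 : traceForm Ω u _ X = _ := hua X hX hc
    change traceForm Ω _ (fun i => weakDeriv Ω i fun x => u x + v x) X = _
    rw [traceForm_congr (ae_eq_refl _) (fun i => hj.weakDeriv_ae_eq hΩ i),
      traceForm_add hu.isJet.memLp h.memLp hu.isJet.memLp_fst h.memLp_fst hX hc, h1,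
      h.trace X hX hc, add_zero]
  · have h1 : normalForm Ω (lap Ω u) (fun i => weakDeriv Ω i u) φ = _ := hub φ hφ hc
    change normalForm Ω (lap Ω fun x => u x + v x) (fun i => weakDeriv Ω i fun x => u x + v x) φ = _
    rw [normalForm_congr hl (fun i => hj.weakDeriv_ae_eq hΩ i),
      normalForm_add (f := lap Ω u) hu.isJet.memLp_lap h.memLp_lap hu.isJet.memLp_fst h.memLp_fst
      hφ hc, h1, h.normal φ hφ hc, add_zero]

end jet

end weak

/-! ### The Hilbert space of jets with zero Cauchy data -/

section jetSpace

variable {d : ℕ}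

/-- `L²(Ω)`. -/
abbrev L2 (Ω : Set (Sp d)) : Type := Lp ℝ 2 (volume.restrict Ω)

/-- Candidates `(v, (∂_i v), (∂_j ∂_i v))` for jets. -/
abbrev JetSpace (Ω : Set (Sp d)) : Type := L2 Ω × (Fin d → L2 Ω) × (Fin d → Fin d → L2 Ω)

open Classical in
/-- The functional `u ↦ ∫_Ω u τ` on `L²(Ω)`. -/
def pairing (Ω : Set (Sp d)) (τ : Sp d → ℝ) : L2 Ω →L[ℝ] ℝ :=
  if h : MemLp τ 2 (volume.restrict Ω) then innerSL ℝ (h.toLp τ) else 0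

variable {Ω : Set (Sp d)}

theorem pairing_apply {τ : Sp d → ℝ} (h : MemLp τ 2 (volume.restrict Ω)) (u : L2 Ω) :
    pairing Ω τ u = ∫ x in Ω, u x * τ x := by
  rw [pairing, dif_pos h, innerSL_apply_apply, L2.inner_def]
  refine integral_congr_ae ?_
  filter_upwards [h.coeFn_toLp] with x hx
  rw [hx]
  rfl

/-- The functionals on jets which vanish on jets of functions with zero Cauchy data. -/
inductive IsJetConstraint (Ω : Set (Sp d)) : (JetSpace Ω →L[ℝ] ℝ) → Prop
  | fst (i : Fin d) (φ : Sp d → ℝ) (hφ : ContDiff ℝ ∞ φ) (hc : HasCompactSupport φ)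
    (hs : tsupport φ ⊆ Ω) : IsJetConstraint Ω
      (pairing Ω (fun x => fderiv ℝ φ x (coordVec i)) ∘L ContinuousLinearMap.fst ℝ _ _
        + pairing Ω φ ∘L ContinuousLinearMap.proj i ∘L ContinuousLinearMap.fst ℝ _ _
          ∘L ContinuousLinearMap.snd ℝ _ _)
  | snd (i j : Fin d) (φ : Sp d → ℝ) (hφ : ContDiff ℝ ∞ φ) (hc : HasCompactSupport φ)
    (hs : tsupport φ ⊆ Ω) : IsJetConstraint Ω
      (pairing Ω (fun x => fderiv ℝ φ x (coordVec j)) ∘L ContinuousLinearMap.proj i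
          ∘L ContinuousLinearMap.fst ℝ _ _ ∘L ContinuousLinearMap.snd ℝ _ _
        + pairing Ω φ ∘L ContinuousLinearMap.proj j ∘L ContinuousLinearMap.proj i
          ∘L ContinuousLinearMap.snd ℝ _ _ ∘L ContinuousLinearMap.snd ℝ _ _)
  | trace (X : Sp d → Sp d) (hX : ContDiff ℝ ∞ X) (hc : HasCompactSupport X) : IsJetConstraint Ω
      (pairing Ω (fun x => ∑ i, (fderiv ℝ X x (coordVec i)) i) ∘L ContinuousLinearMap.fst ℝ _ _
        + ∑ i, pairing Ω (fun x => X x i) ∘L ContinuousLinearMap.proj i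
          ∘L ContinuousLinearMap.fst ℝ _ _ ∘L ContinuousLinearMap.snd ℝ _ _)
  | normal (φ : Sp d → ℝ) (hφ : ContDiff ℝ ∞ φ) (hc : HasCompactSupport φ) : IsJetConstraint Ω
      (∑ i, pairing Ω φ ∘L ContinuousLinearMap.proj i ∘L ContinuousLinearMap.proj i
          ∘L ContinuousLinearMap.snd ℝ _ _ ∘L ContinuousLinearMap.snd ℝ _ _
        + ∑ i, pairing Ω (fun x => fderiv ℝ φ x (coordVec i)) ∘L ContinuousLinearMap.proj i
          ∘L ContinuousLinearMap.fst ℝ _ _ ∘L ContinuousLinearMap.snd ℝ _ _)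

/-- The space of jets of functions of `H²(Ω)` with zero Cauchy data. -/
def zeroJets (Ω : Set (Sp d)) : Submodule ℝ (JetSpace Ω) :=
  ⨅ L : {L : JetSpace Ω →L[ℝ] ℝ // IsJetConstraint Ω L}, L.1.ker

/-- Every condition on a zero jet is the vanishing of a continuous functional. Closedness makes the
space complete, which the existence of minimizers rests on. -/
theorem isClosed_zeroJets : IsClosed (zeroJets Ω : Set (JetSpace Ω)) := by
  rw [zeroJets, Submodule.coe_iInf]
  exact isClosed_iInter fun L => L.1.isClosed_ker

theorem mem_zeroJets_iff {p : JetSpace Ω} :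
    p ∈ zeroJets Ω ↔ IsZeroJet Ω p.1 (fun i => p.2.1 i) (fun i j => p.2.2 i j) := by
  have hG : ∀ (i : Fin d) {φ : Sp d → ℝ} (h : MemLp φ 2 (volume.restrict Ω)),
      Integrable (fun x => p.2.2 i i x * φ x) (volume.restrict Ω) :=
    fun i φ h => integrable_mul_of_memLp (Lp.memLp _) h
  have hnormal : ∀ φ : Sp d → ℝ, ContDiff ℝ ∞ φ → HasCompactSupport φ →
      normalForm Ω (fun x => ∑ i, p.2.2 i i x) (fun i => p.2.1 i) φ
      = (∑ i, ∫ x in Ω, p.2.2 i i x * φ x)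
        + ∑ i, ∫ x in Ω, p.2.1 i x * fderiv ℝ φ x (coordVec i) := by
    intro φ hφ hc
    have hm := memLp_of_test (Ω := Ω) hφ.continuous hc
    rw [normalForm_eq (memLp_finsetSum _ fun i _ => Lp.memLp _) (fun i => Lp.memLp _) hφ hc,
      ← integral_finsetSum _ fun i _ => hG i hm]
    simp_rw [Finset.sum_mul]
  simp only [zeroJets, Submodule.mem_iInf, Subtype.forall, LinearMap.mem_ker]
  constructor
  · intro h
    refine ⟨⟨Lp.memLp _, fun i => Lp.memLp _, fun i j => Lp.memLp _, fun i φ hφ hc hs => ?_,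
      fun i j φ hφ hc hs => ?_⟩, fun X hX hc => ?_, fun φ hφ hc => ?_⟩
    · have := h _ (.fst i φ hφ hc hs)
      simp [pairing_apply (memLp_test_pd hφ hc i), pairing_apply (memLp_of_test hφ.continuous hc)] at this
      linarith
    · have := h _ (.snd i j φ hφ hc hs)
      simp [pairing_apply (memLp_test_pd hφ hc j), pairing_apply (memLp_of_test hφ.continuous hc)] at this
      linarith
    · have := h _ (.trace X hX hc)
      simp [pairing_apply (memLp_div hX hc), pairing_apply (memLp_component hX hc _)] at this
      rw [traceForm_eq (Lp.memLp _) (fun i => Lp.memLp _) hX hc]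
      exact this
    · have := h _ (.normal φ hφ hc)
      simp [pairing_apply (memLp_test_pd hφ hc _), pairing_apply (memLp_of_test hφ.continuous hc)] at this
      rw [hnormal φ hφ hc]
      exact this
  · intro h L hL
    cases hL with
    | fst i φ hφ hc hs =>
      have := h.weak_fst i φ hφ hc hs
      simp [pairing_apply (memLp_test_pd hφ hc i), pairing_apply (memLp_of_test hφ.continuous hc)]
      linarith
    | snd i j φ hφ hc hs =>
      have := h.weak_snd i j φ hφ hc hs
      simp [pairing_apply (memLp_test_pd hφ hc j), pairing_apply (memLp_of_test hφ.continuous hc)]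
      linarith
    | trace X hX hc =>
      have := h.trace X hX hc
      rw [traceForm_eq (Lp.memLp _) (fun i => Lp.memLp _) hX hc] at this
      simp [pairing_apply (memLp_div hX hc), pairing_apply (memLp_component hX hc _)]
      exact this
    | normal φ hφ hc =>
      have := h.normal φ hφ hc
      rw [hnormal φ hφ hc] at this
      simp [pairing_apply (memLp_test_pd hφ hc _), pairing_apply (memLp_of_test hφ.continuous hc)]
      exact this

end jetSpace

/-! ### Stability of the coupled system and existence of minimizers -/

section minimizers

variable {d N : ℕ} {Ω : Set (Sp d)} {w c : Sp d → ℝ}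

theorem memLp_top_of_continuous (hΩ : MeasurableSet Ω) (hΩb : Bornology.IsBounded Ω) {a : Sp d → ℝ}
    (ha : Continuous a) : MemLp a ∞ (volume.restrict Ω) := by
  obtain ⟨K, hK⟩ := (Metric.isCompact_of_isClosed_isBounded isClosed_closure
    hΩb.closure).exists_bound_of_continuousOn ha.continuousOn
  exact memLp_top_of_bound ha.aestronglyMeasurable K
    (ae_restrict_of_forall_mem hΩ fun y hy => hK y (subset_closure hy))

theorem memLp_mul_of_continuous (hΩ : MeasurableSet Ω) (hΩb : Bornology.IsBounded Ω)
    {a u : Sp d → ℝ} (ha : Continuous a) (hu : MemLp u 2 (volume.restrict Ω)) :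
    MemLp (fun x => a x * u x) 2 (volume.restrict Ω) :=
  hu.mul (memLp_top_of_continuous hΩ hΩb ha)

/-- The elliptic system is stable in weighted norms as soon as its scalar principal part is, with
a sufficiently large constant. -/
theorem system_stability (hΩ : MeasurableSet Ω) (hΩb : Bornology.IsBounded Ω) (hw : Continuous w)
    (hc : Continuous c) {c₁ : ℝ} (hc₁ : ∀ x ∈ Ω, |c x| ≤ c₁) (s : Fin N → Fin N → ℝ) {A : ℝ}
    (hA : 4 * c₁ ^ 2 * ∑ m, ∑ n, s m n ^ 2 ≤ A) {v f : Fin N → Sp d → ℝ}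
    (hv : ∀ m, MemLp (v m) 2 (volume.restrict Ω)) (hf : ∀ m, MemLp (f m) 2 (volume.restrict Ω))
    (hcarl : ∀ m, A * ∫ x in Ω, (w x * v m x) ^ 2 ≤ ∫ x in Ω, (w x * f m x) ^ 2) :
    A * ∑ m, ∫ x in Ω, (w x * v m x) ^ 2
        ≤ 4 * ∑ m, ∫ x in Ω, (w x * (f m x - c x * ∑ n, s m n * v n x)) ^ 2 ∧
      ∑ m, ∫ x in Ω, (w x * f m x) ^ 2
        ≤ 4 * ∑ m, ∫ x in Ω, (w x * (f m x - c x * ∑ n, s m n * v n x)) ^ 2 := by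
  set L : Fin N → Sp d → ℝ := fun m x => f m x - c x * ∑ n, s m n * v n x with hL
  have hLm : ∀ m, MemLp (L m) 2 (volume.restrict Ω) := fun m =>
    (hf m).sub (memLp_mul_of_continuous hΩ hΩb hc
      (memLp_finsetSum _ fun n _ => (hv n).const_mul (s m n)))
  have iv := fun m => (memLp_mul_of_continuous hΩ hΩb hw (hv m)).integrable_sq
  have jf := fun m => (memLp_mul_of_continuous hΩ hΩb hw (hf m)).integrable_sq
  have iL := fun m => (memLp_mul_of_continuous hΩ hΩb hw (hLm m)).integrable_sq
  have h1 : A * ∑ m, ∫ x in Ω, (w x * v m x) ^ 2 ≤ ∑ m, ∫ x in Ω, (w x * f m x) ^ 2 := by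
    rw [Finset.mul_sum]
    exact Finset.sum_le_sum fun m _ => hcarl m
  have h2 : ∑ m, ∫ x in Ω, (w x * f m x) ^ 2 ≤ 2 * (∑ m, ∫ x in Ω, (w x * L m x) ^ 2)
      + 2 * (c₁ ^ 2 * ∑ m, ∑ n, s m n ^ 2) * ∑ m, ∫ x in Ω, (w x * v m x) ^ 2 := by
    rw [← integral_finsetSum _ fun m _ => jf m, ← integral_finsetSum _ fun m _ => iL m,
      ← integral_finsetSum _ fun m _ => iv m, ← integral_const_mul, ← integral_const_mul,
      ← integral_add ((integrable_finsetSum _ fun m _ => iL m).const_mul _)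
        ((integrable_finsetSum _ fun m _ => iv m).const_mul _)]
    refine setIntegral_mono_on (integrable_finsetSum _ fun m _ => jf m)
      (((integrable_finsetSum _ fun m _ => iL m).const_mul _).add
        ((integrable_finsetSum _ fun m _ => iv m).const_mul _)) hΩ fun x hx => ?_
    have e : 2 * (∑ m, (w x * L m x) ^ 2)
        + 2 * (c₁ ^ 2 * ∑ m, ∑ n, s m n ^ 2) * ∑ m, (w x * v m x) ^ 2
        = ∑ m, (2 * (w x * L m x) ^ 2
          + 2 * (c₁ ^ 2 * ∑ n, s m n ^ 2) * ∑ n, (w x * v n x) ^ 2) := by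
      simp only [Finset.sum_add_distrib, ← Finset.mul_sum, ← Finset.sum_mul]
    rw [e]
    refine Finset.sum_le_sum fun m _ => ?_
    -- Cauchy-Schwarz over `n` bounds the coupling by the weighted squares of all components.
    have hcs := Finset.sum_mul_sq_le_sq_mul_sq Finset.univ (fun n => s m n) (fun n => w x * v n x)
    have hσ : ∑ n, s m n * (w x * v n x) = w x * ∑ n, s m n * v n x := by
      rw [Finset.mul_sum]
      exact Finset.sum_congr rfl fun n _ => by ring
    rw [hσ] at hcs
    have hc2 : c x ^ 2 ≤ c₁ ^ 2 := sq_le_sq' (by linarith [neg_abs_le (c x), hc₁ x hx])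
      ((le_abs_self _).trans (hc₁ x hx))
    have h3 : c x ^ 2 * (w x * ∑ n, s m n * v n x) ^ 2
        ≤ c₁ ^ 2 * ((∑ n, s m n ^ 2) * ∑ n, (w x * v n x) ^ 2) :=
      mul_le_mul hc2 hcs (sq_nonneg _) (sq_nonneg _)
    have h4 : w x * f m x = w x * L m x + c x * (w x * ∑ n, s m n * v n x) := by
      simp only [hL]
      ring
    rw [h4]
    nlinarith [sq_nonneg (w x * L m x - c x * (w x * ∑ n, s m n * v n x))]
  have hV : 0 ≤ ∑ m, ∫ x in Ω, (w x * v m x) ^ 2 :=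
    Finset.sum_nonneg fun m _ => integral_nonneg fun x => sq_nonneg _
  -- With `V`, `F`, `L` the weighted sums for `v`, `f` and the full operator, `AV ≤ F ≤ 2L + AV/2`.
  -- Absorbing `AV/2` gives both `AV ≤ 4L` and `F ≤ 4L`.
  have h3 := mul_le_mul_of_nonneg_right hA hV
  constructor <;> nlinarith

open Classical in
/-- Multiplication by a bounded function on `L²(Ω)`. -/
def mulOp (Ω : Set (Sp d)) (a : Sp d → ℝ) : L2 Ω →L[ℝ] L2 Ω :=
  if h : MemLp a ∞ (volume.restrict Ω) then
    (ContinuousLinearMap.mul ℝ ℝ).holderL (volume.restrict Ω) ∞ 2 2 (h.toLp a)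
  else 0

theorem mulOp_ae_eq {a : Sp d → ℝ} (ha : MemLp a ∞ (volume.restrict Ω)) (u : L2 Ω) :
    mulOp Ω a u =ᵐ[volume.restrict Ω] fun x => a x * u x := by
  rw [mulOp, dif_pos ha]
  filter_upwards [(ContinuousLinearMap.mul ℝ ℝ).coeFn_holder (r := 2) (ha.toLp a) u, ha.coeFn_toLp]
    with x h1 h2
  rw [ContinuousLinearMap.holderL_apply_apply, h1, h2]
  rfl

/-- The Laplacian of a jet. -/
def jetLap (Ω : Set (Sp d)) : zeroJets Ω →L[ℝ] L2 Ω :=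
  (∑ i, ContinuousLinearMap.proj i ∘L ContinuousLinearMap.proj i ∘L ContinuousLinearMap.snd ℝ _ _
    ∘L ContinuousLinearMap.snd ℝ _ _) ∘L (zeroJets Ω).subtypeL

/-- The function underlying a jet. -/
def jetVal (Ω : Set (Sp d)) : zeroJets Ω →L[ℝ] L2 Ω :=
  ContinuousLinearMap.fst ℝ _ _ ∘L (zeroJets Ω).subtypeL

theorem coeFn_finsetSum {ι α : Type*} [MeasurableSpace α] {μ : Measure α} (s : Finset ι)
    (F : ι → Lp ℝ 2 μ) : (↑(∑ i ∈ s, F i) : α → ℝ) =ᵐ[μ] fun x => ∑ i ∈ s, F i x := by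
  classical
  induction s using Finset.induction_on with
  | empty => simpa using! Lp.coeFn_zero ℝ 2 μ
  | insert a s ha ih =>
    rw [Finset.sum_insert ha]
    filter_upwards [ih, Lp.coeFn_add (F a) (∑ i ∈ s, F i)] with x h1 h2
    rw [h2, Finset.sum_insert ha, Pi.add_apply, h1]

theorem jetLap_ae_eq (p : zeroJets Ω) :
    jetLap Ω p =ᵐ[volume.restrict Ω] fun x => ∑ i, p.1.2.2 i i x := by
  have : jetLap Ω p = ∑ i, p.1.2.2 i i := by
    simp [jetLap]
  rw [this]
  exact coeFn_finsetSum _ _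

/-- The operator `(v_m) ↦ (w (Δ v_m - c ∑ s_{mn} v_n))` on functions with zero Cauchy data. -/
def systemOp (Ω : Set (Sp d)) (w c : Sp d → ℝ) (s : Fin N → Fin N → ℝ) :
    (Fin N → zeroJets Ω) →L[ℝ] PiLp 2 (fun _ : Fin N => L2 Ω) :=
  (PiLp.continuousLinearEquiv 2 ℝ (fun _ : Fin N => L2 Ω)).symm.toContinuousLinearMap ∘L
    ContinuousLinearMap.pi fun m => mulOp Ω w ∘L (jetLap Ω ∘L ContinuousLinearMap.proj m
      - mulOp Ω c ∘L ∑ n, s m n • (jetVal Ω ∘L ContinuousLinearMap.proj n))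

theorem systemOp_ae_eq (hw : MemLp w ∞ (volume.restrict Ω)) (hc : MemLp c ∞ (volume.restrict Ω))
    (s : Fin N → Fin N → ℝ) (p : Fin N → zeroJets Ω) (m : Fin N) :
    systemOp Ω w c s p m =ᵐ[volume.restrict Ω]
      fun x => w x * (∑ i, (p m).1.2.2 i i x - c x * ∑ n, s m n * (p n).1.1 x) := by
  have e : systemOp Ω w c s p m
      = mulOp Ω w (jetLap Ω (p m) - mulOp Ω c (∑ n, s m n • (p n).1.1)) := by
    simp [systemOp, jetVal]
  rw [e]
  have hsm : ∀ n, (↑(s m n • (p n).1.1) : Sp d → ℝ) =ᵐ[volume.restrict Ω]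
      fun x => s m n * (p n).1.1 x := fun n => Lp.coeFn_smul _ _
  filter_upwards [mulOp_ae_eq hw (jetLap Ω (p m) - mulOp Ω c (∑ n, s m n • (p n).1.1)),
    Lp.coeFn_sub (jetLap Ω (p m)) (mulOp Ω c (∑ n, s m n • (p n).1.1)),
    jetLap_ae_eq (p m), mulOp_ae_eq hc (∑ n, s m n • (p n).1.1),
    coeFn_finsetSum Finset.univ (fun n => s m n • (p n).1.1), eventually_all.2 hsm]
    with x h1 h2 h3 h4 h5 h6
  rw [h1, h2, Pi.sub_apply, h3, h4, h5]
  simp_rw [h6]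

theorem norm_sq_L2 {α : Type*} [MeasurableSpace α] {μ : Measure α} (u : Lp ℝ 2 μ) :
    ‖u‖ ^ 2 = ∫ x, u x ^ 2 ∂μ := by
  rw [← real_inner_self_eq_norm_sq, L2.inner_def]
  refine integral_congr_ae (ae_of_all _ fun x => ?_)
  simp [sq]

theorem norm_sq_L2_of_ae_eq {α : Type*} [MeasurableSpace α] {μ : Measure α} {u : Lp ℝ 2 μ}
    {F : α → ℝ} (h : u =ᵐ[μ] F) : ‖u‖ ^ 2 = ∫ x, F x ^ 2 ∂μ := by
  rw [norm_sq_L2]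
  exact integral_congr_ae (by filter_upwards [h] with x hx; rw [hx])

theorem norm_sq_piL2_of_ae_eq {y : PiLp 2 (fun _ : Fin N => L2 Ω)} {F : Fin N → Sp d → ℝ}
    (h : ∀ m, y m =ᵐ[volume.restrict Ω] F m) : ‖y‖ ^ 2 = ∑ m, ∫ x in Ω, F m x ^ 2 := by
  rw [PiLp.norm_sq_eq_of_L2]
  exact Finset.sum_congr rfl fun m _ => norm_sq_L2_of_ae_eq (h m)

/-- Coercivity in the full `H²` jet norm. Stability and `w ≥ 1` give `∫ v² ≤ (4/A) t²` and `∫ (Δv)²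
≤ 4 t²`, with `t` the norm of the image. The gradient costs twice the sum of both, which is the
constant `8/A + 8`; the second derivatives cost only `8 t²`. -/
theorem systemOp_bounded_below (hΩ : IsOpen Ω) (hΩb : Bornology.IsBounded Ω) (hw : Continuous w)
    (hw1 : ∀ x ∈ Ω, 1 ≤ w x) (hc : Continuous c) {c₁ : ℝ} (hc₁ : ∀ x ∈ Ω, |c x| ≤ c₁)
    (s : Fin N → Fin N → ℝ) {A : ℝ} (hA0 : 0 < A) (hA : 4 * c₁ ^ 2 * ∑ m, ∑ n, s m n ^ 2 ≤ A)
    (hcarl : ∀ v f : Sp d → ℝ, MemLp v 2 (volume.restrict Ω) → MemLp f 2 (volume.restrict Ω) →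
      IsExtLaplacian Ω v f → A * ∫ x in Ω, (w x * v x) ^ 2 ≤ ∫ x in Ω, (w x * f x) ^ 2)
    (p : Fin N → zeroJets Ω) :
    ‖p‖ ≤ Real.sqrt (8 / A + 8) * ‖systemOp Ω w c s p‖ := by
  have hm := hΩ.measurableSet
  have hj := fun m => mem_zeroJets_iff.1 (p m).2
  set v : Fin N → Sp d → ℝ := fun m => (p m).1.1
  set f : Fin N → Sp d → ℝ := fun m x => ∑ i, (p m).1.2.2 i i x
  have hv : ∀ m, MemLp (v m) 2 (volume.restrict Ω) := fun m => (hj m).memLp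
  have hf : ∀ m, MemLp (f m) 2 (volume.restrict Ω) := fun m => (hj m).memLp_lap
  have hst := system_stability hm hΩb hw hc hc₁ s hA hv hf
    (fun m => hcarl _ _ (hv m) (hf m) (hj m).isExtLaplacian)
  rw [← norm_sq_piL2_of_ae_eq (fun m => systemOp_ae_eq (memLp_top_of_continuous hm hΩb hw)
    (memLp_top_of_continuous hm hΩb hc) s p m)] at hst
  set t := ‖systemOp Ω w c s p‖
  have hone : ∀ {u : Sp d → ℝ}, MemLp u 2 (volume.restrict Ω) →
      ∫ x in Ω, u x ^ 2 ≤ ∫ x in Ω, (w x * u x) ^ 2 := fun {u} hu =>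
    setIntegral_mono_on hu.integrable_sq (memLp_mul_of_continuous hm hΩb hw hu).integrable_sq hm
      fun x hx => by
        rw [mul_pow]
        exact le_mul_of_one_le_left (sq_nonneg _) (one_le_pow₀ (hw1 x hx))
  have hv2 : ∀ m, ∫ x in Ω, v m x ^ 2 ≤ 4 / A * t ^ 2 := fun m => by
    have h1 := Finset.single_le_sum (f := fun m => ∫ x in Ω, (w x * v m x) ^ 2)
      (fun m _ => integral_nonneg fun x => sq_nonneg _) (Finset.mem_univ m)
    have h2 : ∑ m, ∫ x in Ω, (w x * v m x) ^ 2 ≤ 4 / A * t ^ 2 := by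
      rw [div_mul_eq_mul_div, le_div_iff₀ hA0, mul_comm]
      exact hst.1
    exact (hone (hv m)).trans (h1.trans h2)
  have hf2 : ∀ m, ∫ x in Ω, f m x ^ 2 ≤ 4 * t ^ 2 := fun m =>
    (hone (hf m)).trans ((Finset.single_le_sum (f := fun m => ∫ x in Ω, (w x * f m x) ^ 2)
      (fun m _ => integral_nonneg fun x => sq_nonneg _) (Finset.mem_univ m)).trans hst.2)
  have ht0 : 0 ≤ t := norm_nonneg _
  have hAt : 0 ≤ 1 / A * t ^ 2 := by positivity
  have key : ∀ u : L2 Ω, ‖u‖ ^ 2 ≤ (8 / A + 8) * t ^ 2 → ‖u‖ ≤ Real.sqrt (8 / A + 8) * t := by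
    intro u hu
    refine abs_le_of_sq_le_sq' ?_ (by positivity) |>.2
    rw [mul_pow, Real.sq_sqrt (by positivity)]
    exact hu
  have e8 : (8 / A + 8) * t ^ 2 = 8 * (1 / A * t ^ 2) + 8 * t ^ 2 := by ring
  have e4 : 4 / A * t ^ 2 = 4 * (1 / A * t ^ 2) := by ring
  have hK : 0 ≤ Real.sqrt (8 / A + 8) * t := by positivity
  have ht2 : 0 ≤ t ^ 2 := sq_nonneg t
  refine (pi_norm_le_iff_of_nonneg hK).2 fun m => ?_
  change ‖(p m).1‖ ≤ _
  refine max_le (key _ ?_) (max_le ((pi_norm_le_iff_of_nonneg hK).2 fun i => key _ ?_)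
    ((pi_norm_le_iff_of_nonneg hK).2 fun i => (pi_norm_le_iff_of_nonneg hK).2 fun j => key _ ?_))
  · rw [norm_sq_L2, e8]
    have := hv2 m
    linarith
  · rw [norm_sq_L2, e8]
    have h1 := integral_weakDeriv_sq_le hΩ hΩb (hv m) (hf m) (hj m).isExtLaplacian
      ((hj m).memLp_fst i) ((hj m).weak_fst i)
    have := hv2 m
    have := hf2 m
    linarith
  · rw [norm_sq_L2, e8]
    have h1 := integral_weakDeriv_weakDeriv_sq_le hΩ hΩb (hv m) (hf m) (hj m).isExtLaplacian
      ((hj m).memLp_snd i j) ((hj m).weak_fst i) ((hj m).weak_snd i j)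
    have := hf2 m
    linarith

/-- An operator bounded below on a complete space has complete range, so `-y` has a nearest point in
it. Only the target has to be an inner product space; the jets may keep their sup norm. -/
theorem exists_norm_add_le_of_bounded_below {E F : Type*} [NormedAddCommGroup E] [NormedSpace ℝ E]
    [CompleteSpace E] [NormedAddCommGroup F] [InnerProductSpace ℝ F] (S : E →L[ℝ] F) {K : ℝ}
    (hK : 0 ≤ K) (h : ∀ x, ‖x‖ ≤ K * ‖S x‖) (y : F) : ∃ x₀, ∀ x, ‖y + S x₀‖ ≤ ‖y + S x‖ := by
  have ha : AntilipschitzWith ⟨K, hK⟩ S := AddMonoidHomClass.antilipschitz_of_bound S h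
  have hcomp : IsComplete (S.range : Set F) := by
    have := ha.isComplete_range S.uniformContinuous
    rwa [← ContinuousLinearMap.coe_coe, ← LinearMap.coe_range] at this
  obtain ⟨z, ⟨x₀, hx₀⟩, hz⟩ := S.range.exists_norm_eq_iInf_of_complete_subspace hcomp (-y)
  refine ⟨x₀, fun x => ?_⟩
  have hx₀' : S x₀ = z := hx₀
  have h1 : ∀ a : F, ‖y + a‖ = ‖-y - a‖ := fun a => by rw [← norm_neg, neg_add, sub_eq_add_neg]
  rw [h1, h1, hx₀', hz]
  exact ciInf_le ⟨0, by rintro _ ⟨a, rfl⟩; exact norm_nonneg _⟩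
    (⟨S x, ⟨x, rfl⟩⟩ : (S.range : Set F))

/-- The weighted functionals attain their minimum on the admissible set. -/
theorem exists_isMinOn_costJ (hΩ : IsOpen Ω) (hΩb : Bornology.IsBounded Ω) {T : ℝ}
    {Ψ : ℕ → ℝ → ℝ} {x₀ : Sp d} {b β lam : ℝ} (hβ : 0 ≤ β)
    (hw1 : ∀ x ∈ Ω, 1 ≤ carlemanExp x₀ b β lam x) (hc : Continuous c) {c₁ : ℝ}
    (hc₁ : ∀ x ∈ Ω, |c x| ≤ c₁) {A : ℝ} (hA0 : 0 < A)
    (hA : 4 * c₁ ^ 2 * ∑ m : Fin N, ∑ n : Fin N, sCoef T Ψ m n ^ 2 ≤ A)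
    (hcarl : ∀ v f : Sp d → ℝ, MemLp v 2 (volume.restrict Ω) → MemLp f 2 (volume.restrict Ω) →
      IsExtLaplacian Ω v f → A * ∫ x in Ω, (carlemanExp x₀ b β lam x * v x) ^ 2
        ≤ ∫ x in Ω, (carlemanExp x₀ b β lam x * f x) ^ 2)
    {f g : Fin N → Sp d → ℝ} {uStar F : Fin N → Sp d → ℝ} (hu : uStar ∈ admissible Ω f g)
    (hF : ∀ m, MemLp (F m) 2 (volume.restrict Ω)) :
    ∃ u ∈ admissible Ω f g, IsMinOn (costJ Ω T Ψ c x₀ b β lam F) (admissible Ω f g) u := by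
  have hm := hΩ.measurableSet
  set w := carlemanExp x₀ b β lam
  have hw : Continuous w := continuous_carlemanExp hβ _ _ _
  set s : Fin N → Fin N → ℝ := fun m n => sCoef T Ψ m n
  have hy : ∀ m, MemLp (fun x => w x * (linPart Ω T Ψ c uStar m x + F m x)) 2
      (volume.restrict Ω) := fun m =>
    memLp_mul_of_continuous hm hΩb hw (((hu m).1.isJet.memLp_lap.sub
      (memLp_mul_of_continuous hm hΩb hc (memLp_finsetSum _ fun n _ =>
        (hu n).1.1.1.const_mul (s m n)))).add (hF m))
  -- The weighted residual at the base point `uStar`. As the admissible set is `uStar` plus zero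
  -- jets, the cost becomes `‖y + S p‖²`, with `S` the system operator.
  set y : PiLp 2 (fun _ : Fin N => L2 Ω) := WithLp.toLp 2 fun m => (hy m).toLp _ with hydef
  have hcost : ∀ (u : Fin N → Sp d → ℝ) (p : Fin N → zeroJets Ω),
      (∀ m, u m =ᵐ[volume.restrict Ω] fun x => uStar m x + (p m).1.1 x) →
      (∀ m, lap Ω (u m) =ᵐ[volume.restrict Ω]
        fun x => lap Ω (uStar m) x + ∑ i, (p m).1.2.2 i i x) →
      costJ Ω T Ψ c x₀ b β lam F u = ‖y + systemOp Ω w c s p‖ ^ 2 := by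
    intro u p h1 h2
    have h3 : ∀ m, (y + systemOp Ω w c s p) m =ᵐ[volume.restrict Ω]
        fun x => w x * (linPart Ω T Ψ c u m x + F m x) := by
      intro m
      have e : (y + systemOp Ω w c s p) m = (hy m).toLp _ + systemOp Ω w c s p m := rfl
      rw [e]
      filter_upwards [Lp.coeFn_add ((hy m).toLp _) (systemOp Ω w c s p m), (hy m).coeFn_toLp,
        systemOp_ae_eq (memLp_top_of_continuous hm hΩb hw) (memLp_top_of_continuous hm hΩb hc) s p m,
        eventually_all.2 h1, h2 m] with x k1 k2 k3 k4 k5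
      rw [k1, Pi.add_apply, k2, k3, linPart, linPart, k5]
      simp_rw [k4, mul_add, Finset.sum_add_distrib]
      ring
    rw [norm_sq_piL2_of_ae_eq h3, costJ]
    refine Finset.sum_congr rfl fun m _ => integral_congr_ae (ae_of_all _ fun x => ?_)
    simp only [mul_pow, sq_abs]
    rfl
  have : CompleteSpace (zeroJets Ω) := isClosed_zeroJets.completeSpace_coe
  obtain ⟨p₀, hp₀⟩ := exists_norm_add_le_of_bounded_below (systemOp Ω w c s)
    (Real.sqrt_nonneg _) (systemOp_bounded_below hΩ hΩb hw hw1 hc hc₁ s hA0 hA hcarl) y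
  have hadd := fun m => (mem_zeroJets_iff.1 (p₀ m).2).add_cauchyData hΩ (hu m).1 (hu m).2.1
    (hu m).2.2
  refine ⟨fun m x => uStar m x + (p₀ m).1.1 x, fun m => ⟨(hadd m).1, (hadd m).2.1, (hadd m).2.2.1⟩,
    isMinOn_iff.2 fun u hu' => ?_⟩
  have hz := fun m => isZeroJet_sub (hu' m).1 (hu' m).2.1 (hu' m).2.2 (hu m).1 (hu m).2.1 (hu m).2.2
  -- An arbitrary competitor differs from `uStar` by a zero jet; passing to `L²` classes keeps all
  -- constraints.
  have hz' : ∀ m, ((hz m).memLp.toLp _, fun i => ((hz m).memLp_fst i).toLp _,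
      fun i j => ((hz m).memLp_snd i j).toLp _) ∈ zeroJets Ω := by
    intro m
    refine mem_zeroJets_iff.2 ⟨(hz m).toIsJet.congr (hz m).memLp.coeFn_toLp.symm
      (fun i => ((hz m).memLp_fst i).coeFn_toLp.symm)
      (fun i j => ((hz m).memLp_snd i j).coeFn_toLp.symm), fun X hX hXc => ?_, fun φ hφ hφc => ?_⟩
    · rw [← (hz m).trace X hX hXc]
      exact traceForm_congr (hz m).memLp.coeFn_toLp (fun i => ((hz m).memLp_fst i).coeFn_toLp) X
    · rw [← (hz m).normal φ hφ hφc]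
      refine normalForm_congr ?_ (fun i => ((hz m).memLp_fst i).coeFn_toLp) φ
      filter_upwards [eventually_all.2 fun i => ((hz m).memLp_snd i i).coeFn_toLp] with x hx
      exact Finset.sum_congr rfl fun i _ => hx i
  rw [hcost _ p₀ (fun m => ae_eq_refl _) (fun m => (hadd m).2.2.2),
    hcost u (fun m => ⟨_, hz' m⟩) (fun m => ?_) (fun m => ?_)]
  · exact pow_le_pow_left₀ (norm_nonneg _) (hp₀ _) 2
  · filter_upwards [(hz m).memLp.coeFn_toLp] with x hx
    rw [hx]
    ring
  · filter_upwards [eventually_all.2 fun i => ((hz m).memLp_snd i i).coeFn_toLp] with x hx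
    simp_rw [hx, Finset.sum_add_distrib, Finset.sum_neg_distrib]
    simp only [lap]
    ring

end minimizers

/-! ### The nonlinearity in Fourier coefficients -/

section nonlinearity

variable {T M Q : ℝ} {Ψ : ℕ → ℝ → ℝ} {q : ℝ → ℝ} {N : ℕ}

theorem IsTimeBasis.continuousOn (h : IsTimeBasis T Ψ) (hT : 0 < T) (n : ℕ) :
    ContinuousOn (Ψ n) (Icc 0 T) := by
  have := (h.absCont n).continuousOn
  rwa [uIcc_of_le hT.le] at this

theorem memLp_of_continuousOn_Icc {F : ℝ → ℝ} (hF : ContinuousOn F (Icc 0 T)) :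
    MemLp F 2 (volume.restrict (Ioo 0 T)) := by
  obtain ⟨K, hK⟩ := isCompact_Icc.exists_bound_of_continuousOn hF
  have hm : AEStronglyMeasurable F (volume.restrict (Ioo 0 T)) :=
    (hF.mono Ioo_subset_Icc_self).aestronglyMeasurable measurableSet_Ioo
  exact MemLp.of_bound hm K (ae_restrict_of_forall_mem measurableSet_Ioo
    fun t ht => hK t (Ioo_subset_Icc_self ht))

theorem intervalIntegral_eq_Ioo (hT : 0 < T) (F : ℝ → ℝ) :
    ∫ t in (0 : ℝ)..T, F t = ∫ t in Ioo 0 T, F t := by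
  rw [intervalIntegral.integral_of_le hT.le, integral_Ioc_eq_integral_Ioo]

/-- Bessel's inequality for the time basis. -/
theorem IsTimeBasis.bessel (h : IsTimeBasis T Ψ) {F : ℝ → ℝ}
    (hF : MemLp F 2 (volume.restrict (Ioo 0 T))) :
    ∑ m : Fin N, (∫ t in Ioo 0 T, F t * Ψ m t) ^ 2 ≤ ∫ t in Ioo 0 T, F t ^ 2 := by
  obtain ⟨B, hB⟩ := h.basis
  have ho : Orthonormal ℝ (fun m : Fin N => B m) := B.orthonormal.comp _ Fin.val_injective
  have := ho.sum_inner_products_le (s := Finset.univ) (hF.toLp F)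
  rw [norm_sq_L2_of_ae_eq hF.coeFn_toLp] at this
  refine le_trans (le_of_eq ?_) this
  refine Finset.sum_congr rfl fun m _ => ?_
  rw [Real.norm_eq_abs, sq_abs, L2.inner_def]
  congr 1
  refine integral_congr_ae ?_
  filter_upwards [hB m, hF.coeFn_toLp] with t h1 h2
  rw [h1, h2]
  rfl

/-- Parseval's identity for finite combinations of the time basis. -/
theorem IsTimeBasis.integral_sum_sq (h : IsTimeBasis T Ψ) (a : Fin N → ℝ) :
    ∫ t in Ioo 0 T, (∑ n, a n * Ψ n t) ^ 2 = ∑ n, a n ^ 2 := by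
  obtain ⟨B, hB⟩ := h.basis
  have ho : Orthonormal ℝ (fun m : Fin N => B m) := B.orthonormal.comp _ Fin.val_injective
  have h1 := ho.inner_sum a a Finset.univ
  have hae : (↑(∑ n : Fin N, a n • B n) : ℝ → ℝ) =ᵐ[volume.restrict (Ioo 0 T)]
      fun t => ∑ n : Fin N, a n * Ψ n t := by
    have hsm : ∀ n : Fin N, (↑(a n • B n) : ℝ → ℝ) =ᵐ[volume.restrict (Ioo 0 T)]
        fun t => a n * Ψ n t := fun n => by
      filter_upwards [Lp.coeFn_smul (a n) (B n), hB n] with t h1 h2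
      rw [h1, Pi.smul_apply, h2, smul_eq_mul]
    filter_upwards [coeFn_finsetSum Finset.univ (fun n : Fin N => a n • B n), eventually_all.2 hsm]
      with t h1 h2
    rw [h1]
    exact Finset.sum_congr rfl fun n _ => h2 n
  rw [real_inner_self_eq_norm_sq, norm_sq_L2_of_ae_eq hae] at h1
  rw [h1]
  simp [sq]

/-- The mean value inequality. A point between the two values is again a value at the same `t`, for
a convex combination of the coefficients, so the bound on `q'` applies on the whole segment. -/
theorem abs_sub_le_of_c1BoundedBy (hq : ContDiff ℝ 1 q) (hQ : C1BoundedBy N T Ψ q M Q)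
    {s s' : Fin N → ℝ} (hs : ∀ n, |s n| ≤ M * Real.sqrt T) (hs' : ∀ n, |s' n| ≤ M * Real.sqrt T)
    {t : ℝ} (ht : t ∈ Icc 0 T) :
    |q (∑ n, s n * Ψ n t) - q (∑ n, s' n * Ψ n t)| ≤ Q * |∑ n, (s n - s' n) * Ψ n t| := by
  have hseg : ∀ y ∈ segment ℝ (∑ n, s' n * Ψ n t) (∑ n, s n * Ψ n t), ‖deriv q y‖ ≤ Q := by
    rintro y ⟨a, b, ha, hb, hab, rfl⟩
    have := (hQ t ht (fun n => a * s' n + b * s n) (fun n => by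
      calc |a * s' n + b * s n| ≤ |a * s' n| + |b * s n| := abs_add_le _ _
        _ = a * |s' n| + b * |s n| := by rw [abs_mul, abs_mul, abs_of_nonneg ha, abs_of_nonneg hb]
        _ ≤ a * (M * Real.sqrt T) + b * (M * Real.sqrt T) := by
          gcongr
          exacts [hs' n, hs n]
        _ = M * Real.sqrt T := by rw [← add_mul, hab, one_mul])).2
    rw [Real.norm_eq_abs]
    convert this using 3
    rw [smul_eq_mul, smul_eq_mul, Finset.mul_sum, Finset.mul_sum, ← Finset.sum_add_distrib]
    exact Finset.sum_congr rfl fun n _ => by ring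
  have := Convex.norm_image_sub_le_of_norm_deriv_le (f := q)
    (fun y _ => hq.differentiable (by simp) y) hseg (convex_segment _ _)
    (left_mem_segment _ _ _) (right_mem_segment _ _ _)
  rw [Real.norm_eq_abs, Real.norm_eq_abs, ← Finset.sum_sub_distrib] at this
  simpa only [sub_mul] using this

theorem continuousOn_sum_timeBasis (h : IsTimeBasis T Ψ) (hT : 0 < T) (s : Fin N → ℝ) :
    ContinuousOn (fun t => ∑ n, s n * Ψ n t) (Icc 0 T) :=
  continuousOn_finsetSum _ fun n _ => continuousOn_const.mul (h.continuousOn hT n)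

/-- The Fourier coefficients of the nonlinearity are Lipschitz on the cube. -/
theorem qCoef_lipschitz (h : IsTimeBasis T Ψ) (hT : 0 < T) (hq : ContDiff ℝ 1 q)
    (hQ : C1BoundedBy N T Ψ q M Q) {s s' : Fin N → ℝ} (hs : ∀ n, |s n| ≤ M * Real.sqrt T)
    (hs' : ∀ n, |s' n| ≤ M * Real.sqrt T) :
    ∑ m : Fin N, (qCoef T Ψ q m s - qCoef T Ψ q m s') ^ 2 ≤ Q ^ 2 * ∑ n, (s n - s' n) ^ 2 := by
  have hcont : ∀ s : Fin N → ℝ, ContinuousOn (fun t => q (∑ n, s n * Ψ n t)) (Icc 0 T) := fun s =>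
    hq.continuous.comp_continuousOn (continuousOn_sum_timeBasis h hT s)
  have hm := fun s => memLp_of_continuousOn_Icc (hcont s)
  have hΨ := fun n => memLp_of_continuousOn_Icc (h.continuousOn hT n)
  have hsub := (hm s).sub (hm s')
  have e : ∀ m : Fin N, qCoef T Ψ q m s - qCoef T Ψ q m s'
      = ∫ t in Ioo 0 T, (q (∑ n, s n * Ψ n t) - q (∑ n, s' n * Ψ n t)) * Ψ m t := by
    intro m
    rw [qCoef, qCoef, intervalIntegral_eq_Ioo hT, intervalIntegral_eq_Ioo hT,
      ← integral_sub (integrable_mul_of_memLp (hm s) (hΨ m))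
        (integrable_mul_of_memLp (hm s') (hΨ m))]
    simp_rw [sub_mul]
  simp_rw [e]
  -- Bessel's inequality removes the projection onto the `Ψ_m`, and Parseval's identity returns from
  -- functions of `t` to coefficients; hence the constant is exactly `Q²`.
  refine (h.bessel hsub).trans ?_
  rw [← h.integral_sum_sq (fun n => s n - s' n), ← integral_const_mul]
  refine setIntegral_mono_on hsub.integrable_sq ((memLp_of_continuousOn_Icc
    (continuousOn_sum_timeBasis h hT _)).integrable_sq.const_mul _) measurableSet_Ioo
    fun t ht => ?_
  have := abs_sub_le_of_c1BoundedBy hq hQ hs hs' (Ioo_subset_Icc_self ht)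
  calc (q (∑ n, s n * Ψ n t) - q (∑ n, s' n * Ψ n t)) ^ 2
      = |q (∑ n, s n * Ψ n t) - q (∑ n, s' n * Ψ n t)| ^ 2 := (sq_abs _).symm
    _ ≤ (Q * |∑ n, (s n - s' n) * Ψ n t|) ^ 2 := by gcongr
    _ = Q ^ 2 * (∑ n, (s n - s' n) * Ψ n t) ^ 2 := by rw [mul_pow, sq_abs]

theorem abs_cutoff_le (hM : 0 ≤ M * Real.sqrt T) (s : ℝ) : |cutoff M T s| ≤ M * Real.sqrt T :=
  abs_le.2 ⟨le_max_left _ _, max_le (by linarith) (min_le_left _ _)⟩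

theorem cutoff_eq_self {s : ℝ} (hs : |s| ≤ M * Real.sqrt T) : cutoff M T s = s := by
  rw [cutoff, min_eq_right (abs_le.1 hs).2, max_eq_right (abs_le.1 hs).1]

theorem abs_cutoff_sub_le (s s' : ℝ) : |cutoff M T s - cutoff M T s'| ≤ |s - s'| := by
  unfold cutoff
  refine (abs_max_sub_max_le_max _ _ _ _).trans (max_le (by simp) ?_)
  exact (abs_min_sub_min_le_max _ _ _ _).trans (max_le (by simp) le_rfl)

/-- The cut-off maps into the cube where `Q` controls `q'` and is itself 1-Lipschitz, so the
estimate becomes global. -/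
theorem qCoef_cutoff_lipschitz (h : IsTimeBasis T Ψ) (hT : 0 < T) (hq : ContDiff ℝ 1 q)
    (hM : 0 ≤ M) (hQ : C1BoundedBy N T Ψ q M Q) (s s' : Fin N → ℝ) :
    ∑ m : Fin N, (qCoef T Ψ q m (fun n => cutoff M T (s n))
      - qCoef T Ψ q m (fun n => cutoff M T (s' n))) ^ 2 ≤ Q ^ 2 * ∑ n, (s n - s' n) ^ 2 := by
  have hM' : 0 ≤ M * Real.sqrt T := by positivity
  refine (qCoef_lipschitz h hT hq hQ (fun n => abs_cutoff_le hM' _)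
    (fun n => abs_cutoff_le hM' _)).trans ?_
  exact mul_le_mul_of_nonneg_left
    (Finset.sum_le_sum fun n _ => sq_le_sq.2 (abs_cutoff_sub_le _ _)) (sq_nonneg _)

theorem continuous_qCoef_cutoff (h : IsTimeBasis T Ψ) (hT : 0 < T) (hq : ContDiff ℝ 1 q)
    (hM : 0 ≤ M) (hQ : C1BoundedBy N T Ψ q M Q) (m : Fin N) :
    Continuous (fun s : Fin N → ℝ => qCoef T Ψ q m (fun n => cutoff M T (s n))) := by
  refine continuous_iff_continuousAt.2 fun a => ?_
  refine tendsto_iff_dist_tendsto_zero.2 ?_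
  have hlim : Tendsto (fun s : Fin N → ℝ => Real.sqrt (Q ^ 2 * ∑ n, (s n - a n) ^ 2)) (𝓝 a)
      (𝓝 0) := by
    have : Continuous (fun s : Fin N → ℝ => Real.sqrt (Q ^ 2 * ∑ n, (s n - a n) ^ 2)) := by fun_prop
    simpa using this.tendsto a
  refine squeeze_zero (fun _ => dist_nonneg) (fun s => ?_) hlim
  rw [Real.dist_eq]
  refine Real.abs_le_sqrt ((Finset.single_le_sum (f := fun m : Fin N =>
    (qCoef T Ψ q m (fun n => cutoff M T (s n))
      - qCoef T Ψ q m (fun n => cutoff M T (a n))) ^ 2) (fun m _ => sq_nonneg _)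
    (Finset.mem_univ m)).trans (qCoef_cutoff_lipschitz h hT hq hM hQ s a))

/-- A continuous function is bounded on the compact cube, and the cut-off is idempotent. -/
theorem exists_bound_qCoef_cutoff (h : IsTimeBasis T Ψ) (hT : 0 < T) (hq : ContDiff ℝ 1 q)
    (hM : 0 ≤ M) (hQ : C1BoundedBy N T Ψ q M Q) (m : Fin N) :
    ∃ K, ∀ s : Fin N → ℝ, ‖qCoef T Ψ q m (fun n => cutoff M T (s n))‖ ≤ K := by
  have hM' : 0 ≤ M * Real.sqrt T := by positivity
  have hcomp : IsCompact (Set.pi univ fun _ : Fin N => Icc (-(M * Real.sqrt T)) (M * Real.sqrt T)) :=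
    isCompact_univ_pi fun _ => isCompact_Icc
  obtain ⟨K, hK⟩ := hcomp.exists_bound_of_continuousOn
    (continuous_qCoef_cutoff h hT hq hM hQ m).continuousOn
  refine ⟨K, fun s => ?_⟩
  have := hK (fun n => cutoff M T (s n)) fun n _ => abs_le.1 (abs_cutoff_le hM' (s n))
  simpa only [cutoff_eq_self (abs_cutoff_le hM' _)] using this

variable {d : ℕ} {Ω : Set (Sp d)}

theorem memLp_qCoef_cutoff (h : IsTimeBasis T Ψ) (hT : 0 < T) (hq : ContDiff ℝ 1 q)
    (hM : 0 ≤ M) (hQ : C1BoundedBy N T Ψ q M Q) (hΩb : Bornology.IsBounded Ω)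
    {u : Fin N → Sp d → ℝ} (hu : ∀ n, AEStronglyMeasurable (u n) (volume.restrict Ω)) (m : Fin N) :
    MemLp (fun x => qCoef T Ψ q m (fun n => cutoff M T (u n x))) 2 (volume.restrict Ω) := by
  have hfin : IsFiniteMeasure (volume.restrict Ω) := ⟨by
    rw [Measure.restrict_apply_univ]; exact hΩb.measure_lt_top⟩
  obtain ⟨K, hK⟩ := exists_bound_qCoef_cutoff h hT hq hM hQ m
  refine MemLp.of_bound ?_ K (ae_of_all _ fun x => hK fun n => u n x)
  have hmeas : AEMeasurable (fun x n => u n x) (volume.restrict Ω) :=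
    aemeasurable_pi_lambda _ fun n => (hu n).aemeasurable
  exact ((continuous_qCoef_cutoff h hT hq hM hQ m).measurable.comp_aemeasurable
    hmeas).aestronglyMeasurable

/-- A bound for the sum `∑ u_n Ψ_n` bounds its Fourier coefficients. -/
theorem ae_abs_coef_le (h : IsTimeBasis T Ψ) (hT : 0 < T) {u : Fin N → Sp d → ℝ}
    (hM : eLpNorm (fun z : Sp d × ℝ => expand Ψ u z.1 z.2) ∞
      ((volume.restrict Ω).prod (volume.restrict (Icc 0 T))) < ENNReal.ofReal M) :
    ∀ᵐ x ∂(volume.restrict Ω), ∀ n, |u n x| ≤ M * Real.sqrt T := by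
  have hM0 : 0 < M := by
    by_contra hneg
    rw [ENNReal.ofReal_eq_zero.2 (not_lt.1 hneg)] at hM
    exact absurd hM not_lt_zero
  rw [eLpNorm_exponent_top] at hM
  have h1 : ∀ᵐ z ∂((volume.restrict Ω).prod (volume.restrict (Icc 0 T))),
      |expand Ψ u z.1 z.2| ≤ M := by
    filter_upwards [ae_le_eLpNormEssSup (f := fun z : Sp d × ℝ => expand Ψ u z.1 z.2)
      (μ := (volume.restrict Ω).prod (volume.restrict (Icc 0 T)))] with z hz
    have h2 := hz.trans hM.le
    rw [← ofReal_norm, ENNReal.ofReal_le_ofReal_iff hM0.le] at h2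
    exact h2
  filter_upwards [Measure.ae_ae_of_ae_prod h1] with x hx n
  have h2 : ∀ᵐ t ∂(volume.restrict (Ioo 0 T)), |∑ n : Fin N, u n x * Ψ n t| ≤ M :=
    ae_mono (Measure.restrict_mono Ioo_subset_Icc_self le_rfl) hx
  -- Parseval's identity in `t` for fixed `x`. This is the origin of the cut-off level `M √T`.
  have h3 : ∑ n : Fin N, u n x ^ 2 ≤ M ^ 2 * T := by
    rw [← h.integral_sum_sq (fun n => u n x)]
    calc ∫ t in Ioo 0 T, (∑ n : Fin N, u n x * Ψ n t) ^ 2 ≤ ∫ _ in Ioo 0 T, M ^ 2 := by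
          refine integral_mono_ae (memLp_of_continuousOn_Icc
            (continuousOn_sum_timeBasis h hT _)).integrable_sq (by simp) ?_
          filter_upwards [h2] with t ht
          exact sq_le_sq' (abs_le.1 ht).1 (abs_le.1 ht).2
      _ = M ^ 2 * T := by simp [hT.le, mul_comm]
  have h4 : u n x ^ 2 ≤ M ^ 2 * T :=
    (Finset.single_le_sum (f := fun n => u n x ^ 2) (fun n _ => sq_nonneg _)
      (Finset.mem_univ n)).trans h3
  refine (Real.abs_le_sqrt h4).trans (le_of_eq ?_)
  rw [Real.sqrt_mul (sq_nonneg M), Real.sqrt_sq hM0.le]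

end nonlinearity

/-! ### Contraction of the weighted error -/

section iteration

variable {d N : ℕ} {Ω : Set (Sp d)} {T M Q : ℝ} {Ψ : ℕ → ℝ → ℝ} {c : Sp d → ℝ} {q : ℝ → ℝ}
  {x₀ : Sp d} {b β lam : ℝ} {f g uStar u u' : Fin N → Sp d → ℝ}

theorem memLp_linPart (hΩ : MeasurableSet Ω) (hΩb : Bornology.IsBounded Ω) (hc : Continuous c)
    (hu : ∀ m, MemH2 Ω (u m)) (m : Fin N) :
    MemLp (linPart Ω T Ψ c u m) 2 (volume.restrict Ω) :=
  (hu m).isJet.memLp_lap.sub (memLp_mul_of_continuous hΩ hΩb hc (memLp_finsetSum _ fun n _ =>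
    (hu n).1.1.const_mul _))

/-- One step of the iteration contracts the weighted error. -/
theorem weightedError_step (hΩ : IsOpen Ω) (hΩb : Bornology.IsBounded Ω) (hβ : 0 ≤ β)
    (hc : Continuous c) {c₁ : ℝ} (hc₁ : ∀ x ∈ Ω, |c x| ≤ c₁) {A : ℝ}
    (hA : 4 * c₁ ^ 2 * ∑ m : Fin N, ∑ n : Fin N, sCoef T Ψ m n ^ 2 ≤ A)
    (hcarl : ∀ v f : Sp d → ℝ, MemLp v 2 (volume.restrict Ω) → MemLp f 2 (volume.restrict Ω) →
      IsExtLaplacian Ω v f → A * ∫ x in Ω, (carlemanExp x₀ b β lam x * v x) ^ 2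
        ≤ ∫ x in Ω, (carlemanExp x₀ b β lam x * f x) ^ 2)
    (hΨ : IsTimeBasis T Ψ) (hT : 0 < T) (hq : ContDiff ℝ 1 q) (hM : 0 ≤ M)
    (hQ : C1BoundedBy N T Ψ q M Q) (hsol : IsSolution Ω T Ψ c q f g uStar)
    (hbd : ∀ᵐ x ∂(volume.restrict Ω), ∀ n, |uStar n x| ≤ M * Real.sqrt T)
    (hu : u ∈ admissible Ω f g) (hu' : u' ∈ admissible Ω f g)
    (hmin : IsMinOn (costJ Ω T Ψ c x₀ b β lam
      (fun m x => qCoef T Ψ q m (fun n => cutoff M T (u n x)))) (admissible Ω f g) u') :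
    A * weightedError Ω x₀ b β lam u' uStar ≤ 16 * Q ^ 2 * weightedError Ω x₀ b β lam u uStar := by
  have hm := hΩ.measurableSet
  have hS := hsol.1
  set w := carlemanExp x₀ b β lam with hwdef
  have hw : Continuous w := continuous_carlemanExp hβ _ _ _
  set F : Fin N → Sp d → ℝ := fun m x => qCoef T Ψ q m (fun n => cutoff M T (u n x)) with hF
  set Fs : Fin N → Sp d → ℝ := fun m x => qCoef T Ψ q m (fun n => cutoff M T (uStar n x)) with hFs
  have hFm : ∀ m, MemLp (F m) 2 (volume.restrict Ω) :=
    memLp_qCoef_cutoff hΨ hT hq hM hQ hΩb fun n => (hu n).1.1.1.aestronglyMeasurable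
  have hFsm : ∀ m, MemLp (Fs m) 2 (volume.restrict Ω) :=
    memLp_qCoef_cutoff hΨ hT hq hM hQ hΩb fun n => (hS n).1.1.1.aestronglyMeasurable
  -- The cut-off is inactive on `uStar`, so `uStar` also solves the system with the truncated
  -- nonlinearity.
  have hLS : ∀ m, ∀ᵐ x ∂(volume.restrict Ω), linPart Ω T Ψ c uStar m x = -Fs m x := by
    intro m
    filter_upwards [hsol.2 m, hbd] with x h1 h2
    have e : Fs m x = qCoef T Ψ q m (fun n => uStar n x) := by
      simp only [hFs, cutoff_eq_self (h2 _)]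
    rw [e, linPart, h1]
    ring
  set D := ∑ m, ∫ x in Ω, (w x * (F m x - Fs m x)) ^ 2 with hD
  have iD : ∀ m, Integrable (fun x => (w x * (F m x - Fs m x)) ^ 2) (volume.restrict Ω) :=
    fun m => (memLp_mul_of_continuous hm hΩb hw ((hFm m).sub (hFsm m))).integrable_sq
  have iE : ∀ m, Integrable (fun x => (w x * (u m x - uStar m x)) ^ 2) (volume.restrict Ω) :=
    fun m => (memLp_mul_of_continuous hm hΩb hw
      ((hu m).1.1.1.sub (hS m).1.1.1)).integrable_sq
  have hDle : D ≤ Q ^ 2 * weightedError Ω x₀ b β lam u uStar := by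
    rw [hD, weightedError, ← hwdef, ← integral_finsetSum _ fun m _ => iD m,
      ← integral_finsetSum _ fun m _ => iE m, ← integral_const_mul]
    refine integral_mono (integrable_finsetSum _ fun m _ => iD m)
      ((integrable_finsetSum _ fun m _ => iE m).const_mul _) fun x => ?_
    have h1 := mul_le_mul_of_nonneg_left
      (qCoef_cutoff_lipschitz hΨ hT hq hM hQ (fun n => u n x) (fun n => uStar n x))
      (sq_nonneg (w x))
    simp only [mul_pow, ← Finset.mul_sum]
    calc _ ≤ _ := h1
      _ = _ := by ring
  have hcost1 : costJ Ω T Ψ c x₀ b β lam F uStar = D := by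
    refine Finset.sum_congr rfl fun m _ => integral_congr_ae ?_
    filter_upwards [hLS m] with x hx
    rw [hx, sq_abs, mul_pow]
    ring
  have hcost2 : costJ Ω T Ψ c x₀ b β lam F u'
      = ∑ m, ∫ x in Ω, (w x * (linPart Ω T Ψ c u' m x + F m x)) ^ 2 := by
    refine Finset.sum_congr rfl fun m _ => integral_congr_ae (ae_of_all _ fun x => ?_)
    simp only [sq_abs, mul_pow, hwdef]
  -- Minimality of `u'` against the competitor `uStar`, whose cost is `D`.
  have hle : ∑ m, ∫ x in Ω, (w x * (linPart Ω T Ψ c u' m x + F m x)) ^ 2 ≤ D := by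
    rw [← hcost1, ← hcost2]
    exact isMinOn_iff.1 hmin uStar hS
  have hz := fun m => isZeroJet_sub (hu' m).1 (hu' m).2.1 (hu' m).2.2 (hS m).1 (hS m).2.1 (hS m).2.2
  have hst := (system_stability hm hΩb hw hc hc₁ (fun m n => sCoef T Ψ m n) hA
    (fun m => (hz m).memLp) (fun m => (hz m).memLp_lap)
    (fun m => hcarl _ _ (hz m).memLp (hz m).memLp_lap (hz m).isExtLaplacian)).1
  have iL : ∀ m, Integrable (fun x => (w x * (linPart Ω T Ψ c u' m x + F m x)) ^ 2)
      (volume.restrict Ω) := fun m => (memLp_mul_of_continuous hm hΩb hw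
    ((memLp_linPart hm hΩb hc (fun m => (hu' m).1) m).add (hFm m))).integrable_sq
  -- The linear operator at `u' - uStar` is the residual of `u'` minus `F - Fs`. Both have weighted
  -- square at most `D`, so `(a - b)² ≤ 2a² + 2b²` gives `4D`; the factor 4 of stability then makes
  -- 16.
  have hlin : ∑ m, ∫ x in Ω, (w x * ((∑ i, (weakDeriv Ω i (weakDeriv Ω i (u' m)) x
        + -weakDeriv Ω i (weakDeriv Ω i (uStar m)) x))
        - c x * ∑ n : Fin N, sCoef T Ψ m n * (u' n x + -uStar n x))) ^ 2 ≤ 4 * D := by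
    calc _ ≤ ∑ m, (2 * (∫ x in Ω, (w x * (linPart Ω T Ψ c u' m x + F m x)) ^ 2)
          + 2 * ∫ x in Ω, (w x * (F m x - Fs m x)) ^ 2) := by
          refine Finset.sum_le_sum fun m _ => ?_
          rw [← integral_const_mul, ← integral_const_mul,
            ← integral_add ((iL m).const_mul _) ((iD m).const_mul _)]
          refine integral_mono_of_nonneg (ae_of_all _ fun x => sq_nonneg _)
            (((iL m).const_mul _).add ((iD m).const_mul _)) ?_
          filter_upwards [hLS m] with x hx
          have e : (∑ i, (weakDeriv Ω i (weakDeriv Ω i (u' m)) x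
              + -weakDeriv Ω i (weakDeriv Ω i (uStar m)) x))
              - c x * ∑ n : Fin N, sCoef T Ψ m n * (u' n x + -uStar n x)
              = (linPart Ω T Ψ c u' m x + F m x) - (F m x - Fs m x) := by
            have e1 : (∑ i, (weakDeriv Ω i (weakDeriv Ω i (u' m)) x
              + -weakDeriv Ω i (weakDeriv Ω i (uStar m)) x))
              - c x * ∑ n : Fin N, sCoef T Ψ m n * (u' n x + -uStar n x)
              = linPart Ω T Ψ c u' m x - linPart Ω T Ψ c uStar m x := by
              simp only [linPart, lap, mul_add, Finset.sum_add_distrib, Finset.sum_neg_distrib,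
                mul_neg]
              ring
            rw [e1, hx]
            ring
          simp only [e]
          nlinarith [sq_nonneg (w x * (linPart Ω T Ψ c u' m x + F m x)
            + w x * (F m x - Fs m x))]
      _ = 2 * (∑ m, ∫ x in Ω, (w x * (linPart Ω T Ψ c u' m x + F m x)) ^ 2) + 2 * D := by
          rw [Finset.sum_add_distrib, ← Finset.mul_sum, ← Finset.mul_sum]
      _ ≤ 4 * D := by linarith
  have e : weightedError Ω x₀ b β lam u' uStar
      = ∑ m, ∫ x in Ω, (w x * (u' m x + -uStar m x)) ^ 2 := by
    simp only [weightedError, sub_eq_add_neg, hwdef]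
  rw [e]
  linarith

theorem eLpNorm_two_eq {α : Type*} [MeasurableSpace α] {μ : Measure α} {F : α → ℝ}
    (hF : MemLp F 2 μ) : eLpNorm F 2 μ = ENNReal.ofReal (Real.sqrt (∫ x, F x ^ 2 ∂μ)) := by
  rw [hF.eLpNorm_eq_integral_rpow_norm (by simp) (by simp), Real.sqrt_eq_rpow]
  simp

theorem one_le_carlemanExp (hb : 0 ≤ b) (hlam : 0 ≤ lam) (x : Sp d) :
    1 ≤ carlemanExp x₀ b β lam x :=
  Real.one_le_exp (mul_nonneg (mul_nonneg hlam (Real.rpow_nonneg hb _))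
    (Real.rpow_nonneg dist_nonneg _))

/-- Geometric decay of the squared errors gives convergence of the initial values. -/
theorem tendsto_eLpNorm_expand {u : ℕ → Fin N → Sp d → ℝ} {K r : ℝ}
    (hu : ∀ k m, MemLp (u k m) 2 (volume.restrict Ω))
    (hS : ∀ m, MemLp (uStar m) 2 (volume.restrict Ω)) (hr0 : 0 ≤ r) (hr : r < 1)
    (hK : ∀ k : ℕ, 1 ≤ k → ∑ m, ∫ x in Ω, (u k m x - uStar m x) ^ 2 ≤ K * r ^ (k - 1)) :
    Tendsto (fun k : ℕ => eLpNorm (fun x => expand Ψ (u k) x 0 - expand Ψ uStar x 0) 2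
      (volume.restrict Ω)) atTop (𝓝 0) := by
  have hd : ∀ k m, MemLp (fun x => u k m x - uStar m x) 2 (volume.restrict Ω) :=
    fun k m => (hu k m).sub (hS m)
  have hE : ∀ k, (fun x => expand Ψ (u k) x 0 - expand Ψ uStar x 0)
      = fun x => ∑ n : Fin N, Ψ n 0 * (u k n x - uStar n x) := by
    intro k
    funext x
    rw [expand, expand, ← Finset.sum_sub_distrib]
    exact Finset.sum_congr rfl fun n _ => by ring
  have hm : ∀ k, MemLp (fun x => ∑ n : Fin N, Ψ n 0 * (u k n x - uStar n x)) 2 (volume.restrict Ω) :=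
    fun k => memLp_finsetSum _ fun n _ => (hd k n).const_mul _
  -- Cauchy-Schwarz over `n` bounds the error at `t = 0` by `P` times the squared coefficient
  -- errors.
  set P := ∑ n : Fin N, Ψ n 0 ^ 2 with hP
  have hP0 : 0 ≤ P := Finset.sum_nonneg fun n _ => sq_nonneg _
  have hbound : ∀ k : ℕ, 1 ≤ k →
      ∫ x in Ω, (∑ n : Fin N, Ψ n 0 * (u k n x - uStar n x)) ^ 2 ≤ P * (K * r ^ (k - 1)) := by
    intro k hk
    refine le_trans ?_ (mul_le_mul_of_nonneg_left (hK k hk) hP0)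
    rw [← integral_finsetSum _ fun n _ => (hd k n).integrable_sq, ← integral_const_mul]
    exact integral_mono (hm k).integrable_sq
      ((integrable_finsetSum _ fun n _ => (hd k n).integrable_sq).const_mul _)
      fun x => Finset.sum_mul_sq_le_sq_mul_sq _ _ _
  have hlim : Tendsto (fun k : ℕ => P * (K * r ^ (k - 1))) atTop (𝓝 0) := by
    have h1 := (tendsto_pow_atTop_nhds_zero_of_lt_one hr0 hr).comp (tendsto_sub_atTop_nat 1)
    simpa using (h1.const_mul K).const_mul P
  have hlim2 : Tendsto (fun k => ∫ x in Ω, (∑ n : Fin N, Ψ n 0 * (u k n x - uStar n x)) ^ 2)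
      atTop (𝓝 0) :=
    tendsto_of_tendsto_of_tendsto_of_le_of_le' tendsto_const_nhds hlim
      (Eventually.of_forall fun k => integral_nonneg fun x => sq_nonneg _)
      ((eventually_ge_atTop 1).mono hbound)
  simp_rw [hE, fun k => eLpNorm_two_eq (hm k)]
  have h3 := ENNReal.tendsto_ofReal (hlim2.sqrt)
  simpa using h3

end iteration

end LateralCauchy

/-! ### Choice of constants and conclusion -/

theorem mainTheorem1
    (d : ℕ) (hd : 1 ≤ d)
    (Ω : Set (LateralCauchy.Sp d)) (hΩo : IsOpen Ω) (hΩb : Bornology.IsBounded Ω)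
    (hΩs : LateralCauchy.HasSmoothBoundary Ω)
    (T : ℝ) (hT : 0 < T) (N : ℕ)
    (x₀ : LateralCauchy.Sp d) (b : ℝ)
    (hx₀ : ∀ x ∈ closure Ω, 1 < dist x x₀) (hb : ∀ x ∈ closure Ω, dist x x₀ < b) :
    ∃ β₀ : ℝ, 0 < β₀ ∧ ∀ β : ℝ, β₀ ≤ β →
    -- the constant `C = C(M, Q)` does not depend on the data quantified after it
    ∃ C : ℝ → ℝ → ℝ, (∀ M Q, 0 < C M Q) ∧
    ∀ Ψ : ℕ → ℝ → ℝ, LateralCauchy.IsTimeBasis T Ψ →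
    ∀ c₁ : ℝ, ∃ lam₀ : ℝ, 0 < lam₀ ∧
    ∀ (c : LateralCauchy.Sp d → ℝ) (c₀ : ℝ), ContDiff ℝ 1 c → 0 < c₀ → (∀ x, c₀ ≤ c x) →
      (∀ x ∈ Ω, c x ≤ c₁) →
    ∀ (q : ℝ → ℝ), ContDiff ℝ 1 q →
    ∀ (f g : Fin N → LateralCauchy.Sp d → ℝ),
      (∀ m, MemLp (f m) 2 (LateralCauchy.surfaceMeasure Ω)) →
      (∀ m, MemLp (g m) 2 (LateralCauchy.surfaceMeasure Ω)) →
    -- the unique solution of the system with Cauchy data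
    ∀ (uStar : Fin N → LateralCauchy.Sp d → ℝ),
      LateralCauchy.IsSolution Ω T Ψ c q f g uStar →
      (∀ w, LateralCauchy.IsSolution Ω T Ψ c q f g w →
        ∀ m, w m =ᵐ[volume.restrict Ω] uStar m) →
    ∀ (M Q : ℝ),
      eLpNorm (fun z : LateralCauchy.Sp d × ℝ => LateralCauchy.expand Ψ uStar z.1 z.2) ∞
        ((volume.restrict Ω).prod (volume.restrict (Icc 0 T))) < ENNReal.ofReal M →
      LateralCauchy.C1BoundedBy N T Ψ q M Q →
    ∀ lam : ℝ, lam₀ ≤ lam →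
      (∃ u, LateralCauchy.IsMinimizingIteration Ω T Ψ c q M x₀ b β lam f g u) ∧
      ∀ u : ℕ → Fin N → LateralCauchy.Sp d → ℝ,
        LateralCauchy.IsMinimizingIteration Ω T Ψ c q M x₀ b β lam f g u →
        (∀ k : ℕ, 1 ≤ k →
          LateralCauchy.weightedError Ω x₀ b β lam (u k) uStar
            ≤ (C M Q / lam ^ 3) ^ (k - 1)
              * LateralCauchy.weightedError Ω x₀ b β lam (u 1) uStar) ∧
        (C M Q / lam ^ 3 < 1 →
          (∃ K : ℝ, ∀ k : ℕ, 1 ≤ k →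
            ∑ m, ∫ x in Ω, (u k m x - uStar m x) ^ 2 ≤ K * (C M Q / lam ^ 3) ^ (k - 1)) ∧
          Tendsto
            (fun k : ℕ => eLpNorm
              (fun x => LateralCauchy.expand Ψ (u k) x 0 - LateralCauchy.expand Ψ uStar x 0) 2
              (volume.restrict Ω))
            atTop (𝓝 0)) := by
  -- `β ≥ 2` is what makes the weight a convex function of `r²`.
  refine ⟨2, two_pos, fun β hβ => ?_⟩
  obtain ⟨κ, lam₁, hκ, hlam₁, hcarl⟩ :=
    LateralCauchy.carleman_of_isExtLaplacian hβ hΩo hΩb x₀ hx₀ hb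
  -- One step gives the factor `16 Q² / (κ λ³)`; the summand 1 keeps `C` positive when `Q = 0`.
  refine ⟨fun _ Q => 16 * Q ^ 2 / κ + 1, fun _ Q => by positivity, fun Ψ hΨ c₁ => ?_⟩
  set S := ∑ m : Fin N, ∑ n : Fin N, LateralCauchy.sCoef T Ψ m n ^ 2 with hS
  have hS0 : 0 ≤ S := Finset.sum_nonneg fun m _ => Finset.sum_nonneg fun n _ => sq_nonneg _
  -- The three thresholds: validity of the Carleman estimate, `λ ≤ λ³`, and absorption of the
  -- coupling, `4 c₁² S ≤ κ λ³`.
  refine ⟨max lam₁ (max 1 (4 * c₁ ^ 2 * S / κ)), lt_max_of_lt_left hlam₁, ?_⟩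
  intro c c₀ hcd hc₀ hc0 hc1 q hq f g _ _ uStar hsol _ M Q hM hQ lam hlam
  have hlam1 : 1 ≤ lam := (le_max_left _ _).trans ((le_max_right _ _).trans hlam)
  have hlam0 : 0 < lam := one_pos.trans_le hlam1
  have hβ0 : 0 ≤ β := by linarith
  have hm := hΩo.measurableSet
  have hc : Continuous c := hcd.continuous
  have hcabs : ∀ x ∈ Ω, |c x| ≤ c₁ := fun x hx => by
    rw [abs_of_nonneg (hc₀.le.trans (hc0 x))]
    exact hc1 x hx
  have hA0 : 0 < κ * lam ^ 3 := by positivity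
  have hA : 4 * c₁ ^ 2 * S ≤ κ * lam ^ 3 := by
    have h1 : 4 * c₁ ^ 2 * S / κ ≤ lam := (le_max_right _ _).trans ((le_max_right _ _).trans hlam)
    rw [div_le_iff₀ hκ] at h1
    calc 4 * c₁ ^ 2 * S ≤ lam * κ := h1
      _ ≤ lam ^ 3 * κ := by
        gcongr
        exact le_self_pow₀ hlam1 (by norm_num)
      _ = κ * lam ^ 3 := mul_comm _ _
  have hcarl' := hcarl lam ((le_max_left _ _).trans hlam)
  have hM0 : 0 ≤ M := by
    by_contra hneg
    rw [ENNReal.ofReal_eq_zero.2 (not_le.1 hneg).le] at hM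
    exact absurd hM not_lt_zero
  have hw1 : ∀ x ∈ Ω, 1 ≤ LateralCauchy.carlemanExp x₀ b β lam x := fun x hx =>
    LateralCauchy.one_le_carlemanExp
      (dist_nonneg.trans (hb x (subset_closure hx)).le) hlam0.le x
  have hbd := LateralCauchy.ae_abs_coef_le hΨ hT hM
  have hmin := fun F hF => LateralCauchy.exists_isMinOn_costJ (T := T) (Ψ := Ψ) (F := F) hΩo hΩb hβ0
    hw1 hc hcabs hA0 hA hcarl' hsol.1 hF
  refine ⟨?_, fun u hu => ?_⟩
  -- The truncated nonlinear term is bounded, hence in `L²`, so a next minimizer always exists; the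
  -- sequence is built by choice and recursion inside the admissible set.
  · have hnext : ∀ v : LateralCauchy.admissible Ω f g, ∃ v' : LateralCauchy.admissible Ω f g,
        IsMinOn (LateralCauchy.costJ Ω T Ψ c x₀ b β lam
          (fun m x => LateralCauchy.qCoef T Ψ q m (fun n => LateralCauchy.cutoff M T (v.1 n x))))
          (LateralCauchy.admissible Ω f g) v'.1 := by
      intro v
      obtain ⟨v', hv', h⟩ := hmin _ (LateralCauchy.memLp_qCoef_cutoff hΨ hT hq hM0 hQ hΩb
        fun n => (v.2 n).1.1.1.aestronglyMeasurable)
      exact ⟨⟨v', hv'⟩, h⟩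
    choose next hnext using hnext
    obtain ⟨v₀, hv₀, h₀⟩ := hmin (fun _ _ => 0) fun _ => MemLp.zero
    let U : ℕ → LateralCauchy.admissible Ω f g := fun k => Nat.rec ⟨v₀, hv₀⟩ (fun _ v => next v) k
    exact ⟨fun k => (U k).1, fun k => (U k).2, h₀, fun k => hnext (U k)⟩
  · have hnn : ∀ k, 0 ≤ LateralCauchy.weightedError Ω x₀ b β lam (u k) uStar := fun k =>
      Finset.sum_nonneg fun m _ => integral_nonneg fun x => sq_nonneg _
    have hr0 : 0 ≤ (16 * Q ^ 2 / κ + 1) / lam ^ 3 := by positivity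
    have hdecay : ∀ k : ℕ, 1 ≤ k → LateralCauchy.weightedError Ω x₀ b β lam (u k) uStar
        ≤ ((16 * Q ^ 2 / κ + 1) / lam ^ 3) ^ (k - 1)
          * LateralCauchy.weightedError Ω x₀ b β lam (u 1) uStar := by
      intro k hk
      induction k, hk using Nat.le_induction with
      | base => simp
      | succ k hk ih =>
        have hstep := LateralCauchy.weightedError_step hΩo hΩb hβ0 hc hcabs hA hcarl' hΨ hT hq hM0
          hQ hsol hbd (hu.mem k) (hu.mem (k + 1)) (hu.isMin_succ k)
        have h1 : LateralCauchy.weightedError Ω x₀ b β lam (u (k + 1)) uStar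
            ≤ (16 * Q ^ 2 / κ + 1) / lam ^ 3
              * LateralCauchy.weightedError Ω x₀ b β lam (u k) uStar := by
          rw [div_mul_eq_mul_div, le_div_iff₀ (by positivity)]
          refine le_of_mul_le_mul_left ?_ hκ
          have e : κ * ((16 * Q ^ 2 / κ + 1) * LateralCauchy.weightedError Ω x₀ b β lam (u k) uStar)
              = 16 * Q ^ 2 * LateralCauchy.weightedError Ω x₀ b β lam (u k) uStar
                + κ * LateralCauchy.weightedError Ω x₀ b β lam (u k) uStar := by
            field_simp
          rw [e]
          have := mul_nonneg hκ.le (hnn k)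
          linarith
        -- Since `k ≥ 1`, the truncated exponent `k - 1` becomes an honest `j`.
        obtain ⟨j, rfl⟩ : ∃ j, k = j + 1 := ⟨k - 1, by omega⟩
        refine h1.trans ((mul_le_mul_of_nonneg_left ih hr0).trans (le_of_eq ?_))
        simp only [Nat.add_sub_cancel]
        ring
    have hH2 := fun k m => (hu.mem k m).1.1.1
    have hSH2 := fun m => (hsol.1 m).1.1.1
    have hL2 : ∀ k : ℕ, 1 ≤ k → ∑ m, ∫ x in Ω, (u k m x - uStar m x) ^ 2
        ≤ LateralCauchy.weightedError Ω x₀ b β lam (u 1) uStar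
          * ((16 * Q ^ 2 / κ + 1) / lam ^ 3) ^ (k - 1) := by
      intro k hk
      rw [mul_comm]
      refine le_trans (Finset.sum_le_sum fun m _ => ?_) (hdecay k hk)
      refine setIntegral_mono_on ((hH2 k m).sub (hSH2 m)).integrable_sq
        (LateralCauchy.memLp_mul_of_continuous hm hΩb
          (LateralCauchy.continuous_carlemanExp hβ0 x₀ b lam)
          ((hH2 k m).sub (hSH2 m))).integrable_sq hm fun x hx => ?_
      rw [mul_pow]
      exact le_mul_of_one_le_left (sq_nonneg _) (one_le_pow₀ (hw1 x hx))
    exact ⟨hdecay, fun hr => ⟨⟨_, hL2⟩,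
      LateralCauchy.tendsto_eLpNorm_expand hH2 hSH2 hr0 hr hL2⟩⟩

end
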